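/- **Setting.** Let $y_i=x_i\beta_i+z_i'\gamma_0+u_i$, $i=1,2,\dots$, with $x_i\in\mathbb R$, $z_i\in\mathbb R^{p}$, $w_i=(x_i,z_i')'$, where $\beta_i$ equals $b_k$ with probability $\pi_k$, $k=1,\dots,K$, $\pi_k\in(0,1)$, $\sum_k\pi_k=1$, $b_1<\dots<b_K$. Here $\beta_i$ is independent of $w_i$, $E u_i=0$, and the vectors $(w_i,\beta_i,u_i)$ are independent (not necessarily identically distributed) over $i$. Put $\xi_i=u_i+x_i(\beta_i-E\beta_i)$, $Q_n=n^{-1}\sum_{i\le n} w_iw_i'$, $q_n=n^{-1}\sum_{i\le n} w_iy_i$, $\hat\phi=Q_n^{-1}q_n$, and let $\hat\gamma$ consist of the last $p$ coordinates of $\hat\phi$. Matrix norms are spectral norms. *Parameters and moment functions.* Let $\theta=(\pi_1,\dots,\pi_{K-1},b_1,\dots,b_K)'$ with $\pi_K=1-\sum_{k<K}\pi_k$, $h_j(\theta)=\sum_{k=1}^K\pi_kb_k^j$, $\sigma=(\sigma_2,\dots,\sigma_{2K-1})'$, $\sigma_0=1$ and $\sigma_1=0$ (as scalars), $\eta=(\theta',\sigma')'$.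 Fix an integer $S$ with $2K-1<S\le 4K-2$. For $r=1,\dots,2K-1$ and $s=0,\dots,S-r$ let $\hat g_n(\theta,\sigma,\gamma)$ have the components $$\frac1n\sum_{i=1}^n\Big[\sum_{q=0}^r\tbinom rq x_i^{r-q+s}\sigma_q h_{r-q}(\theta)-(y_i-z_i'\gamma)^rx_i^s\Big].$$ Assume that the limits $\rho_{r,s}(\gamma)=\lim_n n^{-1}\sum_{i\le n}E[(y_i-z_i'\gamma)^rx_i^s]$ exist for all $\gamma$ and all $0\le r\le 2K-1$, $0\le s\le S-r$, and that the averages $n^{-1}\sum_{i\le n}E(u_i^r)$, $2\le r\le 2K-1$, converge; their limits form the true value of $\sigma$. Let $g_0(\theta,\sigma,\gamma)$ have the components $\sum_{q=0}^r\binom rq\rho_{0,r-q+s}(\gamma)\sigma_qh_{r-q}(\theta)-\rho_{r,s}(\gamma)$. Let $\eta_0=(\theta_0',\sigma_0')'$ denote the true value of $\eta$ (so from here on $\sigma_0$ is the true value of the vector $\sigma$). Let $G_0$ and $G_{0,\gamma}$ be the Jacobian matrices of $g_0$ with respect to $\eta$ and $\gamma$ at $(\eta_0,\gamma_0)$. *Estimator.*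 Given parameter sets $\Theta,\mathcal S$ and random matrices $A_n$, $\hat\eta=(\hat\theta',\hat\sigma')'$ minimizes $\hat g_n(\theta,\sigma,\hat\gamma)'A_n\hat g_n(\theta,\sigma,\hat\gamma)$ over $\theta\in\Theta$, $\sigma\in\mathcal S$. **Assumptions.** 1. (a) $u_i$ is independent of $(w_i,\beta_i)$; $\sup_iE|u_i|^r<\infty$ for $1\le r\le 2K-1$; $n^{-1}\sum_{i\le n} u_i^4=O_p(1)$. (b) $\|E Q_n\|$ and $\|E q_n\|$ are bounded; there are $0<c<C<\infty$ such that almost surely $c<\lambda_{\min}(Q_n)\le\lambda_{\max}(Q_n)<C$ for all large $n$; $\sup_iE\|w_i\|^r<\infty$ for $1\le r\le 4K-2$; $n^{-1}\sum_{i\le n}\|w_i\|^4=O_p(1)$. (c) $\|Q_n-EQ_n\|$ and $\|q_n-Eq_n\|$ are $O_p(n^{-1/2})$, and $EQ_n\succ0$ for all large $n$. (d) $\|EQ_n-Q_{ww}\|$ and $\|Eq_n-q_{wy}\|$ are $O(n^{-1/2})$, for some matrix $Q_{ww}\succ0$ and some vector $q_{wy}$. 2. $\|n^{-1}\sum_{i\le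 n} E(w_iw_i'\xi_i^2)-V_{w\xi}\|=O(n^{-1/2})$ with $V_{w\xi}\succ0$, and $\|n^{-1}\sum_{i\le n}[w_iw_i'\xi_i^2-E(w_iw_i'\xi_i^2)]\|=O_p(n^{-1/2})$. 3. (a) $\Theta$ and $\mathcal S$ are compact, every $\theta\in\Theta$ satisfies $\pi_k\in(0,1)$ for all $k\le K$ and $b_1<\dots<b_K$, and $\theta_0\in\mathrm{int}\,\Theta$, $\sigma_0\in\mathrm{int}\,\mathcal S$. (b) $A_n\to_pA$ with $A$ positive definite. (c) $n^{-1}\sum_{i\le n}[(y_i-z_i'\hat\gamma)^rx_i^s-E((y_i-z_i'\gamma_0)^rx_i^s)]=O_p(n^{-1/2})$ for $0\le r\le 2K-1$, $0\le s\le S-r$. 4. (a) $\sqrt n\,\hat g_n(\theta_0,\sigma_0,\gamma_0)\to_d\zeta\sim N(0,V)$. (b) $G_0'AG_0\succ0$. **Theorem.** Under these assumptions, $\sqrt n(\hat\gamma-\gamma_0)\to_dN(0,V_\gamma)$, where $V_\gamma$ is the lower right $p\times p$ block of $Q_{ww}^{-1}V_{w\xi}Q_{ww}^{-1}$. Moreover,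 whenever $\zeta_\gamma$ is such that $(\zeta,\zeta_\gamma)$ is jointly normal and $$\big(\sqrt n\,\hat g_n(\theta_0,\sigma_0,\gamma_0),\ \sqrt n(\hat\gamma-\gamma_0)\big)\to_d(\zeta,\zeta_\gamma),$$ one has, as $n\to\infty$, $$\sqrt n(\hat\eta-\eta_0)\to_d(G_0'AG_0)^{-1}G_0'A\,(\zeta+G_{0,\gamma}\zeta_\gamma).$$ -/

import Mathlib

open MeasureTheory ProbabilityTheory Filter Topology
open scoped Matrix

noncomputable section

namespace CategoricalRC

/-- Sample average over the first `n` observations. -/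
def avg (n : ℕ) (f : ℕ → ℝ) : ℝ := (n : ℝ)⁻¹ * ∑ i ∈ Finset.range n, f i

/-- `X n = O_p(1)`. -/
def BddInProb {Ω : Type*} [MeasurableSpace Ω] (P : Measure Ω) (X : ℕ → Ω → ℝ) : Prop :=
  ∀ ε : ℝ, 0 < ε → ∃ B : ℝ, ∀ᶠ n in atTop, P {ω | B < |X n ω|} ≤ ENNReal.ofReal ε

/-- `X n = O_p(n^{-1/2})`. -/
def RootNBddInProb {Ω : Type*} [MeasurableSpace Ω] (P : Measure Ω) (X : ℕ → Ω → ℝ) : Prop :=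
  BddInProb P fun n ω => √(n : ℝ) * X n ω

/-- The (deterministic) rate `n^{-1/2}`. -/
def rootRate (n : ℕ) : ℝ := (√(n : ℝ))⁻¹

/-- The ingredients of the regression `y i = x i * β i + z i ' γ + u i`, where `β i` takes the
value `b k` with probability `prob k`. What is required of them is `RCModel.IsModel`. -/
structure RCModel (Ω : Type*) (p K : ℕ) where
  x : ℕ → Ω → ℝ
  z : ℕ → Ω → EuclideanSpace ℝ (Fin p)
  β : ℕ → Ω → ℝ
  u : ℕ → Ω → ℝ
  γ : EuclideanSpace ℝ (Fin p)
  prob : Fin K → ℝ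
  b : Fin K → ℝ

/-- Coordinates of `θ = (π_1, …, π_{K-1}, b_1, …, b_K)`; `π_K` is one minus the others. -/
abbrev ThetaIdx (K : ℕ) := Fin (K - 1) ⊕ Fin K

/-- Coordinates of `σ = (σ_2, …, σ_{2K-1})`. -/
abbrev SigmaIdx (K : ℕ) := Fin (2 * K - 2)

/-- Coordinates of `η = (θ, σ)`. -/
abbrev EtaIdx (K : ℕ) := ThetaIdx K ⊕ SigmaIdx K

/-- The moment conditions: `⟨r', s⟩` stands for the orders `r = r' + 1 ∈ {1, …, 2K-1}` of `y`
and `s ∈ {0, …, S - r}` of `x`. -/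
abbrev MomIdx (K S : ℕ) := Σ r : Fin (2 * K - 1), Fin (S - (r : ℕ))

/-- All `K` category probabilities of `θ`. -/
def probOf {K : ℕ} (θ : EuclideanSpace ℝ (ThetaIdx K)) (k : Fin K) : ℝ :=
  if h : (k : ℕ) < K - 1 then θ (Sum.inl ⟨k, h⟩) else 1 - ∑ j : Fin (K - 1), θ (Sum.inl j)

/-- The support points of `θ`. -/
def suppOf {K : ℕ} (θ : EuclideanSpace ℝ (ThetaIdx K)) (k : Fin K) : ℝ := θ (Sum.inr k)

/-- `θ` describes a `K`-categorical distribution. -/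
def Admissible {K : ℕ} (θ : EuclideanSpace ℝ (ThetaIdx K)) : Prop :=
  (∀ k, 0 < probOf θ k ∧ probOf θ k < 1) ∧ StrictMono (suppOf θ)

/-- `[h(θ)]_j`, the `j`-th moment of the categorical distribution `θ`. -/
def hMom {K : ℕ} (θ : EuclideanSpace ℝ (ThetaIdx K)) (j : ℕ) : ℝ :=
  ∑ k : Fin K, probOf θ k * suppOf θ k ^ j

/-- `σ_q` for all `q ≤ 2K-1`, with `σ_0 = 1` and `σ_1 = 0` (zero beyond, which is never used). -/
def sigmaExt {K : ℕ} (σ : EuclideanSpace ℝ (SigmaIdx K)) (q : ℕ) : ℝ :=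
  if q = 0 then 1 else if h : 2 ≤ q ∧ q - 2 < 2 * K - 2 then σ ⟨q - 2, h.2⟩ else 0

/-- `η = (θ', σ')'`. -/
def stack {K : ℕ} (θ : EuclideanSpace ℝ (ThetaIdx K)) (σ : EuclideanSpace ℝ (SigmaIdx K)) :
    EuclideanSpace ℝ (EtaIdx K) :=
  WithLp.toLp 2 (Sum.elim (fun j => θ j) (fun j => σ j))

def thetaPart {K : ℕ} (η : EuclideanSpace ℝ (EtaIdx K)) : EuclideanSpace ℝ (ThetaIdx K) :=
  WithLp.toLp 2 fun j => η (Sum.inl j)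

def sigmaPart {K : ℕ} (η : EuclideanSpace ℝ (EtaIdx K)) : EuclideanSpace ℝ (SigmaIdx K) :=
  WithLp.toLp 2 fun j => η (Sum.inr j)

/-- Matrix of the derivative of `f` at `a`. -/
def jacobian {ι κ : Type*} [Fintype ι] [DecidableEq ι] [Fintype κ]
    (f : EuclideanSpace ℝ ι → EuclideanSpace ℝ κ) (a : EuclideanSpace ℝ ι) : Matrix κ ι ℝ :=
  Matrix.of fun k i => fderiv ℝ f a (EuclideanSpace.single i 1) k

/-- `A v` on Euclidean vectors. -/
def mulE {ι κ : Type*} [Fintype ι] (A : Matrix κ ι ℝ) (v : EuclideanSpace ℝ ι) :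
    EuclideanSpace ℝ κ :=
  WithLp.toLp 2 (A *ᵥ v.ofLp)

namespace RCModel

variable {Ω : Type*} {p K : ℕ} (M : RCModel Ω p K)

def y (i : ℕ) (ω : Ω) : ℝ := M.x i ω * M.β i ω + inner ℝ (M.z i ω) M.γ + M.u i ω

/-- `w i = (x i, z i')'`. -/
def w (i : ℕ) (ω : Ω) : EuclideanSpace ℝ (Fin (p + 1)) :=
  WithLp.toLp 2 (Fin.cons (M.x i ω) (fun j => M.z i ω j))

/-- `y i - z i ' g`, for an arbitrary coefficient vector `g`. -/
def ytilde (g : EuclideanSpace ℝ (Fin p)) (i : ℕ) (ω : Ω) : ℝ := M.y i ω - inner ℝ (M.z i ω) g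

/-- `E(β i)`. -/
def meanβ : ℝ := ∑ k, M.prob k * M.b k

/-- `ξ i = u i + x i * (β i - E(β i))`. -/
def ξ (i : ℕ) (ω : Ω) : ℝ := M.u i ω + M.x i ω * (M.β i ω - M.meanβ)

/-- The true value of `θ`. -/
def θ₀ : EuclideanSpace ℝ (ThetaIdx K) :=
  WithLp.toLp 2 (Sum.elim (fun j => M.prob ⟨j, by omega⟩) M.b)

/-- `Q_{n,ww}`. -/
def Q (n : ℕ) (ω : Ω) : Matrix (Fin (p + 1)) (Fin (p + 1)) ℝ :=
  Matrix.of fun a b => avg n fun i => M.w i ω a * M.w i ω b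

/-- `q_{n,wy}`. -/
def q (n : ℕ) (ω : Ω) : EuclideanSpace ℝ (Fin (p + 1)) :=
  WithLp.toLp 2 fun a => avg n fun i => M.w i ω a * M.y i ω

/-- The least squares estimator `Q_{n,ww}⁻¹ q_{n,wy}` of `φ = (E(β i), γ')'`. -/
def φhat (n : ℕ) (ω : Ω) : EuclideanSpace ℝ (Fin (p + 1)) := mulE (M.Q n ω)⁻¹ (M.q n ω)

def γhat (n : ℕ) (ω : Ω) : EuclideanSpace ℝ (Fin p) :=
  WithLp.toLp 2 fun j => M.φhat n ω j.succ

/-- `n⁻¹ ∑ w i w i' ξ i ^ 2`. -/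
def Wξ (n : ℕ) (ω : Ω) : Matrix (Fin (p + 1)) (Fin (p + 1)) ℝ :=
  Matrix.of fun a b => avg n fun i => M.w i ω a * M.w i ω b * M.ξ i ω ^ 2

/-- The sample moment function `ĝ_n(θ, σ, γ)` at an arbitrary parameter value. -/
def ghat (S n : ℕ) (ω : Ω) (θ : EuclideanSpace ℝ (ThetaIdx K)) (σ : EuclideanSpace ℝ (SigmaIdx K))
    (g : EuclideanSpace ℝ (Fin p)) : EuclideanSpace ℝ (MomIdx K S) :=
  WithLp.toLp 2 fun rs =>
    let r : ℕ := (rs.1 : ℕ) + 1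
    let s : ℕ := (rs.2 : ℕ)
    avg n fun i =>
      (∑ t ∈ Finset.range (r + 1),
        (r.choose t : ℝ) * M.x i ω ^ (r - t + s) * sigmaExt σ t * hMom θ (r - t))
      - M.ytilde g i ω ^ r * M.x i ω ^ s

/-- The GMM criterion `ĝ_n' A_n ĝ_n` evaluated at `γhat`. -/
def criterion (S n : ℕ) (ω : Ω) (A : Matrix (MomIdx K S) (MomIdx K S) ℝ)
    (θ : EuclideanSpace ℝ (ThetaIdx K)) (σ : EuclideanSpace ℝ (SigmaIdx K)) : ℝ :=
  let v := (M.ghat S n ω θ σ (M.γhat n ω)).ofLp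
  v ⬝ᵥ (A *ᵥ v)

variable [MeasurableSpace Ω] (P : Measure Ω)

def meanQ (n : ℕ) : Matrix (Fin (p + 1)) (Fin (p + 1)) ℝ :=
  Matrix.of fun a b => avg n fun i => ∫ ω, M.w i ω a * M.w i ω b ∂P

def meanq (n : ℕ) : EuclideanSpace ℝ (Fin (p + 1)) :=
  WithLp.toLp 2 fun a => avg n fun i => ∫ ω, M.w i ω a * M.y i ω ∂P

def meanWξ (n : ℕ) : Matrix (Fin (p + 1)) (Fin (p + 1)) ℝ :=
  Matrix.of fun a b => avg n fun i => ∫ ω, M.w i ω a * M.w i ω b * M.ξ i ω ^ 2 ∂P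

/-- The categorical random coefficient model: `β i` is `K`-categorical and independent of `w i`,
the errors have mean zero, and the observations are independent (but not necessarily identically
distributed) across `i`. -/
structure IsModel : Prop where
  meas_x : ∀ i, Measurable (M.x i)
  meas_z : ∀ i, Measurable (M.z i)
  meas_β : ∀ i, Measurable (M.β i)
  meas_u : ∀ i, Measurable (M.u i)
  prob_mem : ∀ k, 0 < M.prob k ∧ M.prob k < 1
  prob_sum : ∑ k, M.prob k = 1
  b_mono : StrictMono M.b
  law_β : ∀ i k, P {ω | M.β i ω = M.b k} = ENNReal.ofReal (M.prob k)
  β_indep_w : ∀ i, IndepFun (M.β i) (fun ω => (M.x i ω, M.z i ω)) P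
  mean_u : ∀ i, ∫ ω, M.u i ω ∂P = 0
  indep : iIndepFun (fun i ω => (M.x i ω, M.z i ω, M.β i ω, M.u i ω)) P

section MatrixNorm

open scoped Matrix.Norms.L2Operator

/-- Regularity of errors and regressors. Matrix norms are spectral norms; the bounds on the extreme
eigenvalues of `Q_{n,ww}` are written `c I ≺ Q_{n,ww} ≺ C I`. -/
structure Regularity (Qww : Matrix (Fin (p + 1)) (Fin (p + 1)) ℝ)
    (qwy : EuclideanSpace ℝ (Fin (p + 1))) : Prop where
  u_indep : ∀ i, IndepFun (M.u i) (fun ω => (M.x i ω, M.z i ω, M.β i ω)) P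
  u_moments : ∃ C : ℝ, ∀ i, ∀ r ∈ Finset.Icc 1 (2 * K - 1),
    Integrable (fun ω => |M.u i ω| ^ r) P ∧ ∫ ω, |M.u i ω| ^ r ∂P < C
  u_four : BddInProb P fun n ω => avg n fun i => M.u i ω ^ 4
  meanQ_bdd : ∃ C : ℝ, ∀ n, ‖M.meanQ P n‖ < C ∧ ‖M.meanq P n‖ < C
  Q_eig : ∃ c C : ℝ, 0 < c ∧ ∀ᵐ ω ∂P, ∀ᶠ n in atTop,
    (M.Q n ω - c • (1 : Matrix (Fin (p + 1)) (Fin (p + 1)) ℝ)).PosDef ∧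
    (C • (1 : Matrix (Fin (p + 1)) (Fin (p + 1)) ℝ) - M.Q n ω).PosDef
  w_moments : ∃ C : ℝ, ∀ i, ∀ r ∈ Finset.Icc 1 (4 * K - 2),
    Integrable (fun ω => ‖M.w i ω‖ ^ r) P ∧ ∫ ω, ‖M.w i ω‖ ^ r ∂P < C
  w_four : BddInProb P fun n ω => avg n fun i => ‖M.w i ω‖ ^ 4
  Q_lln : RootNBddInProb P fun n ω => ‖M.Q n ω - M.meanQ P n‖
  q_lln : RootNBddInProb P fun n ω => ‖M.q n ω - M.meanq P n‖
  meanQ_pos : ∀ᶠ n in atTop, (M.meanQ P n).PosDef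
  meanQ_lim : (fun n => ‖M.meanQ P n - Qww‖) =O[atTop] rootRate
  meanq_lim : (fun n => ‖M.meanq P n - qwy‖) =O[atTop] rootRate
  Qww_pos : Qww.PosDef

/-- Condition on the variance of `w i ξ i`, for the estimation of `γ`. -/
structure ScoreVariance (Vwξ : Matrix (Fin (p + 1)) (Fin (p + 1)) ℝ) : Prop where
  lim : (fun n => ‖M.meanWξ P n - Vwξ‖) =O[atTop] rootRate
  pos : Vwξ.PosDef
  lln : RootNBddInProb P fun n ω => ‖M.Wξ n ω - M.meanWξ P n‖

end MatrixNorm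

/-- `ρ_{r,s}(g)` is the limit of `n⁻¹ ∑ E((y i - z i ' g) ^ r x i ^ s)`, for all the orders that
occur in the moment conditions and all coefficient vectors `g`. -/
def IsPopMoment (S : ℕ) (ρ : ℕ → ℕ → EuclideanSpace ℝ (Fin p) → ℝ) : Prop :=
  ∀ r s : ℕ, r ≤ 2 * K - 1 → r + s ≤ S → ∀ g,
    Tendsto (fun n => avg n fun i => ∫ ω, M.ytilde g i ω ^ r * M.x i ω ^ s ∂P) atTop
      (𝓝 (ρ r s g))

/-- `σ₀` is the vector of limits of the averaged error moments of orders `2, …, 2K-1`. -/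
def IsErrorMoment (σ₀ : EuclideanSpace ℝ (SigmaIdx K)) : Prop :=
  ∀ j : SigmaIdx K,
    Tendsto (fun n => avg n fun i => ∫ ω, M.u i ω ^ ((j : ℕ) + 2) ∂P) atTop (𝓝 (σ₀ j))

/-- Conditions on the parameter space, the weighting matrices and the sample moments. -/
structure GMMConditions (S : ℕ) (Θ : Set (EuclideanSpace ℝ (ThetaIdx K)))
    (Sig : Set (EuclideanSpace ℝ (SigmaIdx K))) (σ₀ : EuclideanSpace ℝ (SigmaIdx K))
    (An : ℕ → Ω → Matrix (MomIdx K S) (MomIdx K S) ℝ)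
    (A : Matrix (MomIdx K S) (MomIdx K S) ℝ) : Prop where
  Θ_compact : IsCompact Θ
  Θ_admissible : ∀ θ ∈ Θ, Admissible θ
  Sig_compact : IsCompact Sig
  θ₀_int : M.θ₀ ∈ interior Θ
  σ₀_int : σ₀ ∈ interior Sig
  An_meas : ∀ n a b, AEMeasurable (fun ω => An n ω a b) P
  An_lim : ∀ a b, TendstoInMeasure P (fun n ω => An n ω a b) atTop (fun _ => A a b)
  A_pos : A.PosDef
  moment_lln : ∀ r s : ℕ, r ≤ 2 * K - 1 → r + s ≤ S →
    RootNBddInProb P fun n ω => avg n fun i =>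
      M.ytilde (M.γhat n ω) i ω ^ r * M.x i ω ^ s - ∫ ω', M.ytilde M.γ i ω' ^ r * M.x i ω' ^ s ∂P

/-- `(θhat, σhat)` is the GMM estimator: a measurable minimizer of the criterion. -/
structure IsGMM (S : ℕ) (Θ : Set (EuclideanSpace ℝ (ThetaIdx K)))
    (Sig : Set (EuclideanSpace ℝ (SigmaIdx K)))
    (An : ℕ → Ω → Matrix (MomIdx K S) (MomIdx K S) ℝ)
    (θhat : ℕ → Ω → EuclideanSpace ℝ (ThetaIdx K))
    (σhat : ℕ → Ω → EuclideanSpace ℝ (SigmaIdx K)) : Prop where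
  meas_θ : ∀ n, AEMeasurable (θhat n) P
  meas_σ : ∀ n, AEMeasurable (σhat n) P
  isMin : ∀ n, ∀ᵐ ω ∂P, θhat n ω ∈ Θ ∧ σhat n ω ∈ Sig ∧
    ∀ θ ∈ Θ, ∀ σ ∈ Sig,
      M.criterion S n ω (An n ω) (θhat n ω) (σhat n ω) ≤ M.criterion S n ω (An n ω) θ σ

end RCModel

/-- The population moment function `g_0(θ, σ, γ)`. -/
def gPop {p K : ℕ} (S : ℕ) (ρ : ℕ → ℕ → EuclideanSpace ℝ (Fin p) → ℝ)
    (θ : EuclideanSpace ℝ (ThetaIdx K)) (σ : EuclideanSpace ℝ (SigmaIdx K))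
    (g : EuclideanSpace ℝ (Fin p)) : EuclideanSpace ℝ (MomIdx K S) :=
  WithLp.toLp 2 fun rs =>
    let r : ℕ := (rs.1 : ℕ) + 1
    let s : ℕ := (rs.2 : ℕ)
    (∑ t ∈ Finset.range (r + 1),
      (r.choose t : ℝ) * ρ 0 (r - t + s) g * sigmaExt σ t * hMom θ (r - t)) - ρ r s g

/-- `G_0`, the derivative of `g_0` in `η = (θ, σ)`. -/
def GEta {p K : ℕ} (S : ℕ) (ρ : ℕ → ℕ → EuclideanSpace ℝ (Fin p) → ℝ)
    (θ : EuclideanSpace ℝ (ThetaIdx K)) (σ : EuclideanSpace ℝ (SigmaIdx K))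
    (g : EuclideanSpace ℝ (Fin p)) : Matrix (MomIdx K S) (EtaIdx K) ℝ :=
  jacobian (fun η => gPop S ρ (thetaPart η) (sigmaPart η) g) (stack θ σ)

/-- `G_{0,γ}`, the derivative of `g_0` in `γ`. -/
def GGamma {p K : ℕ} (S : ℕ) (ρ : ℕ → ℕ → EuclideanSpace ℝ (Fin p) → ℝ)
    (θ : EuclideanSpace ℝ (ThetaIdx K)) (σ : EuclideanSpace ℝ (SigmaIdx K))
    (g : EuclideanSpace ℝ (Fin p)) : Matrix (MomIdx K S) (Fin p) ℝ :=
  jacobian (fun g' => gPop S ρ θ σ g') g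

end CategoricalRC

end

open CategoricalRC

/-! Convergence in probability is treated as convergence along a filter `whp P` on `ℕ × Ω`, whose
members are the events with probability tending to one. The `O_p` and `o_p` calculus becomes Landau
calculus along this filter, so consistency and the expansion of the estimator reduce to arguments
about filters, compactness and derivatives. Probability enters through a central limit theorem, a
weak law of large numbers and its converse.

Least squares. With `ξ` as error, `γhat - γ` consists of the last rows of `Q_n⁻¹` times the average
score. Since some `π_k` lies strictly below one in any model, `K ≥ 2`, hence `2K-1 ≥ 3` and `4K-2 ≥
6`: the score has bounded third moments, the central limit theorem applies to it, and `Q_n⁻¹` may be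
replaced by its limit.

Identification. Only the rank of `G₀` at the truth is assumed, yet consistency needs `g₀(θ, σ, γ₀) =
0` to have a single solution. Write `m j` for the limiting averaged moments of `x`. Order by order,
the equations determine `h_r` and `σ_r` together unless `m (r+s) = m r * m s` for all admissible `s`
(`eq_of_momSum_eq`). If the moments factor in this way at some order, a correlation inequality shows
that `x²` is asymptotically a constant `A`, that is `m (j+2) = A * m j`
(`exists_moments_eq_of_factor`). But then variance can be moved from `u` to `x β` without changing
the equations to first order, and `G₀` has a kernel (`exists_hasDerivAt_momSum_eq_zero`), against
the rank condition. Finally `h` determines `θ` by testing with polynomials that vanish at all atoms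
but one (`eq_of_hMom_eq`).

Dependence on `γ`. The expansion at `γhat` needs a law of large numbers for averages of `(y - z'γ)^r
x^s z_j`. At the top order `S = 4K-2` the moments are merely bounded, without uniform integrability.
The assumed convergence for `x^S` supplies what is missing: for independent nonnegative summands
with bounded means, the weak law implies negligibility of the summands
(`negligible_of_tendsto_avg_sub`), and this passes to the gradient terms by domination.

Limit law. A deterministic lemma on minimum distance estimators (`isLittleO_argmin_sub`) gives `ηhat
- η₀ = -L ĝ(γhat)` up to smaller order, with `L = (G₀'AG₀)⁻¹G₀'A`, and `ĝ(γhat)` expands into `ĝ(γ₀)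
+ G_{0,γ}(γhat - γ₀)`. The minus sign disappears in the limit because a centered normal law is
symmetric. -/

noncomputable section

namespace CategoricalRC

/-! ### Convergence and boundedness in probability through a filter -/

section WithHighProbability

variable {Ω : Type*} [MeasurableSpace Ω] {P : Measure Ω}

/-- The filter of events that hold with probability tending to one: convergence along `whp P` is
convergence in probability. -/
def whp (P : Measure Ω) : Filter (ℕ × Ω) where
  sets := {E | Tendsto (fun n => P {ω | (n, ω) ∉ E}) atTop (𝓝 0)}
  univ_sets := by simp
  sets_of_superset := by
    intro E F hE hEF
    refine tendsto_of_tendsto_of_tendsto_of_le_of_le tendsto_const_nhds hE (fun _ => zero_le)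
      fun n => measure_mono fun ω hω h => hω (hEF h)
  inter_sets := by
    intro E F hE hF
    have h := Tendsto.add hE hF
    rw [add_zero] at h
    refine tendsto_of_tendsto_of_tendsto_of_le_of_le tendsto_const_nhds h (fun _ => zero_le)
      fun n => ?_
    refine (measure_mono ?_).trans (measure_union_le _ _)
    intro ω hω
    by_cases h1 : (n, ω) ∈ E
    · exact Or.inr fun h2 => hω ⟨h1, h2⟩
    · exact Or.inl h1

lemma eventually_whp {p : ℕ × Ω → Prop} :
    (∀ᶠ a in whp P, p a) ↔ Tendsto (fun n => P {ω | ¬ p (n, ω)}) atTop (𝓝 0) := Iff.rfl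

lemma eventually_whp_of_forall_ae {p : ℕ → Ω → Prop} (h : ∀ n, ∀ᵐ ω ∂P, p n ω) :
    ∀ᶠ a in whp P, p a.1 a.2 := by
  rw [eventually_whp]
  have : ∀ n, P {ω | ¬ p n ω} = 0 := fun n => h n
  simp [this]

lemma tendsto_fst_whp : Tendsto Prod.fst (whp P) atTop := by
  refine tendsto_atTop.2 fun N => eventually_whp.2 ?_
  refine tendsto_const_nhds.congr' ?_
  filter_upwards [eventually_ge_atTop N] with n hn
  simp [not_lt.2 hn]

/-- Makes limits in probability unique, which later forces the population moments to vanish at the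
truth. -/
instance whp_neBot [IsProbabilityMeasure P] : (whp P).NeBot := by
  refine ⟨fun h => ?_⟩
  have : ∀ᶠ _ in whp P, False := by rw [h]; exact eventually_bot
  rw [eventually_whp] at this
  simp at this

lemma tendsto_whp_iff {E : Type*} [PseudoMetricSpace E] {X : ℕ → Ω → E} {c : E} :
    Tendsto (fun a : ℕ × Ω => X a.1 a.2) (whp P) (𝓝 c) ↔
      TendstoInMeasure P X atTop (fun _ => c) := by
  rw [tendstoInMeasure_iff_dist, Metric.tendsto_nhds]
  refine forall_congr' fun ε => ?_
  simp only [gt_iff_lt, eventually_whp, not_lt]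

/-- Split at a level that `X` exceeds with small probability; below it, `Y` only has to be smaller
than `δ` divided by that level. -/
lemma BddInProb.mul_tendsto_zero {X : ℕ → Ω → ℝ} (hX : BddInProb P X) {Y : ℕ × Ω → ℝ}
    (hY : Tendsto Y (whp P) (𝓝 0)) :
    Tendsto (fun a => X a.1 a.2 * Y a) (whp P) (𝓝 0) := by
  rw [Metric.tendsto_nhds]
  intro δ hδ
  rw [eventually_whp, ENNReal.tendsto_nhds_zero]
  intro ε hε
  obtain ⟨ε', hε', hεε⟩ : ∃ ε' : ℝ, 0 < ε' ∧ ENNReal.ofReal ε' + ENNReal.ofReal ε' ≤ ε := by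
    obtain ⟨e, he0, he⟩ := ENNReal.lt_iff_exists_real_btwn.1 hε
    refine ⟨e / 2, ?_, ?_⟩
    · have := ENNReal.ofReal_pos.1 he.1
      linarith
    · rw [← ENNReal.ofReal_add (by linarith) (by linarith), add_halves]
      exact he.2.le
  obtain ⟨B, hB⟩ := hX ε' hε'
  set B' := max B 1
  have hB' : 0 < B' := lt_max_of_lt_right one_pos
  have h2 := (Metric.tendsto_nhds.1 hY (δ / B') (by positivity))
  rw [eventually_whp, ENNReal.tendsto_nhds_zero] at h2
  filter_upwards [hB, h2 _ (ENNReal.ofReal_pos.2 hε')] with n h1 h2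
  refine le_trans ((measure_mono ?_).trans (measure_union_le _ _)) ((add_le_add h1 h2).trans hεε)
  intro ω hω
  simp only [dist_zero_right, Real.norm_eq_abs, not_lt, Set.mem_ofPred_eq, Set.mem_union] at hω ⊢
  by_contra hcon
  push Not at hcon
  have h3 : |X n ω| ≤ B' := hcon.1.trans (le_max_left _ _)
  have : |X n ω * Y (n, ω)| < δ := by
    rw [abs_mul]
    calc |X n ω| * |Y (n, ω)| ≤ B' * |Y (n, ω)| := by gcongr
      _ < B' * (δ / B') := by gcongr; exact hcon.2
      _ = δ := by field_simp
  linarith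

lemma tendsto_inv_sqrt_whp : Tendsto (fun a : ℕ × Ω => (√(a.1 : ℝ))⁻¹) (whp P) (𝓝 0) :=
  (tendsto_inv_atTop_zero.comp <| Real.tendsto_sqrt_atTop.comp
    tendsto_natCast_atTop_atTop).comp tendsto_fst_whp

lemma eventually_pos_whp : ∀ᶠ a : ℕ × Ω in whp P, 0 < a.1 :=
  tendsto_fst_whp.eventually (eventually_gt_atTop 0)

lemma RootNBddInProb.tendsto_zero {X : ℕ → Ω → ℝ} (hX : RootNBddInProb P X) :
    Tendsto (fun a : ℕ × Ω => X a.1 a.2) (whp P) (𝓝 0) := by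
  refine (BddInProb.mul_tendsto_zero hX tendsto_inv_sqrt_whp).congr' ?_
  filter_upwards [eventually_pos_whp] with a ha
  have : √(a.1 : ℝ) ≠ 0 := by positivity
  field_simp

lemma BddInProb.of_integral_le {X : ℕ → Ω → ℝ} {C : ℝ}
    (hX : ∀ᶠ n in atTop, Integrable (X n) P) (hC : ∀ᶠ n in atTop, ∫ ω, |X n ω| ∂P ≤ C) :
    BddInProb P X := by
  intro ε hε
  -- Markov's inequality; `|C| + 1` in place of `C` keeps the level positive.
  refine ⟨(|C| + 1) / ε, ?_⟩
  filter_upwards [hX, hC] with n h1 h2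
  have hB : 0 < (|C| + 1) / ε := by positivity
  have h3 : ENNReal.ofReal ((|C| + 1) / ε) * P {ω | ENNReal.ofReal ((|C| + 1) / ε) ≤ ‖X n ω‖ₑ} ≤
      ∫⁻ ω, ‖X n ω‖ₑ ∂P := mul_meas_ge_le_lintegral₀ h1.1.enorm _
  have h4 : ∫⁻ ω, ‖X n ω‖ₑ ∂P ≤ ENNReal.ofReal (|C| + 1) := by
    rw [← ofReal_integral_norm_eq_lintegral_enorm h1]
    refine ENNReal.ofReal_le_ofReal ?_
    simp only [Real.norm_eq_abs]
    linarith [le_abs_self C]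
  have h5 : P {ω | (|C| + 1) / ε < |X n ω|} ≤
      P {ω | ENNReal.ofReal ((|C| + 1) / ε) ≤ ‖X n ω‖ₑ} := by
    refine measure_mono fun ω hω => ?_
    simp only [Set.mem_ofPred_eq] at hω ⊢
    rw [Real.enorm_eq_ofReal_abs]
    exact ENNReal.ofReal_le_ofReal hω.le
  refine h5.trans ?_
  rw [← ENNReal.mul_le_mul_iff_right (a := ENNReal.ofReal ((|C| + 1) / ε))
    (ENNReal.ofReal_pos.2 hB).ne' ENNReal.ofReal_ne_top, ← ENNReal.ofReal_mul hB.le]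
  refine (h3.trans h4).trans (ENNReal.ofReal_le_ofReal ?_)
  field_simp
  exact le_rfl

lemma tendsto_whp_zero_of_integral_abs {X : ℕ → Ω → ℝ}
    (hX : ∀ᶠ n in atTop, Integrable (X n) P)
    (hC : Tendsto (fun n => ∫ ω, |X n ω| ∂P) atTop (𝓝 0)) :
    Tendsto (fun a : ℕ × Ω => X a.1 a.2) (whp P) (𝓝 0) := by
  rw [Metric.tendsto_nhds]
  intro δ hδ
  rw [eventually_whp]
  have h0 : Tendsto (fun n => ENNReal.ofReal (δ⁻¹ * ∫ ω, |X n ω| ∂P)) atTop (𝓝 0) := by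
    have := ENNReal.tendsto_ofReal (hC.const_mul δ⁻¹)
    simpa using this
  refine tendsto_of_tendsto_of_tendsto_of_le_of_le' tendsto_const_nhds h0
    (Eventually.of_forall fun _ => zero_le) ?_
  filter_upwards [hX] with n h1
  have h3 : ENNReal.ofReal δ * P {ω | ENNReal.ofReal δ ≤ ‖X n ω‖ₑ} ≤
      ∫⁻ ω, ‖X n ω‖ₑ ∂P := mul_meas_ge_le_lintegral₀ h1.1.enorm _
  rw [← ofReal_integral_norm_eq_lintegral_enorm h1] at h3
  have h5 : P {ω | ¬ dist (X n ω) 0 < δ} ≤ P {ω | ENNReal.ofReal δ ≤ ‖X n ω‖ₑ} := by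
    refine measure_mono fun ω hω => ?_
    simp only [Set.mem_ofPred_eq, dist_zero_right, not_lt] at hω ⊢
    rw [← ofReal_norm]
    exact ENNReal.ofReal_le_ofReal hω
  refine h5.trans ?_
  rw [← ENNReal.mul_le_mul_iff_right (a := ENNReal.ofReal δ)
    (ENNReal.ofReal_pos.2 hδ).ne' ENNReal.ofReal_ne_top, ← ENNReal.ofReal_mul hδ.le]
  refine h3.trans (ENNReal.ofReal_le_ofReal ?_)
  rw [mul_inv_cancel_left₀ hδ.ne']
  exact le_rfl

/-- The closed sets `{k ≤ ‖x‖}` decrease to the empty set, so one of them has limit mass below `ε`,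
and the portmanteau bound for closed sets passes this on to the sequence. -/
lemma bddInProb_norm_of_tendstoInDistribution {Ω' E : Type*} [MeasurableSpace Ω']
    {P' : Measure Ω'} [IsProbabilityMeasure P] [IsProbabilityMeasure P'] [NormedAddCommGroup E]
    [MeasurableSpace E] [BorelSpace E] {X : ℕ → Ω → E} {Z : Ω' → E}
    (h : TendstoInDistribution X atTop Z (fun _ => P) P') :
    BddInProb P fun n ω => ‖X n ω‖ := by
  intro ε hε
  have := Measure.isProbabilityMeasure_map (μ := P') h.aemeasurable_limit
  have hF : ∀ k : ℕ, IsClosed {x : E | (k : ℝ) ≤ ‖x‖} := fun k =>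
    isClosed_le continuous_const continuous_norm
  have h1 : Tendsto (fun k : ℕ => P'.map Z {x : E | (k : ℝ) ≤ ‖x‖}) atTop (𝓝 0) := by
    have h2 := tendsto_measure_iInter_atTop (μ := P'.map Z)
      (s := fun k : ℕ => {x : E | (k : ℝ) ≤ ‖x‖})
      (fun k => (hF k).measurableSet.nullMeasurableSet)
      (fun k l hkl x (hx : (l : ℝ) ≤ ‖x‖) => (Nat.cast_le.2 hkl).trans hx) ⟨0, measure_ne_top _ _⟩
    have h3 : ⋂ k : ℕ, {x : E | (k : ℝ) ≤ ‖x‖} = ∅ := by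
      ext x
      simp only [Set.mem_iInter, Set.mem_ofPred_eq, Set.mem_empty_iff_false, iff_false, not_forall,
        not_le]
      exact exists_nat_gt ‖x‖
    rw [h3, measure_empty] at h2
    exact h2
  obtain ⟨k, hk⟩ := (h1.eventually (gt_mem_nhds (ENNReal.ofReal_pos.2 hε))).exists
  have h4 := ProbabilityMeasure.limsup_measure_closed_le_of_tendsto h.tendsto (hF k)
  refine ⟨k, ?_⟩
  have h5 := Filter.eventually_lt_of_limsup_lt (lt_of_le_of_lt h4 hk)
  filter_upwards [h5] with n hn
  refine le_trans (measure_mono ?_) ((Measure.le_map_apply (h.forall_aemeasurable n) _).trans hn.le)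
  intro ω hω
  simp only [Set.mem_ofPred_eq, abs_norm, Set.mem_preimage] at hω ⊢
  exact hω.le

end WithHighProbability

/-! ### A central limit theorem for independent vectors -/

section CentralLimit

lemma norm_prod_sub_prod_le_sum (n : ℕ) (a b : ℕ → ℂ) (ha : ∀ i, ‖a i‖ ≤ 1)
    (hb : ∀ i, ‖b i‖ ≤ 1) :
    ‖∏ i ∈ Finset.range n, a i - ∏ i ∈ Finset.range n, b i‖ ≤
      ∑ i ∈ Finset.range n, ‖a i - b i‖ := by
  induction n with
  | zero => simp
  | succ n ih =>
    rw [Finset.prod_range_succ, Finset.prod_range_succ, Finset.sum_range_succ]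
    have h1 : ‖∏ i ∈ Finset.range n, b i‖ ≤ 1 := by
      rw [norm_prod]
      exact Finset.prod_le_one (fun _ _ => norm_nonneg _) fun i _ => hb i
    calc ‖(∏ i ∈ Finset.range n, a i) * a n - (∏ i ∈ Finset.range n, b i) * b n‖
        = ‖(∏ i ∈ Finset.range n, a i - ∏ i ∈ Finset.range n, b i) * a n +
            (∏ i ∈ Finset.range n, b i) * (a n - b n)‖ := by ring_nf
      _ ≤ ‖∏ i ∈ Finset.range n, a i - ∏ i ∈ Finset.range n, b i‖ * ‖a n‖ +
            ‖∏ i ∈ Finset.range n, b i‖ * ‖a n - b n‖ := by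
          refine (norm_add_le _ _).trans ?_
          rw [norm_mul, norm_mul]
      _ ≤ (∑ i ∈ Finset.range n, ‖a i - b i‖) * 1 + 1 * ‖a n - b n‖ := by
          gcongr
          exact ha n
      _ = _ := by ring

/-- The constant is crude: for `|x| ≤ 1` the exponential remainder costs `exp 1 < 4`, and for `|x| >
1` the trivial bound `2 + |x| + x² / 2` is already below `4 |x|³`. -/
lemma norm_exp_mul_I_taylor_two (x : ℝ) :
    ‖Complex.exp (x * Complex.I) - (1 + x * Complex.I - x ^ 2 / 2)‖ ≤ 4 * |x| ^ 3 := by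
  rcases le_or_gt |x| 1 with hx | hx
  · have h := Complex.norm_exp_sub_sum_le_norm_mul_exp (x * Complex.I) 3
    simp only [norm_mul, Complex.norm_real, Complex.norm_I, mul_one, Real.norm_eq_abs] at h
    have h2 : ∑ m ∈ Finset.range 3, (x * Complex.I) ^ m / (m.factorial : ℂ) =
        1 + x * Complex.I - x ^ 2 / 2 := by
      simp [Finset.sum_range_succ, mul_pow]
      ring
    rw [h2] at h
    refine h.trans ?_
    have h3 : Real.exp |x| ≤ 4 := by
      have := Real.exp_one_lt_d9
      have := Real.exp_le_exp.2 hx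
      linarith
    calc |x| ^ 3 * Real.exp |x| ≤ |x| ^ 3 * 4 := by gcongr
      _ = _ := by ring
  · have h1 : ‖Complex.exp (x * Complex.I)‖ = 1 := Complex.norm_exp_ofReal_mul_I x
    have h2 : ‖(1 + x * Complex.I - x ^ 2 / 2 : ℂ)‖ ≤ 1 + |x| + |x| ^ 2 / 2 := by
      refine (norm_sub_le _ _).trans (add_le_add ((norm_add_le _ _).trans ?_) ?_)
      · simp
      · simp
    refine (norm_sub_le _ _).trans ?_
    rw [h1]
    nlinarith [sq_nonneg (|x| - 1), pow_pos (lt_trans one_pos hx) 2, pow_pos (lt_trans one_pos hx) 3]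

lemma abs_exp_neg_sub_le {x : ℝ} (hx : 0 ≤ x) : |Real.exp (-x) - (1 - x)| ≤ x ^ 2 := by
  have h1 : 1 - x ≤ Real.exp (-x) := by linarith [Real.add_one_le_exp (-x)]
  rw [abs_of_nonneg (by linarith)]
  rcases le_or_gt x 1 with h | h
  · have := Real.norm_exp_sub_one_sub_id_le (x := -x) (by simpa [abs_of_nonneg hx] using h)
    rw [Real.norm_eq_abs, Real.norm_eq_abs, abs_neg, sq_abs] at this
    linarith [(abs_le.1 this).2]
  · have : Real.exp (-x) ≤ 1 := Real.exp_le_one_iff.2 (by linarith)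
    nlinarith

variable {Ω : Type*} [MeasurableSpace Ω] {P : Measure Ω} [IsProbabilityMeasure P]

lemma integrable_pow_of_integrable_pow_three {Y : Ω → ℝ} (hm : AEStronglyMeasurable Y P)
    (h3 : Integrable (fun ω => |Y ω| ^ 3) P) {k : ℕ} (hk : k ≤ 3) :
    Integrable (fun ω => |Y ω| ^ k) P := by
  refine Integrable.mono' ((integrable_const 1).add h3) (hm.norm.pow k) (Eventually.of_forall ?_)
  intro ω
  simp only [norm_pow, Real.norm_eq_abs, abs_abs, Pi.add_apply]
  rcases le_or_gt |Y ω| 1 with h | h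
  · have := pow_le_one₀ (n := k) (abs_nonneg _) h
    have := pow_nonneg (abs_nonneg (Y ω)) 3
    linarith
  · have := pow_le_pow_right₀ h.le hk
    linarith

lemma norm_integral_exp_sub_le {Y : Ω → ℝ} (hm : Measurable Y)
    (h3 : Integrable (fun ω => |Y ω| ^ 3) P) (h0 : ∫ ω, Y ω ∂P = 0) (c : ℝ) :
    ‖∫ ω, Complex.exp ((c * Y ω : ℝ) * Complex.I) ∂P -
      (1 - (c ^ 2 * (∫ ω, Y ω ^ 2 ∂P) / 2 : ℝ))‖ ≤ 4 * |c| ^ 3 * ∫ ω, |Y ω| ^ 3 ∂P := by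
  have hY1 : Integrable Y P := by
    have := integrable_pow_of_integrable_pow_three hm.aestronglyMeasurable h3 (k := 1) (by norm_num)
    simp only [pow_one] at this
    exact (integrable_norm_iff hm.aestronglyMeasurable).1 this
  have hY2 : Integrable (fun ω => Y ω ^ 2) P := by
    simpa using integrable_pow_of_integrable_pow_three hm.aestronglyMeasurable h3 (k := 2)
      (by norm_num)
  have hE : Integrable (fun ω => Complex.exp ((c * Y ω : ℝ) * Complex.I)) P := by
    refine Integrable.of_bound (C := 1) (by fun_prop) (Eventually.of_forall fun ω => ?_)
    rw [Complex.norm_exp_ofReal_mul_I]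
  have hT : Integrable (fun ω => (1 + (c * Y ω : ℝ) * Complex.I - (c * Y ω : ℝ) ^ 2 / 2 : ℂ)) P := by
    have h1 := (integrable_const (μ := P) (1 : ℂ)).add
      (((hY1.const_mul c).ofReal (𝕜 := ℂ)).mul_const Complex.I)
    have h2 := h1.sub ((hY2.const_mul (c ^ 2 / 2)).ofReal (𝕜 := ℂ))
    refine h2.congr (Eventually.of_forall fun ω => ?_)
    simp
    ring
  have hTi : ∫ ω, (1 + (c * Y ω : ℝ) * Complex.I - (c * Y ω : ℝ) ^ 2 / 2 : ℂ) ∂P =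
      1 - (c ^ 2 * (∫ ω, Y ω ^ 2 ∂P) / 2 : ℝ) := by
    have h1 : ∀ ω, (1 + (c * Y ω : ℝ) * Complex.I - (c * Y ω : ℝ) ^ 2 / 2 : ℂ) =
        1 + ((c * Y ω : ℝ) : ℂ) * Complex.I - ((c ^ 2 / 2 * Y ω ^ 2 : ℝ) : ℂ) := fun ω => by
      push_cast; ring
    simp_rw [h1]
    rw [integral_sub, integral_add, integral_mul_const, integral_complex_ofReal,
      integral_complex_ofReal, integral_const_mul, integral_const_mul, h0]
    · simp
      ring
    · exact integrable_const _
    · exact ((hY1.const_mul c).ofReal (𝕜 := ℂ)).mul_const Complex.I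
    · exact (integrable_const _).add (((hY1.const_mul c).ofReal (𝕜 := ℂ)).mul_const Complex.I)
    · exact (hY2.const_mul (c ^ 2 / 2)).ofReal (𝕜 := ℂ)
  rw [← hTi, ← integral_sub hE hT]
  refine (norm_integral_le_integral_norm _).trans ?_
  rw [← integral_const_mul]
  refine integral_mono (hE.sub hT).norm (h3.const_mul _) fun ω => ?_
  refine (norm_exp_mul_I_taylor_two (c * Y ω)).trans (le_of_eq ?_)
  rw [abs_mul]
  ring

variable {ι : Type*} [Fintype ι] [DecidableEq ι]

set_option maxHeartbeats 800000 in
/-- Central limit theorem for independent random vectors with bounded third moments whose average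
covariance converges. -/
theorem tendstoInDistribution_inv_sqrt_smul_sum {X : ℕ → Ω → EuclideanSpace ℝ ι}
    (hind : iIndepFun X P) (hm : ∀ i, Measurable (X i)) {C : ℝ}
    (h3 : ∀ i, Integrable (fun ω => ‖X i ω‖ ^ 3) P) (hC : ∀ i, ∫ ω, ‖X i ω‖ ^ 3 ∂P ≤ C)
    (h0 : ∀ i t, ∫ ω, inner ℝ (X i ω) t ∂P = 0) {V : Matrix ι ι ℝ} (hV : V.PosSemidef)
    (hvar : ∀ t : EuclideanSpace ℝ ι, Tendsto
      (fun n => avg n fun i => ∫ ω, inner ℝ (X i ω) t ^ 2 ∂P) atTop (𝓝 (t ⬝ᵥ V *ᵥ t))) :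
    TendstoInDistribution (fun (n : ℕ) ω => (√(n : ℝ))⁻¹ • ∑ i ∈ Finset.range n, X i ω) atTop
      (id : EuclideanSpace ℝ ι → EuclideanSpace ℝ ι) (fun _ => P) (multivariateGaussian 0 V) where
  forall_aemeasurable n := by
    have : Measurable fun ω => ∑ i ∈ Finset.range n, X i ω :=
      Finset.measurable_fun_sum _ fun i _ => hm i
    fun_prop
  tendsto := by
    -- Lévy's continuity theorem. The characteristic function of the normalized sum is a product,
    -- compared factor by factor with Gaussian factors of the same variances; the product of the
    -- latter depends on the average variance only.
    refine ProbabilityMeasure.tendsto_iff_tendsto_charFun.2 fun t => ?_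
    simp only [ProbabilityMeasure.coe_mk, Measure.map_id]
    rw [charFun_multivariateGaussian hV]
    set Y : ℕ → Ω → ℝ := fun i ω => inner ℝ (X i ω) t with hY
    have hYm : ∀ i, Measurable (Y i) := fun i => (hm i).inner_const
    set s : ℕ → ℝ := fun i => ∫ ω, Y i ω ^ 2 ∂P with hs
    have hYle : ∀ i ω, |Y i ω| ^ 3 ≤ ‖t‖ ^ 3 * ‖X i ω‖ ^ 3 := fun i ω => by
      rw [← mul_pow, mul_comm]
      gcongr
      exact abs_real_inner_le_norm _ _
    have hY3 : ∀ i, Integrable (fun ω => |Y i ω| ^ 3) P := fun i => by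
      refine Integrable.mono' ((h3 i).const_mul (‖t‖ ^ 3))
        ((hYm i).abs.pow_const 3).aestronglyMeasurable (Eventually.of_forall fun ω => ?_)
      rw [Real.norm_eq_abs, abs_of_nonneg (by positivity)]
      exact hYle i ω
    set D := ‖t‖ ^ 3 * C with hD
    have hY3C : ∀ i, ∫ ω, |Y i ω| ^ 3 ∂P ≤ D := fun i => by
      refine (integral_mono (hY3 i) ((h3 i).const_mul (‖t‖ ^ 3)) (hYle i)).trans ?_
      rw [integral_const_mul]
      exact mul_le_mul_of_nonneg_left (hC i) (by positivity)
    have hD0 : 0 ≤ D := le_trans (integral_nonneg fun ω => by positivity) (hY3C 0)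
    have hs0 : ∀ i, 0 ≤ s i := fun i => integral_nonneg fun ω => sq_nonneg _
    have hsD : ∀ i, s i ≤ 1 + D := fun i => by
      have h2 : Integrable (fun ω => Y i ω ^ 2) P := by
        simpa using integrable_pow_of_integrable_pow_three (hYm i).aestronglyMeasurable (hY3 i)
          (k := 2) (by norm_num)
      refine (integral_mono h2 ((integrable_const 1).add (hY3 i)) fun ω => ?_).trans ?_
      · simp only [Pi.add_apply]
        rw [← sq_abs]
        rcases le_or_gt |Y i ω| 1 with h | h
        · have := pow_le_one₀ (n := 2) (abs_nonneg _) h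
          have := pow_nonneg (abs_nonneg (Y i ω)) 3
          linarith
        · have := pow_le_pow_right₀ h.le (show 2 ≤ 3 by norm_num)
          linarith
      · rw [integral_add' (integrable_const 1) (hY3 i)]
        simpa using hY3C i
    have hchar : ∀ n : ℕ, charFun (P.map fun ω => (√(n : ℝ))⁻¹ • ∑ i ∈ Finset.range n, X i ω) t =
        ∏ i ∈ Finset.range n,
          ∫ ω, Complex.exp (((√(n : ℝ))⁻¹ * Y i ω : ℝ) * Complex.I) ∂P := by
      intro n
      have h1 : (fun ω => (√(n : ℝ))⁻¹ • ∑ i ∈ Finset.range n, X i ω) =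
          fun ω => ∑ i ∈ Finset.range n, (√(n : ℝ))⁻¹ • X i ω := by
        ext1 ω
        rw [Finset.smul_sum]
      have h2 : iIndepFun (fun i ω => (√(n : ℝ))⁻¹ • X i ω) P :=
        hind.comp (fun _ x => (√(n : ℝ))⁻¹ • x) fun _ => measurable_const_smul _
      have h3 := congrFun ((h2.restrict (Finset.range n)).charFun_map_fun_finsetSum_eq_prod
        (X := fun i ω => (√(n : ℝ))⁻¹ • X i ω)
        fun i _ => ((hm i).const_smul (√(n : ℝ))⁻¹).aemeasurable) t
      rw [h1, h3, Finset.prod_apply]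
      refine Finset.prod_congr rfl fun i _ => ?_
      have hmi := hm i
      have hmc : Measurable fun ω => (√(n : ℝ))⁻¹ • X i ω := by fun_prop
      rw [charFun_apply, integral_map hmc.aemeasurable (by fun_prop)]
      simp [hY, inner_smul_left]
    have hprod : Tendsto (fun n : ℕ => ∏ i ∈ Finset.range n,
        (Real.exp (-((√(n : ℝ))⁻¹ ^ 2 * s i / 2)) : ℂ)) atTop
        (𝓝 (Complex.exp (((inner ℝ t (0 : EuclideanSpace ℝ ι) : ℝ) : ℂ) * Complex.I -
          ((t ⬝ᵥ V *ᵥ t : ℝ) : ℂ) / 2))) := by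
      have h1 : ∀ n : ℕ, ∏ i ∈ Finset.range n,
          (Real.exp (-((√(n : ℝ))⁻¹ ^ 2 * s i / 2)) : ℂ) = ((Real.exp (-(avg n s / 2)) : ℝ) : ℂ) := by
        intro n
        rw [← Complex.ofReal_prod, ← Real.exp_sum]
        congr 2
        rw [avg, Finset.sum_neg_distrib, inv_pow, Real.sq_sqrt (Nat.cast_nonneg n), Finset.mul_sum,
          Finset.sum_div]
      simp_rw [h1]
      have h2 : Complex.exp (((inner ℝ t (0 : EuclideanSpace ℝ ι) : ℝ) : ℂ) * Complex.I -
          ((t ⬝ᵥ V *ᵥ t : ℝ) : ℂ) / 2) = ((Real.exp (-((t ⬝ᵥ V *ᵥ t) / 2)) : ℝ) : ℂ) := by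
        push_cast
        simp
      rw [h2]
      exact (Complex.continuous_ofReal.tendsto _).comp
        ((Real.continuous_exp.tendsto _).comp ((hvar t).div_const 2).neg)
    have hdiff : Tendsto (fun n : ℕ =>
        charFun (P.map fun ω => (√(n : ℝ))⁻¹ • ∑ i ∈ Finset.range n, X i ω) t -
        ∏ i ∈ Finset.range n, (Real.exp (-((√(n : ℝ))⁻¹ ^ 2 * s i / 2)) : ℂ)) atTop (𝓝 0) := by
      have hlim : Tendsto (fun n : ℕ => 4 * D * (√(n : ℝ))⁻¹ + (1 + D) ^ 2 * ((√(n : ℝ))⁻¹) ^ 2)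
          atTop (𝓝 0) := by
        have h := tendsto_inv_atTop_zero.comp
          (Real.tendsto_sqrt_atTop.comp tendsto_natCast_atTop_atTop)
        simpa using (h.const_mul (4 * D)).add ((h.pow 2).const_mul ((1 + D) ^ 2))
      refine squeeze_zero_norm' ?_ hlim
      filter_upwards [eventually_gt_atTop 0] with n hn
      rw [hchar]
      refine (norm_prod_sub_prod_le_sum n _ _ (fun i => ?_) (fun i => ?_)).trans ?_
      · refine (norm_integral_le_integral_norm _).trans ?_
        simp_rw [Complex.norm_exp_ofReal_mul_I]
        simp
      · rw [Complex.norm_real, Real.norm_eq_abs, abs_of_pos (Real.exp_pos _), Real.exp_le_one_iff]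
        have := hs0 i
        have : 0 ≤ (√(n : ℝ))⁻¹ ^ 2 * s i / 2 := by positivity
        linarith
      · set c := (√(n : ℝ))⁻¹ with hc
        have hc0 : 0 < c := by positivity
        have hcn : (n : ℝ) * c ^ 2 = 1 := by
          rw [hc, inv_pow, Real.sq_sqrt (Nat.cast_nonneg n)]
          field_simp
        -- Each factor is off by terms of order `c³` and `c⁴`; there are `n` of them and `n c² = 1`,
        -- so the total is of order `c`.
        have hterm : ∀ i ∈ Finset.range n,
            ‖∫ ω, Complex.exp ((c * Y i ω : ℝ) * Complex.I) ∂P -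
              (Real.exp (-(c ^ 2 * s i / 2)) : ℂ)‖ ≤ 4 * c ^ 3 * D + c ^ 4 * (1 + D) ^ 2 := by
          intro i _
          have h1 := norm_integral_exp_sub_le (hYm i) (hY3 i) (h0 i t) c
          have hx0 : 0 ≤ c ^ 2 * s i / 2 := by
            have := hs0 i
            positivity
          have h2 := abs_exp_neg_sub_le hx0
          have h3' : ‖((1 - (c ^ 2 * s i / 2 : ℝ) : ℂ)) - (Real.exp (-(c ^ 2 * s i / 2)) : ℂ)‖ ≤
              (c ^ 2 * s i / 2) ^ 2 := by
            rw [norm_sub_rev, ← Complex.ofReal_one, ← Complex.ofReal_sub, ← Complex.ofReal_sub,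
              Complex.norm_real]
            exact h2
          have h4 := norm_sub_le_norm_sub_add_norm_sub
            (∫ ω, Complex.exp ((c * Y i ω : ℝ) * Complex.I) ∂P)
            (1 - (c ^ 2 * s i / 2 : ℝ) : ℂ) (Real.exp (-(c ^ 2 * s i / 2)) : ℂ)
          refine h4.trans (add_le_add (h1.trans ?_) (h3'.trans ?_))
          · rw [abs_of_pos hc0]
            have := hY3C i
            gcongr
          · have e : (c ^ 2 * s i / 2) ^ 2 = c ^ 4 * (s i ^ 2 / 4) := by ring
            rw [e]
            have h5 := hs0 i
            have h6 := hsD i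
            have h7 : s i ^ 2 ≤ (1 + D) ^ 2 := by gcongr
            have h8 := sq_nonneg (s i)
            gcongr
            linarith
        refine (Finset.sum_le_sum hterm).trans (le_of_eq ?_)
        rw [Finset.sum_const, Finset.card_range, nsmul_eq_mul]
        have e : (n : ℝ) * (4 * c ^ 3 * D + c ^ 4 * (1 + D) ^ 2) =
            (n * c ^ 2) * (4 * D * c + (1 + D) ^ 2 * c ^ 2) := by ring
        rw [e, hcn, one_mul]
    have := hdiff.add hprod
    simpa using this

end CentralLimit

/-! ### The weak law of large numbers and its converse -/

section LawOfLargeNumbers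

/-- A convex function comparable to `min |y| (y ^ 2)`. -/
def huber (y : ℝ) : ℝ := y ^ 2 / (1 + |y|)

lemma huber_nonneg (y : ℝ) : 0 ≤ huber y := by unfold huber; positivity

lemma huber_le_abs (y : ℝ) : huber y ≤ |y| := by
  unfold huber
  rw [div_le_iff₀ (by positivity), ← sq_abs]
  nlinarith [abs_nonneg y]

lemma huber_le_sq (y : ℝ) : huber y ≤ y ^ 2 :=
  div_le_self (sq_nonneg y) (by linarith [abs_nonneg y])

lemma huber_mono {y a : ℝ} (h : |y| ≤ |a|) : huber y ≤ huber a := by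
  unfold huber
  rw [div_le_div_iff₀ (by positivity) (by positivity), ← sq_abs y, ← sq_abs a]
  have h1 : |y| ^ 2 ≤ |a| ^ 2 := by gcongr
  have h2 : |y| ^ 2 * |a| ≤ |a| ^ 2 * |y| := by
    have := mul_le_mul_of_nonneg_left h (mul_nonneg (abs_nonneg y) (abs_nonneg a))
    nlinarith
  nlinarith

lemma huber_mul_le {c : ℝ} (hc : 1 ≤ c) (y : ℝ) : huber (c * y) ≤ c ^ 2 * huber y := by
  unfold huber
  rw [mul_pow, mul_div_assoc]
  have h : |y| ≤ |c * y| := by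
    rw [abs_mul, abs_of_nonneg (by linarith : (0 : ℝ) ≤ c)]
    nlinarith [abs_nonneg y]
  gcongr

/-- The larger of `|a|` and `|d|` is at least `|y| / 2`, and doubling the argument costs the factor
`2² = 4`. -/
lemma huber_le_add {y a d : ℝ} (h : |y| ≤ |a| + |d|) : huber y ≤ 4 * huber a + 4 * huber d := by
  have ha := huber_nonneg a
  have hd := huber_nonneg d
  rcases le_total |d| |a| with h1 | h1
  · have h2 : huber y ≤ huber (2 * a) := huber_mono (by rw [abs_mul, abs_two]; linarith)
    have h3 := huber_mul_le (c := 2) (by norm_num) a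
    linarith
  · have h2 : huber y ≤ huber (2 * d) := huber_mono (by rw [abs_mul, abs_two]; linarith)
    have h3 := huber_mul_le (c := 2) (by norm_num) d
    linarith

lemma measurable_huber : Measurable huber := by unfold huber; fun_prop

/-- The right side is the excess of a Laplace transform, which is what the converse weak law
controls. Three ranges: for `y ≤ 0` it is at least `y² / 2`; for `0 ≤ y ≤ 2` squaring `1 - y / 2 ≤
exp (-y / 2)` gives `y² / 4`; for `y ≥ 2` it exceeds `y - 1 ≥ y / 4`. -/
lemma huber_le_exp (y : ℝ) : huber y / 4 ≤ Real.exp (-y) - 1 + y := by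
  have h0 := huber_le_sq y
  rcases le_total y 0 with hy | hy
  · have := Real.quadratic_le_exp_of_nonneg (x := -y) (by linarith)
    nlinarith
  · rcases le_total y 2 with h2 | h2
    · have h3 : 1 - y / 2 ≤ Real.exp (-(y / 2)) := by linarith [Real.add_one_le_exp (-(y / 2))]
      have h4 : Real.exp (-y) = Real.exp (-(y / 2)) ^ 2 := by
        rw [← Real.exp_nat_mul]
        congr 1
        push_cast
        ring
      rw [h4]
      have h5 : (1 - y / 2) ^ 2 ≤ Real.exp (-(y / 2)) ^ 2 := by
        gcongr
        linarith
      nlinarith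
    · have := huber_le_abs y
      rw [abs_of_nonneg hy] at this
      have := Real.exp_pos (-y)
      linarith

lemma one_add_sum_le_prod_one_add {d : ℕ → ℝ} (hd : ∀ i, 0 ≤ d i) (n : ℕ) :
    1 + ∑ i ∈ Finset.range n, d i ≤ ∏ i ∈ Finset.range n, (1 + d i) := by
  induction n with
  | zero => simp
  | succ n ih =>
    rw [Finset.sum_range_succ, Finset.prod_range_succ]
    have h1 : 0 ≤ ∑ i ∈ Finset.range n, d i := Finset.sum_nonneg fun i _ => hd i
    nlinarith [hd n]

variable {Ω : Type*} [MeasurableSpace Ω] {P : Measure Ω}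

lemma Integrable.huber_div {Z : Ω → ℝ} (hZ : Integrable Z P) (c : ℝ) :
    Integrable (fun ω => huber (Z ω / c)) P := by
  refine Integrable.mono' (hZ.div_const c).norm
    (measurable_huber.comp_aemeasurable (hZ.div_const c).aemeasurable).aestronglyMeasurable
    (Eventually.of_forall fun ω => ?_)
  rw [Real.norm_eq_abs, abs_of_nonneg (huber_nonneg _)]
  exact huber_le_abs _

/-- The summands `Z i / n`, `i < n`, are uniformly negligible in `L¹`, in the sense that makes the
weak law of large numbers hold. -/
def Negligible (P : Measure Ω) (Z : ℕ → Ω → ℝ) : Prop :=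
  Tendsto (fun n : ℕ => ∑ i ∈ Finset.range n, ∫ ω, huber (Z i ω / n) ∂P) atTop (𝓝 0)

lemma negligible_const [IsProbabilityMeasure P] (c : ℝ) : Negligible P fun _ _ => c := by
  have hlim : Tendsto (fun n : ℕ => c ^ 2 * ((n : ℝ))⁻¹) atTop (𝓝 0) := by
    simpa using (tendsto_inv_atTop_zero.comp
      (tendsto_natCast_atTop_atTop (R := ℝ))).const_mul (c ^ 2)
  refine squeeze_zero (fun n => Finset.sum_nonneg fun i _ => integral_nonneg fun ω =>
    huber_nonneg _) (fun n => ?_) hlim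
  rcases Nat.eq_zero_or_pos n with rfl | hn
  · simp
  · simp only [integral_const, probReal_univ, smul_eq_mul, one_mul, Finset.sum_const,
      Finset.card_range, nsmul_eq_mul]
    have := huber_le_sq (c / n)
    calc (n : ℝ) * huber (c / n) ≤ n * (c / n) ^ 2 := by gcongr
      _ = _ := by field_simp

lemma Negligible.add {X Y : ℕ → Ω → ℝ} (hX : Negligible P X) (hY : Negligible P Y)
    (hXi : ∀ i, Integrable (X i) P) (hYi : ∀ i, Integrable (Y i) P) :
    Negligible P fun i ω => X i ω + Y i ω := by
  have hlim := (Tendsto.const_mul 4 hX).add (Tendsto.const_mul 4 hY)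
  rw [mul_zero, add_zero] at hlim
  refine squeeze_zero (fun n => Finset.sum_nonneg fun i _ => integral_nonneg fun ω =>
    huber_nonneg _) (fun n => ?_) hlim
  rw [Finset.mul_sum, Finset.mul_sum, ← Finset.sum_add_distrib]
  refine Finset.sum_le_sum fun i _ => ?_
  have h1 := (Integrable.huber_div (hXi i) n).const_mul 4
  have h2 := (Integrable.huber_div (hYi i) n).const_mul 4
  rw [← integral_const_mul, ← integral_const_mul, ← integral_add h1 h2]
  refine integral_mono (Integrable.huber_div ((hXi i).add (hYi i)) n) (h1.add h2) fun ω => ?_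
  refine huber_le_add ?_
  rw [add_div]
  exact abs_add_le _ _

/-- For fixed `R` the dominating part `R |X i|` stays negligible, and the `n` remaining errors, each
at most of order `η / n`, add up to order `η` uniformly in `n`. -/
lemma Negligible.of_approx {X Z : ℕ → Ω → ℝ} (hX : Negligible P X)
    (hXi : ∀ i, Integrable (X i) P) (hZi : ∀ i, Integrable (Z i) P)
    (h : ∀ η : ℝ, 0 < η → ∃ R : ℝ, 1 ≤ R ∧ ∃ D : ℕ → Ω → ℝ, ∀ i, Integrable (D i) P ∧
      ∫ ω, |D i ω| ∂P ≤ η ∧ ∀ᵐ ω ∂P, |Z i ω| ≤ R * |X i ω| + |D i ω|) :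
    Negligible P Z := by
  rw [Negligible, Metric.tendsto_atTop']
  intro ε hε
  -- `huber_le_add` multiplies the error by four, leaving `ε / 2` for it and `ε / 2` for the
  -- dominating part.
  obtain ⟨R, hR, D, hD⟩ := h (ε / 8) (by positivity)
  have h1 := Tendsto.const_mul (4 * R ^ 2) hX
  rw [mul_zero] at h1
  obtain ⟨N, hN⟩ := eventually_atTop.1 (h1.eventually (gt_mem_nhds (half_pos hε)))
  refine ⟨max N 0, fun n hn => ?_⟩
  have hn0 : 0 < n := lt_of_le_of_lt (le_max_right _ _) hn
  have hn1 : (0 : ℝ) < n := by exact_mod_cast hn0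
  have hnN := hN n ((le_max_left _ _).trans hn.le)
  rw [Real.dist_eq, sub_zero, abs_of_nonneg (Finset.sum_nonneg fun i _ => integral_nonneg fun ω =>
    huber_nonneg _)]
  have key : ∀ i ∈ Finset.range n, ∫ ω, huber (Z i ω / n) ∂P ≤
      4 * R ^ 2 * ∫ ω, huber (X i ω / n) ∂P + 4 * (ε / 8) / n := by
    intro i _
    have h2 := (Integrable.huber_div (hXi i) n).const_mul (4 * R ^ 2)
    have h3 := ((hD i).1.abs.const_mul 4).div_const (n : ℝ)
    have h4 : ∫ ω, 4 * |D i ω| / n ∂P ≤ 4 * (ε / 8) / n := by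
      rw [integral_div, integral_const_mul]
      have := (hD i).2.1
      gcongr
    refine le_trans ?_ (add_le_add (le_of_eq (integral_const_mul _ _)) h4)
    rw [← integral_add h2 h3]
    refine integral_mono_ae (Integrable.huber_div (hZi i) n) (h2.add h3) ?_
    filter_upwards [(hD i).2.2] with ω hω
    have h5 : |Z i ω / n| ≤ |R * (X i ω / n)| + |D i ω / n| := by
      rw [abs_div, abs_mul, abs_div, abs_div, abs_of_pos hn1, abs_of_nonneg (by linarith : 0 ≤ R)]
      rw [← mul_div_assoc, ← add_div]
      gcongr
    have h6 := huber_le_add h5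
    have h7 := huber_mul_le hR (X i ω / n)
    have h8 := huber_le_abs (D i ω / n)
    rw [abs_div, abs_of_pos hn1] at h8
    rw [mul_div_assoc]
    linarith
  refine lt_of_le_of_lt (Finset.sum_le_sum key) ?_
  rw [Finset.sum_add_distrib, ← Finset.mul_sum, Finset.sum_const, Finset.card_range, nsmul_eq_mul]
  have : (n : ℝ) * (4 * (ε / 8) / n) = ε / 2 := by field_simp; ring
  rw [this]
  linarith

variable [IsProbabilityMeasure P]

/-- Weak law of large numbers for independent, not necessarily identically distributed summands. -/
lemma Negligible.tendsto_avg_sub {Z : ℕ → Ω → ℝ} (h : Negligible P Z) (hind : iIndepFun Z P)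
    (hm : ∀ i, Measurable (Z i)) (hZi : ∀ i, Integrable (Z i) P) :
    Tendsto (fun a : ℕ × Ω => avg a.1 (fun i => Z i a.2) - avg a.1 fun i => ∫ ω, Z i ω ∂P)
      (whp P) (𝓝 0) := by
  -- A smooth substitute for truncation: `y = f y + g y` with `f² ≤ huber` and `|g| = huber`. The
  -- sum of the `f` parts is controlled by its variance, that of the `g` parts in `L¹`, both by the
  -- same quantity.
  set f : ℝ → ℝ := fun y => y / (1 + |y|) with hf
  set g : ℝ → ℝ := fun y => y * |y| / (1 + |y|) with hg
  have hfm : Measurable f := by fun_prop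
  have hgm : Measurable g := by fun_prop
  have hfg : ∀ y, y = f y + g y := fun y => by
    simp only [hf, hg]
    have : 1 + |y| ≠ 0 := by positivity
    field_simp
  have hf1 : ∀ y, |f y| ≤ 1 := fun y => by
    simp only [hf]
    rw [abs_div, abs_of_nonneg (by positivity : 0 ≤ 1 + |y|), div_le_one (by positivity)]
    linarith
  have hf2 : ∀ y, f y ^ 2 ≤ huber y := fun y => by
    simp only [hf, huber]
    rw [div_pow]
    gcongr
    nlinarith [abs_nonneg y]
  have hgh : ∀ y, |g y| = huber y := fun y => by
    simp only [hg, huber]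
    rw [abs_div, abs_mul, abs_abs, abs_of_nonneg (by positivity : 0 ≤ 1 + |y|), ← sq, sq_abs]
  have hfi : ∀ (n : ℕ) i, Integrable (fun ω => f (Z i ω / n)) P := fun n i =>
    Integrable.of_bound (hfm.comp ((hm i).div_const _)).aestronglyMeasurable 1
      (Eventually.of_forall fun ω => hf1 _)
  have hgi : ∀ (n : ℕ) i, Integrable (fun ω => g (Z i ω / n)) P := fun n i =>
    ((Integrable.huber_div (hZi i) n).mono'
      (hgm.comp ((hm i).div_const _)).aestronglyMeasurable
      (Eventually.of_forall fun ω => (hgh _).le))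
  have hsum : ∀ (n : ℕ) (ω : Ω), avg n (fun i => Z i ω) - avg n (fun i => ∫ ω, Z i ω ∂P) =
      (∑ i ∈ Finset.range n, f (Z i ω / n) - ∫ ω, ∑ i ∈ Finset.range n, f (Z i ω / n) ∂P) +
      (∑ i ∈ Finset.range n, g (Z i ω / n) - ∫ ω, ∑ i ∈ Finset.range n, g (Z i ω / n) ∂P) := by
    intro n ω
    have h1 : ∀ i, (n : ℝ)⁻¹ * ∫ ω, Z i ω ∂P =
        ∫ ω, f (Z i ω / n) ∂P + ∫ ω, g (Z i ω / n) ∂P := fun i => by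
      rw [← integral_add (hfi n i) (hgi n i), ← integral_const_mul]
      refine integral_congr_ae (Eventually.of_forall fun ω => ?_)
      simp only
      rw [← hfg, div_eq_inv_mul]
    have h2 : ∀ i, (n : ℝ)⁻¹ * Z i ω = f (Z i ω / n) + g (Z i ω / n) := fun i => by
      rw [← hfg, div_eq_inv_mul]
    rw [integral_finsetSum _ fun i _ => hfi n i, integral_finsetSum _ fun i _ => hgi n i, avg, avg,
      Finset.mul_sum, Finset.mul_sum, Finset.sum_congr rfl fun i _ => h1 i,
      Finset.sum_congr rfl fun i _ => h2 i, Finset.sum_add_distrib, Finset.sum_add_distrib]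
    ring
  have hF : Tendsto (fun a : ℕ × Ω => ∑ i ∈ Finset.range a.1, f (Z i a.2 / a.1) -
      ∫ ω, ∑ i ∈ Finset.range a.1, f (Z i ω / a.1) ∂P) (whp P) (𝓝 0) := by
    have hsq : Tendsto (fun a : ℕ × Ω => (∑ i ∈ Finset.range a.1, f (Z i a.2 / a.1) -
        ∫ ω, ∑ i ∈ Finset.range a.1, f (Z i ω / a.1) ∂P) ^ 2) (whp P) (𝓝 0) := by
      have hL2 : ∀ (n : ℕ) i, MemLp (fun ω => f (Z i ω / n)) 2 P := fun n i =>
        MemLp.of_bound (hfm.comp ((hm i).div_const _)).aestronglyMeasurable 1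
          (Eventually.of_forall fun ω => hf1 _)
      have hL2s : ∀ n : ℕ, MemLp (fun ω => ∑ i ∈ Finset.range n, f (Z i ω / n)) 2 P := fun n =>
        memLp_finsetSum _ fun i _ => hL2 n i
      have hi : ∀ n : ℕ, Integrable (fun ω => (∑ i ∈ Finset.range n, f (Z i ω / n) -
          ∫ ω, ∑ i ∈ Finset.range n, f (Z i ω / n) ∂P) ^ 2) P := fun n =>
        ((hL2s n).sub (memLp_const _)).integrable_sq
      refine tendsto_whp_zero_of_integral_abs (X := fun n ω => (∑ i ∈ Finset.range n, f (Z i ω / n) -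
          ∫ ω, ∑ i ∈ Finset.range n, f (Z i ω / n) ∂P) ^ 2) (Eventually.of_forall hi) ?_
      refine squeeze_zero (fun n => integral_nonneg fun ω => abs_nonneg _) (fun n => ?_) h
      have h1 : ∫ ω, |(∑ i ∈ Finset.range n, f (Z i ω / n) -
          ∫ ω, ∑ i ∈ Finset.range n, f (Z i ω / n) ∂P) ^ 2| ∂P =
          Var[fun ω => ∑ i ∈ Finset.range n, f (Z i ω / n); P] := by
        rw [variance_eq_integral (hL2s n).aestronglyMeasurable.aemeasurable]
        refine integral_congr_ae (Eventually.of_forall fun ω => ?_)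
        simp only [abs_pow, sq_abs]
      have h2 : Var[fun ω => ∑ i ∈ Finset.range n, f (Z i ω / n); P] =
          ∑ i ∈ Finset.range n, Var[fun ω => f (Z i ω / n); P] := by
        have := IndepFun.variance_sum (X := fun i ω => f (Z i ω / n)) (μ := P)
          (s := Finset.range n) (fun i _ => hL2 n i) (fun i _ j _ hij =>
            (hind.indepFun hij).comp (hfm.comp (measurable_id.div_const _))
              (hfm.comp (measurable_id.div_const _)))
        rw [← this]
        congr 1
        ext ω
        simp
      rw [h1, h2]
      refine Finset.sum_le_sum fun i _ => ?_
      refine (variance_le_expectation_sq (hL2 n i).aestronglyMeasurable).trans ?_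
      refine integral_mono (hL2 n i).integrable_sq (Integrable.huber_div (hZi i) n) fun ω => ?_
      exact hf2 _
    have := (Real.continuous_sqrt.tendsto 0).comp hsq
    rw [Real.sqrt_zero] at this
    refine (tendsto_zero_iff_abs_tendsto_zero _).2 (this.congr fun a => ?_)
    simp [Real.sqrt_sq_eq_abs]
  have hG : Tendsto (fun a : ℕ × Ω => ∑ i ∈ Finset.range a.1, g (Z i a.2 / a.1) -
      ∫ ω, ∑ i ∈ Finset.range a.1, g (Z i ω / a.1) ∂P) (whp P) (𝓝 0) := by
    have hgs : ∀ n : ℕ, Integrable (fun ω => ∑ i ∈ Finset.range n, g (Z i ω / n)) P := fun n =>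
      integrable_finsetSum _ fun i _ => hgi n i
    have h2 := Tendsto.const_mul 2 h
    rw [mul_zero] at h2
    refine tendsto_whp_zero_of_integral_abs (X := fun n ω => ∑ i ∈ Finset.range n, g (Z i ω / n) -
        ∫ ω, ∑ i ∈ Finset.range n, g (Z i ω / n) ∂P)
      (Eventually.of_forall fun n => (hgs n).sub (integrable_const _)) ?_
    refine squeeze_zero (fun n => integral_nonneg fun ω => abs_nonneg _) (fun n => ?_) h2
    have h3 : ∫ ω, |∑ i ∈ Finset.range n, g (Z i ω / n)| ∂P ≤
        ∑ i ∈ Finset.range n, ∫ ω, huber (Z i ω / n) ∂P := by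
      rw [← integral_finsetSum _ fun i _ => Integrable.huber_div (hZi i) n]
      refine integral_mono (hgs n).abs
        (integrable_finsetSum _ fun i _ => Integrable.huber_div (hZi i) n) fun ω => ?_
      refine (Finset.abs_sum_le_sum_abs _ _).trans (le_of_eq ?_)
      exact Finset.sum_congr rfl fun i _ => hgh _
    calc ∫ ω, |∑ i ∈ Finset.range n, g (Z i ω / n) -
          ∫ ω, ∑ i ∈ Finset.range n, g (Z i ω / n) ∂P| ∂P
        ≤ ∫ ω, (|∑ i ∈ Finset.range n, g (Z i ω / n)| +
          |∫ ω, ∑ i ∈ Finset.range n, g (Z i ω / n) ∂P|) ∂P := by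
          refine integral_mono ((hgs n).sub (integrable_const _)).abs
            ((hgs n).abs.add (integrable_const _)) fun ω => abs_sub _ _
      _ = ∫ ω, |∑ i ∈ Finset.range n, g (Z i ω / n)| ∂P +
          |∫ ω, ∑ i ∈ Finset.range n, g (Z i ω / n) ∂P| := by
          rw [integral_add (hgs n).abs (integrable_const _)]
          simp
      _ ≤ _ := by
          have := abs_integral_le_integral_abs (μ := P)
            (f := fun ω => ∑ i ∈ Finset.range n, g (Z i ω / n))
          linarith
  have := hF.add hG
  rw [add_zero] at this
  exact this.congr fun a => (hsum a.1 a.2).symm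

/-- For nonnegative summands with bounded means, the weak law of large numbers with centering at
the means forces the summands to be negligible. -/
lemma negligible_of_tendsto_avg_sub {X : ℕ → Ω → ℝ} (hind : iIndepFun X P)
    (hm : ∀ i, Measurable (X i)) (hXi : ∀ i, Integrable (X i) P) (hX0 : ∀ i ω, 0 ≤ X i ω) {C : ℝ}
    (hC : ∀ i, ∫ ω, X i ω ∂P ≤ C)
    (h : Tendsto (fun a : ℕ × Ω => avg a.1 (fun i => X i a.2) - avg a.1 fun i => ∫ ω, X i ω ∂P)
      (whp P) (𝓝 0)) :
    Negligible P X := by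
  set c : ℕ → ℝ := fun i => ∫ ω, X i ω ∂P with hc
  have hc0 : ∀ i, 0 ≤ c i := fun i => integral_nonneg (hX0 i)
  have hC0 : 0 ≤ C := (hc0 0).trans (hC 0)
  have hexp_int : ∀ (n : ℕ) i, Integrable (fun ω => Real.exp (-((X i ω - c i) / n))) P := by
    intro n i
    have hmi := hm i
    refine Integrable.of_bound (C := Real.exp (c i / n)) (by fun_prop)
      (Eventually.of_forall fun ω => ?_)
    rw [Real.norm_eq_abs, abs_of_pos (Real.exp_pos _), Real.exp_le_exp, ← neg_div]
    gcongr
    linarith [hX0 i ω]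
  -- By independence the product of the `1 + δ n i` is the mean of `exp (-W)`, where `W` is the
  -- centered average. As `W` tends to zero in probability, the limsup of this mean is at most one,
  -- so the nonnegative `δ n i` sum to something vanishing; they bound `huber` of the centered
  -- summands.
  set δ : ℕ → ℕ → ℝ := fun n i => ∫ ω, (Real.exp (-((X i ω - c i) / n)) - 1 + (X i ω - c i) / n) ∂P
    with hδ
  have hlin : ∀ (n : ℕ) i, Integrable (fun ω => (X i ω - c i) / n) P := fun n i =>
    ((hXi i).sub (integrable_const _)).div_const _
  have hδeq : ∀ (n : ℕ) i, ∫ ω, Real.exp (-((X i ω - c i) / n)) ∂P = 1 + δ n i := by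
    intro n i
    simp only [hδ]
    have h1 : Integrable (fun ω => Real.exp (-((X i ω - c i) / n)) - 1) P :=
      (hexp_int n i).sub (integrable_const 1)
    rw [integral_add h1 (hlin n i), integral_sub (hexp_int n i) (integrable_const 1), integral_div,
      integral_sub (hXi i) (integrable_const _)]
    simp [hc]
  have hδ_int : ∀ (n : ℕ) i, Integrable
      (fun ω => Real.exp (-((X i ω - c i) / n)) - 1 + (X i ω - c i) / n) P := fun n i =>
    ((hexp_int n i).sub (integrable_const 1)).add (hlin n i)
  have hδ0 : ∀ n i, 0 ≤ δ n i := fun n i => integral_nonneg fun ω => by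
    have := huber_le_exp ((X i ω - c i) / n)
    have := huber_nonneg ((X i ω - c i) / n)
    simp only [Pi.zero_apply]
    linarith
  have hprod : ∀ n : ℕ, ∫ ω, Real.exp (-(avg n (fun i => X i ω) - avg n c)) ∂P =
      ∏ i ∈ Finset.range n, (1 + δ n i) := by
    intro n
    have hind' : iIndepFun (fun i ω => -((X i ω - c i) / n)) P :=
      hind.comp (fun i x => -((x - c i) / n)) fun i => by fun_prop
    have h1 := hind'.mgf_sum (t := 1) (fun i => by have := hm i; fun_prop) (Finset.range n)
    simp only [mgf, one_mul] at h1
    simp_rw [← hδeq]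
    rw [← h1]
    refine integral_congr_ae (Eventually.of_forall fun ω => ?_)
    beta_reduce
    rw [Finset.sum_apply]
    congr 1
    rw [Finset.sum_neg_distrib, avg, avg, ← Finset.sum_div, Finset.sum_sub_distrib]
    ring
  have hupper : ∀ ε : ℝ, 0 < ε → ∀ᶠ n in atTop,
      ∫ ω, Real.exp (-(avg n (fun i => X i ω) - avg n c)) ∂P ≤ 1 + ε := by
    intro ε hε
    obtain ⟨d, hd0, hd⟩ : ∃ d : ℝ, 0 < d ∧ Real.exp d ≤ 1 + ε / 2 := by
      refine ⟨Real.log (1 + ε / 2), Real.log_pos (by linarith), ?_⟩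
      rw [Real.exp_log (by linarith)]
    have h1 := Metric.tendsto_nhds.1 h d hd0
    rw [eventually_whp] at h1
    have h2 := (ENNReal.tendsto_toReal ENNReal.zero_ne_top).comp h1
    have h3 := h2.const_mul (Real.exp C)
    simp only [ENNReal.toReal_zero, mul_zero, Function.comp_def] at h3
    filter_upwards [h3.eventually (gt_mem_nhds (half_pos hε))] with n hn
    set W : Ω → ℝ := fun ω => avg n (fun i => X i ω) - avg n c with hW
    have hWm : Measurable W := by
      simp only [hW, avg]
      have : Measurable fun ω => ∑ i ∈ Finset.range n, X i ω :=
        Finset.measurable_fun_sum _ fun i _ => hm i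
      fun_prop
    have havgc : avg n c ≤ C := by
      rcases Nat.eq_zero_or_pos n with rfl | hn
      · simpa [avg] using hC0
      · have hn' : (0 : ℝ) < n := by exact_mod_cast hn
        rw [avg, inv_mul_le_iff₀ hn']
        refine (Finset.sum_le_sum fun i _ => hC i).trans ?_
        simp
    -- Nonnegativity of the summands is essential here: it bounds `exp (-W)`, so that convergence in
    -- probability controls its mean.
    have hWC : ∀ ω, -W ω ≤ C := fun ω => by
      have : 0 ≤ avg n fun i => X i ω :=
        mul_nonneg (by positivity) (Finset.sum_nonneg fun i _ => hX0 i ω)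
      simp only [hW]
      linarith
    set T := {ω | ¬ dist (W ω) 0 < d} with hT
    have hTm : MeasurableSet T :=
      (measurableSet_lt (hWm.dist measurable_const) measurable_const).compl
    have hb : ∀ ω, Real.exp (-W ω) ≤ Real.exp d + T.indicator (fun _ => Real.exp C) ω := by
      intro ω
      by_cases hω : ω ∈ T
      · rw [Set.indicator_of_mem hω]
        have := Real.exp_le_exp.2 (hWC ω)
        have := Real.exp_pos d
        linarith
      · rw [Set.indicator_of_notMem hω, add_zero, Real.exp_le_exp]
        have : dist (W ω) 0 < d := not_not.1 hω
        rw [Real.dist_eq, sub_zero] at this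
        linarith [neg_abs_le (W ω)]
    have hI : Integrable (fun ω => T.indicator (fun _ => Real.exp C) ω) P :=
      (integrable_const _).indicator hTm
    calc ∫ ω, Real.exp (-W ω) ∂P
        ≤ ∫ ω, (Real.exp d + T.indicator (fun _ => Real.exp C) ω) ∂P := by
          refine integral_mono ?_ ((integrable_const _).add hI) hb
          refine Integrable.of_bound (C := Real.exp C) (by fun_prop) (Eventually.of_forall fun ω => ?_)
          rw [Real.norm_eq_abs, abs_of_pos (Real.exp_pos _), Real.exp_le_exp]
          exact hWC ω
      _ = Real.exp d + Real.exp C * (P T).toReal := by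
          rw [integral_add (integrable_const _) hI, integral_indicator_const _ hTm]
          simp [Measure.real, mul_comm]
      _ ≤ 1 + ε := by linarith
  have hδsum : Tendsto (fun n => ∑ i ∈ Finset.range n, δ n i) atTop (𝓝 0) := by
    rw [Metric.tendsto_nhds]
    intro ε hε
    filter_upwards [hupper (ε / 2) (half_pos hε)] with n hn
    rw [Real.dist_eq, sub_zero, abs_of_nonneg (Finset.sum_nonneg fun i _ => hδ0 n i)]
    have h1 : 1 + ∑ i ∈ Finset.range n, δ n i ≤ ∏ i ∈ Finset.range n, (1 + δ n i) :=
      one_add_sum_le_prod_one_add (hδ0 n) n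
    rw [hprod] at hn
    linarith
  have hlim : Tendsto (fun n : ℕ => 16 * ∑ i ∈ Finset.range n, δ n i + 4 * C ^ 2 * (n : ℝ)⁻¹) atTop
      (𝓝 0) := by
    have h1 := hδsum.const_mul 16
    have h2 := (tendsto_inv_atTop_zero.comp
      (tendsto_natCast_atTop_atTop (R := ℝ))).const_mul (4 * C ^ 2)
    simpa using h1.add h2
  refine squeeze_zero (fun n => Finset.sum_nonneg fun i _ => integral_nonneg fun ω =>
    huber_nonneg _) (fun n => ?_) hlim
  -- `16 = 4 * 4`: one factor from separating the mean by `huber_le_add`, one from the quarter in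
  -- `huber_le_exp`.
  have key : ∀ i ∈ Finset.range n, ∫ ω, huber (X i ω / n) ∂P ≤ 16 * δ n i + 4 * (C / n) ^ 2 := by
    intro i _
    have h1 : ∫ ω, (16 * (Real.exp (-((X i ω - c i) / n)) - 1 + (X i ω - c i) / n) +
        4 * (C / n) ^ 2) ∂P = 16 * δ n i + 4 * (C / n) ^ 2 := by
      rw [integral_add ((hδ_int n i).const_mul 16) (integrable_const _), integral_const_mul]
      simp [hδ]
    rw [← h1]
    refine integral_mono (Integrable.huber_div (hXi i) n)
      (((hδ_int n i).const_mul 16).add (integrable_const _)) fun ω => ?_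
    have h2 : |X i ω / n| ≤ |(X i ω - c i) / n| + |c i / n| := by
      refine le_trans (le_of_eq ?_) (abs_add_le _ _)
      congr 1
      ring
    have h3 := huber_le_add h2
    have h4 := huber_le_exp ((X i ω - c i) / n)
    have h5 := huber_le_sq (c i / n)
    have h6 : (c i / n) ^ 2 ≤ (C / n) ^ 2 := by
      have := hc0 i
      have := hC i
      gcongr
    simp only
    linarith
  refine (Finset.sum_le_sum key).trans (le_of_eq ?_)
  rw [Finset.sum_add_distrib, ← Finset.mul_sum, Finset.sum_const, Finset.card_range, nsmul_eq_mul]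
  rcases Nat.eq_zero_or_pos n with rfl | hn
  · simp
  · field_simp

end LawOfLargeNumbers

/-! ### Moment bounds for errors, slopes and regressors -/

namespace RCModel

variable {Ω : Type*} {p K : ℕ} {M : RCModel Ω p K}

lemma norm_sq_w (i : ℕ) (ω : Ω) : ‖M.w i ω‖ ^ 2 = M.x i ω ^ 2 + ‖M.z i ω‖ ^ 2 := by
  rw [EuclideanSpace.real_norm_sq_eq, EuclideanSpace.real_norm_sq_eq, Fin.sum_univ_succ]
  simp [w]

lemma abs_x_le (i : ℕ) (ω : Ω) : |M.x i ω| ≤ ‖M.w i ω‖ := by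
  refine abs_le_of_sq_le_sq ?_ (norm_nonneg _)
  rw [norm_sq_w]
  nlinarith [sq_nonneg ‖M.z i ω‖]

lemma norm_z_le (i : ℕ) (ω : Ω) : ‖M.z i ω‖ ≤ ‖M.w i ω‖ := by
  refine le_of_sq_le_sq ?_ (norm_nonneg _)
  rw [norm_sq_w]
  nlinarith [sq_nonneg (M.x i ω)]

lemma abs_z_le (i : ℕ) (ω : Ω) (j : Fin p) : |M.z i ω j| ≤ ‖M.z i ω‖ :=
  PiLp.norm_apply_le (M.z i ω) j

variable [MeasurableSpace Ω] {P : Measure Ω}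

/-- The regressors as a function of the pair `(x, z)`. -/
def consE {p : ℕ} (a : ℝ × EuclideanSpace ℝ (Fin p)) : EuclideanSpace ℝ (Fin (p + 1)) :=
  WithLp.toLp 2 (Fin.cons a.1 (fun j => a.2 j))

lemma measurable_consE : Measurable (consE (p := p)) := by
  unfold consE
  refine (WithLp.measurable_toLp 2 _).comp (measurable_pi_lambda _ fun j => ?_)
  refine Fin.cases ?_ (fun j => ?_) j
  · simpa using measurable_fst
  · simp only [Fin.cons_succ]
    fun_prop

lemma IsModel.measurable_w (hM : M.IsModel P) (i : ℕ) : Measurable (M.w i) :=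
  measurable_consE.comp ((hM.meas_x i).prodMk (hM.meas_z i))

/-- A single category would have probability one, which is excluded. The consequences `3 ≤ 2K-1` and
`6 ≤ 4K-2` provide the moments for the central limit theorem. -/
lemma IsModel.two_le (hM : M.IsModel P) : 2 ≤ K := by
  by_contra h
  have hK : K = 0 ∨ K = 1 := by omega
  rcases hK with rfl | rfl
  · have := hM.prob_sum
    simp at this
  · have h1 := hM.prob_sum
    have h2 := (hM.prob_mem 0).2
    simp at h1
    linarith

lemma IsModel.ae_β_mem [IsProbabilityMeasure P] (hM : M.IsModel P) (i : ℕ) :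
    ∀ᵐ ω ∂P, ∃ k, M.β i ω = M.b k := by
  have hmk : ∀ k, MeasurableSet {ω | M.β i ω = M.b k} := fun k =>
    hM.meas_β i (measurableSet_singleton _)
  have h1 : P (⋃ k, {ω | M.β i ω = M.b k}) = 1 := by
    rw [measure_iUnion _ hmk, tsum_fintype]
    · simp_rw [hM.law_β]
      rw [← ENNReal.ofReal_sum_of_nonneg fun k _ => (hM.prob_mem k).1.le, hM.prob_sum,
        ENNReal.ofReal_one]
    · intro k l hkl
      refine Set.disjoint_left.2 fun ω (h1 : M.β i ω = M.b k) (h2 : M.β i ω = M.b l) => ?_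
      exact hkl (hM.b_mono.injective (h1.symm.trans h2))
  have h2 := (prob_compl_eq_zero_iff (MeasurableSet.iUnion hmk)).2 h1
  rw [ae_iff]
  convert! h2 using 2
  ext ω
  simp

/-- Bounded slopes reduce all moments of `y - z'γ` and `ξ` to those of `u` and `w`. -/
lemma IsModel.exists_bound_β [IsProbabilityMeasure P] (hM : M.IsModel P) :
    ∃ B : ℝ, 1 ≤ B ∧ |M.meanβ| ≤ B ∧ ∀ i, ∀ᵐ ω ∂P, |M.β i ω| ≤ B := by
  refine ⟨1 + |M.meanβ| + ∑ k, |M.b k|, ?_, ?_, fun i => ?_⟩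
  · have := Finset.sum_nonneg fun k (_ : k ∈ Finset.univ) => abs_nonneg (M.b k)
    have := abs_nonneg M.meanβ
    linarith
  · have := Finset.sum_nonneg fun k (_ : k ∈ Finset.univ) => abs_nonneg (M.b k)
    linarith
  · filter_upwards [hM.ae_β_mem i] with ω ⟨k, hk⟩
    have h1 := Finset.single_le_sum (f := fun k => |M.b k|) (fun k _ => abs_nonneg (M.b k))
      (Finset.mem_univ k)
    have := abs_nonneg M.meanβ
    rw [hk]
    linarith

lemma IsModel.integrable_β [IsProbabilityMeasure P] (hM : M.IsModel P) (i : ℕ) :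
    Integrable (M.β i) P := by
  obtain ⟨B, -, -, hB⟩ := hM.exists_bound_β
  exact Integrable.of_bound (hM.meas_β i).aestronglyMeasurable B (hB i)

lemma IsModel.integral_β [IsProbabilityMeasure P] (hM : M.IsModel P) (i : ℕ) :
    ∫ ω, M.β i ω ∂P = M.meanβ := by
  have hmk : ∀ k, MeasurableSet {ω | M.β i ω = M.b k} := fun k =>
    hM.meas_β i (measurableSet_singleton _)
  have h1 : M.β i =ᵐ[P] fun ω => ∑ k, {ω | M.β i ω = M.b k}.indicator (fun _ => M.b k) ω := by
    filter_upwards [hM.ae_β_mem i] with ω ⟨k, hk⟩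
    rw [Finset.sum_eq_single k]
    · simp [Set.indicator, hk]
    · intro l _ hl
      rw [Set.indicator_of_notMem]
      intro (h : M.β i ω = M.b l)
      exact hl (hM.b_mono.injective (h.symm.trans hk))
    · simp
  rw [integral_congr_ae h1, integral_finsetSum _ fun k _ => (integrable_const _).indicator (hmk k)]
  refine Finset.sum_congr rfl fun k _ => ?_
  rw [integral_indicator_const _ (hmk k), Measure.real, hM.law_β,
    ENNReal.toReal_ofReal (hM.prob_mem k).1.le, smul_eq_mul]

variable {Qww : Matrix (Fin (p + 1)) (Fin (p + 1)) ℝ} {qwy : EuclideanSpace ℝ (Fin (p + 1))}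

lemma Regularity.u_indep_w (hreg : M.Regularity P Qww qwy) (i : ℕ) :
    IndepFun (M.u i) (M.w i) P :=
  (hreg.u_indep i).comp (φ := id)
    (ψ := fun a : ℝ × EuclideanSpace ℝ (Fin p) × ℝ => consE (a.1, a.2.1)) measurable_id
    (measurable_consE.comp (by fun_prop))

/-- Uniform bounds for the mixed absolute moments of errors and regressors. -/
lemma Regularity.mixed_moments [IsProbabilityMeasure P]
    (hreg : M.Regularity P Qww qwy) :
    ∃ C : ℝ, 0 ≤ C ∧ ∀ i a b, a ≤ 2 * K - 1 → b ≤ 4 * K - 2 →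
      Integrable (fun ω => |M.u i ω| ^ a * ‖M.w i ω‖ ^ b) P ∧
      ∫ ω, |M.u i ω| ^ a * ‖M.w i ω‖ ^ b ∂P ≤ C := by
  obtain ⟨Cu, hCu⟩ := hreg.u_moments
  obtain ⟨Cw, hCw⟩ := hreg.w_moments
  have hu : ∀ i a, a ≤ 2 * K - 1 → Integrable (fun ω => |M.u i ω| ^ a) P ∧
      ∫ ω, |M.u i ω| ^ a ∂P ≤ max Cu 1 := by
    intro i a ha
    rcases Nat.eq_zero_or_pos a with rfl | ha0
    · simp
    · have := hCu i a (Finset.mem_Icc.2 ⟨ha0, ha⟩)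
      exact ⟨this.1, this.2.le.trans (le_max_left _ _)⟩
  have hw : ∀ i a, a ≤ 4 * K - 2 → Integrable (fun ω => ‖M.w i ω‖ ^ a) P ∧
      ∫ ω, ‖M.w i ω‖ ^ a ∂P ≤ max Cw 1 := by
    intro i a ha
    rcases Nat.eq_zero_or_pos a with rfl | ha0
    · simp
    · have := hCw i a (Finset.mem_Icc.2 ⟨ha0, ha⟩)
      exact ⟨this.1, this.2.le.trans (le_max_left _ _)⟩
  have h1u : 0 ≤ max Cu 1 := zero_le_one.trans (le_max_right _ _)
  have h1w : 0 ≤ max Cw 1 := zero_le_one.trans (le_max_right _ _)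
  refine ⟨max Cu 1 * max Cw 1, by positivity, fun i a b ha hb => ?_⟩
  have hind : IndepFun (fun ω => |M.u i ω| ^ a) (fun ω => ‖M.w i ω‖ ^ b) P :=
    (hreg.u_indep_w i).comp (φ := fun v : ℝ => |v| ^ a)
      (ψ := fun v : EuclideanSpace ℝ (Fin (p + 1)) => ‖v‖ ^ b) (by fun_prop) (by fun_prop)
  refine ⟨hind.integrable_mul (hu i a ha).1 (hw i b hb).1, ?_⟩
  rw [hind.integral_fun_mul_eq_mul_integral (hu i a ha).1.aestronglyMeasurable
    (hw i b hb).1.aestronglyMeasurable]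
  exact mul_le_mul (hu i a ha).2 (hw i b hb).2 (integral_nonneg fun ω => by positivity) h1u

end RCModel

/-! ### Limits and measurability of inverse matrices -/

section MatrixLemmas

lemma tendsto_rootRate : Tendsto rootRate atTop (𝓝 0) :=
  tendsto_inv_atTop_zero.comp (Real.tendsto_sqrt_atTop.comp tendsto_natCast_atTop_atTop)

lemma tendsto_matrix_inv {α m : Type*} [Fintype m] [DecidableEq m] {l : Filter α}
    {f : α → Matrix m m ℝ} {A : Matrix m m ℝ} (hA : IsUnit A.det) (hf : Tendsto f l (𝓝 A)) :
    Tendsto (fun a => (f a)⁻¹) l (𝓝 A⁻¹) := by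
  simp_rw [Matrix.inv_def, Ring.inverse_eq_inv']
  refine Tendsto.smul ?_ ?_
  · exact ((Continuous.matrix_det continuous_id).continuousAt.tendsto.comp hf).inv₀ hA.ne_zero
  · exact (Continuous.matrix_adjugate continuous_id).continuousAt.tendsto.comp hf

/-- The inverse is the adjugate times the inverse determinant, with value `0` where the determinant
vanishes, so no invertibility is needed. -/
lemma measurable_matrix_inv_apply {Ω m : Type*} [MeasurableSpace Ω] [Fintype m] [DecidableEq m]
    {f : Ω → Matrix m m ℝ} (hf : ∀ a b, Measurable fun ω => f ω a b) (a b : m) :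
    Measurable fun ω => (f ω)⁻¹ a b := by
  have hf' : Measurable fun ω => (fun a b => f ω a b : m → m → ℝ) :=
    measurable_pi_lambda _ fun a => measurable_pi_lambda _ fun b => hf a b
  have h1 : Continuous fun v : m → m → ℝ => (Matrix.of v).det :=
    Continuous.matrix_det continuous_id
  have h2 : Continuous fun v : m → m → ℝ => (Matrix.of v).adjugate a b :=
    (Continuous.matrix_adjugate (A := fun v : m → m → ℝ => Matrix.of v) continuous_id).matrix_elem
      a b
  have h3 : (fun ω => (f ω)⁻¹ a b) = fun ω => ((Matrix.of fun a b => f ω a b).det)⁻¹ *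
      (Matrix.of fun a b => f ω a b).adjugate a b := by
    ext ω
    rw [Matrix.inv_def, Ring.inverse_eq_inv']
    rfl
  rw [h3]
  exact (h1.measurable.comp hf').inv.mul (h2.measurable.comp hf')

open scoped Matrix.Norms.L2Operator in
lemma tendsto_matrix_of_norm_sub {α m n : Type*} [Fintype m] [Fintype n] [DecidableEq n]
    {l : Filter α} {f : α → Matrix m n ℝ} {A : Matrix m n ℝ}
    (h : Tendsto (fun a => ‖f a - A‖) l (𝓝 0)) : Tendsto f l (𝓝 A) :=
  tendsto_iff_norm_sub_tendsto_zero.2 h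

open scoped Matrix.Norms.L2Operator in
lemma tendsto_matrix_sub_zero_of_norm {α m n : Type*} [Fintype m] [Fintype n] [DecidableEq n]
    {l : Filter α} {f : α → Matrix m n ℝ}
    (h : Tendsto (fun a => ‖f a‖) l (𝓝 0)) : Tendsto f l (𝓝 0) :=
  tendsto_zero_iff_norm_tendsto_zero.2 h

end MatrixLemmas

/-! ### Algebra of sample averages -/

lemma avg_add (n : ℕ) (f g : ℕ → ℝ) : avg n (fun i => f i + g i) = avg n f + avg n g := by
  simp only [avg, Finset.sum_add_distrib, mul_add]

lemma avg_sub (n : ℕ) (f g : ℕ → ℝ) : avg n (fun i => f i - g i) = avg n f - avg n g := by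
  simp only [avg, Finset.sum_sub_distrib, mul_sub]

lemma avg_const_mul (n : ℕ) (c : ℝ) (f : ℕ → ℝ) : avg n (fun i => c * f i) = c * avg n f := by
  simp only [avg, ← Finset.mul_sum]
  ring

lemma avg_sum {ι : Type*} (s : Finset ι) (n : ℕ) (f : ι → ℕ → ℝ) :
    avg n (fun i => ∑ j ∈ s, f j i) = ∑ j ∈ s, avg n (f j) := by
  simp only [avg]
  rw [Finset.sum_comm, Finset.mul_sum]

lemma sqrt_mul_avg (n : ℕ) (f : ℕ → ℝ) :
    √(n : ℝ) * avg n f = (√(n : ℝ))⁻¹ * ∑ i ∈ Finset.range n, f i := by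
  rw [avg, ← mul_assoc]
  congr 1
  rcases Nat.eq_zero_or_pos n with rfl | hn
  · simp
  · have h : (0 : ℝ) < n := by exact_mod_cast hn
    have h1 : √(n : ℝ) ≠ 0 := by positivity
    have h2 := Real.mul_self_sqrt h.le
    field_simp
    rw [sq, h2]

/-! ### The least squares score and its central limit theorem -/

namespace RCModel

variable {Ω : Type*} {p K : ℕ} {M : RCModel Ω p K}

/-- The average least squares score `n⁻¹ ∑ w i ξ i`. -/
def score (M : RCModel Ω p K) (n : ℕ) (ω : Ω) : EuclideanSpace ℝ (Fin (p + 1)) :=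
  WithLp.toLp 2 fun a => avg n fun i => M.w i ω a * M.ξ i ω

/-- The least squares estimand `(E β, γ)`. -/
def φ₀ (M : RCModel Ω p K) : EuclideanSpace ℝ (Fin (p + 1)) := consE (M.meanβ, M.γ)

/-- Absorbing `x (β - E β)` into the error turns the random coefficient model into a linear
regression with constant coefficients. -/
lemma y_eq (i : ℕ) (ω : Ω) : M.y i ω = ∑ b, M.w i ω b * M.φ₀ b + M.ξ i ω := by
  rw [Fin.sum_univ_succ, y, ξ, PiLp.inner_apply]
  simp only [w, φ₀, consE, Fin.cons_zero, Fin.cons_succ]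
  have h : ∀ j, inner ℝ (M.z i ω j) (M.γ j) = M.z i ω j * M.γ j := fun j => by
    simp [mul_comm]
  simp_rw [h]
  ring

lemma q_eq (n : ℕ) (ω : Ω) : M.q n ω = mulE (M.Q n ω) M.φ₀ + M.score n ω := by
  ext a
  simp only [q, mulE, score, PiLp.add_apply, Matrix.mulVec, dotProduct, Q, Matrix.of_apply]
  have h : ∀ i, M.w i ω a * M.y i ω =
      ∑ b, M.φ₀ b * (M.w i ω a * M.w i ω b) + M.w i ω a * M.ξ i ω := fun i => by
    rw [y_eq, mul_add, Finset.mul_sum]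
    congr 1
    exact Finset.sum_congr rfl fun b _ => by ring
  simp_rw [h]
  rw [avg_add, avg_sum]
  congr 1
  refine Finset.sum_congr rfl fun b _ => ?_
  rw [avg_const_mul, mul_comm]

lemma γhat_sub_eq {n : ℕ} {ω : Ω} (h : IsUnit (M.Q n ω).det) :
    M.γhat n ω - M.γ = mulE ((M.Q n ω)⁻¹.submatrix Fin.succ id) (M.score n ω) := by
  ext j
  have h1 : M.φhat n ω = M.φ₀ + mulE (M.Q n ω)⁻¹ (M.score n ω) := by
    ext a
    simp only [φhat, q_eq, mulE, PiLp.add_apply, WithLp.ofLp_add, Matrix.mulVec_add,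
      Matrix.mulVec_mulVec, Matrix.nonsing_inv_mul _ h, Matrix.one_mulVec, Pi.add_apply]
  simp only [PiLp.sub_apply, γhat, h1, PiLp.add_apply]
  have h2 : M.φ₀ j.succ = M.γ j := by simp [φ₀, consE]
  rw [h2, add_sub_cancel_left]
  simp [mulE, Matrix.mulVec, dotProduct]

variable [MeasurableSpace Ω] {P : Measure Ω}

lemma IsModel.measurable_ξ (hM : M.IsModel P) (i : ℕ) : Measurable (M.ξ i) := by
  have h1 := hM.meas_x i
  have h2 := hM.meas_β i
  have h3 := hM.meas_u i
  unfold ξ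
  fun_prop

lemma IsModel.measurable_y (hM : M.IsModel P) (i : ℕ) : Measurable (M.y i) := by
  have h1 := hM.meas_x i
  have h2 := hM.meas_β i
  have h3 := hM.meas_u i
  have h4 := hM.meas_z i
  unfold y
  fun_prop

lemma IsModel.measurable_w_apply (hM : M.IsModel P) (i : ℕ) (a : Fin (p + 1)) :
    Measurable fun ω => M.w i ω a :=
  (by fun_prop : Measurable fun v : EuclideanSpace ℝ (Fin (p + 1)) => v a).comp (hM.measurable_w i)

lemma measurable_avg {f : ℕ → Ω → ℝ} (hf : ∀ i, Measurable (f i)) (n : ℕ) :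
    Measurable fun ω => avg n fun i => f i ω := by
  unfold avg
  exact (Finset.measurable_fun_sum _ fun i _ => hf i).const_mul _

lemma IsModel.measurable_γhat (hM : M.IsModel P) (n : ℕ) : Measurable (M.γhat n) := by
  refine (WithLp.measurable_toLp 2 _).comp (measurable_pi_lambda _ fun j => ?_)
  simp only [φhat, mulE, Matrix.mulVec, dotProduct]
  refine Finset.measurable_fun_sum _ fun b _ => Measurable.mul ?_ ?_
  · refine measurable_matrix_inv_apply (fun a b => ?_) _ _
    exact measurable_avg (fun i => (hM.measurable_w_apply i a).mul (hM.measurable_w_apply i b)) n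
  · exact measurable_avg (fun i => (hM.measurable_w_apply i b).mul (hM.measurable_y i)) n

variable [IsProbabilityMeasure P]
variable {Qww : Matrix (Fin (p + 1)) (Fin (p + 1)) ℝ} {qwy : EuclideanSpace ℝ (Fin (p + 1))}
  {Vwξ : Matrix (Fin (p + 1)) (Fin (p + 1)) ℝ}

lemma IsModel.exists_abs_ξ_le (hM : M.IsModel P) :
    ∃ B : ℝ, 1 ≤ B ∧ ∀ i, ∀ᵐ ω ∂P, |M.ξ i ω| ≤ |M.u i ω| + B * ‖M.w i ω‖ := by
  obtain ⟨B, h1, h2, h3⟩ := hM.exists_bound_β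
  refine ⟨2 * B, by linarith, fun i => ?_⟩
  filter_upwards [h3 i] with ω hω
  refine (abs_add_le _ _).trans ?_
  gcongr
  rw [abs_mul, mul_comm]
  have h4 : |M.β i ω - M.meanβ| ≤ 2 * B := (abs_sub _ _).trans (by linarith)
  exact mul_le_mul h4 (abs_x_le i ω) (abs_nonneg _) (by linarith)

/-- As `|ξ| ≤ |u| + B ‖w‖`, the cube is dominated by `|u|³ ‖w‖³` and `‖w‖⁶`; these orders are
available because `3 ≤ 2K-1` and `6 ≤ 4K-2`. -/
lemma Regularity.exists_score_moment (hM : M.IsModel P) (hreg : M.Regularity P Qww qwy) :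
    ∃ C : ℝ, 0 ≤ C ∧ ∀ i, Integrable (fun ω => (‖M.w i ω‖ * |M.ξ i ω|) ^ 3) P ∧
      ∫ ω, (‖M.w i ω‖ * |M.ξ i ω|) ^ 3 ∂P ≤ C := by
  have hK := hM.two_le
  obtain ⟨B, hB1, hB⟩ := hM.exists_abs_ξ_le
  obtain ⟨C, hC0, hC⟩ := hreg.mixed_moments
  refine ⟨8 * (C + B ^ 3 * C), by positivity, fun i => ?_⟩
  have h1 := hC i 3 3 (by omega) (by omega)
  have h2 := hC i 0 6 (by omega) (by omega)
  have hdom : Integrable (fun ω => 8 * (|M.u i ω| ^ 3 * ‖M.w i ω‖ ^ 3 +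
      B ^ 3 * (|M.u i ω| ^ 0 * ‖M.w i ω‖ ^ 6))) P :=
    (h1.1.add (h2.1.const_mul (B ^ 3))).const_mul 8
  have hle : ∀ᵐ ω ∂P, (‖M.w i ω‖ * |M.ξ i ω|) ^ 3 ≤ 8 * (|M.u i ω| ^ 3 * ‖M.w i ω‖ ^ 3 +
      B ^ 3 * (|M.u i ω| ^ 0 * ‖M.w i ω‖ ^ 6)) := by
    filter_upwards [hB i] with ω hω
    have h3 : (‖M.w i ω‖ * |M.ξ i ω|) ^ 3 ≤ (‖M.w i ω‖ * (|M.u i ω| + B * ‖M.w i ω‖)) ^ 3 := by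
      gcongr
    refine h3.trans ?_
    have h4 : (|M.u i ω| + B * ‖M.w i ω‖) ^ 3 ≤ 2 ^ (3 - 1) * (|M.u i ω| ^ 3 +
        (B * ‖M.w i ω‖) ^ 3) := add_pow_le (abs_nonneg _) (by positivity) 3
    rw [mul_pow]
    have h5 : 0 ≤ |M.u i ω| ^ 3 + (B * ‖M.w i ω‖) ^ 3 := by positivity
    calc ‖M.w i ω‖ ^ 3 * (|M.u i ω| + B * ‖M.w i ω‖) ^ 3
        ≤ ‖M.w i ω‖ ^ 3 * (8 * (|M.u i ω| ^ 3 + (B * ‖M.w i ω‖) ^ 3)) := by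
          gcongr
          norm_num at h4
          linarith
      _ = _ := by ring
  have hm : Measurable fun ω => (‖M.w i ω‖ * |M.ξ i ω|) ^ 3 := by
    have := hM.measurable_w i
    have := hM.measurable_ξ i
    fun_prop
  have hint : Integrable (fun ω => (‖M.w i ω‖ * |M.ξ i ω|) ^ 3) P := by
    refine hdom.mono' hm.aestronglyMeasurable ?_
    filter_upwards [hle] with ω hω
    rwa [Real.norm_eq_abs, abs_of_nonneg (by positivity)]
  refine ⟨hint, (integral_mono_ae hint hdom hle).trans ?_⟩
  rw [integral_const_mul, integral_add h1.1 (h2.1.const_mul (B ^ 3)), integral_const_mul]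
  gcongr
  · exact h1.2
  · exact h2.2

/-- Two independences are used: that of `u` and `w` kills `w u`, that of `β` and `(x, z)` kills `w x
(β - E β)`. -/
lemma Regularity.integral_w_mul_ξ (hM : M.IsModel P) (hreg : M.Regularity P Qww qwy) (i : ℕ)
    (a : Fin (p + 1)) :
    Integrable (fun ω => M.w i ω a * M.ξ i ω) P ∧ ∫ ω, M.w i ω a * M.ξ i ω ∂P = 0 := by
  have hK := hM.two_le
  obtain ⟨C, hC0, hC⟩ := hreg.mixed_moments
  have hwa : ∀ ω, |M.w i ω a| ≤ ‖M.w i ω‖ := fun ω => PiLp.norm_apply_le (M.w i ω) a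
  have hmw := hM.measurable_w_apply i a
  have hmx := hM.meas_x i
  have hwi : Integrable (fun ω => M.w i ω a) P := by
    refine (hC i 0 1 (by omega) (by omega)).1.mono' hmw.aestronglyMeasurable
      (Eventually.of_forall fun ω => ?_)
    simpa using hwa ω
  have hui : Integrable (M.u i) P := by
    refine (hC i 1 0 (by omega) (by omega)).1.mono' (hM.meas_u i).aestronglyMeasurable
      (Eventually.of_forall fun ω => ?_)
    simp
  have hwx : Integrable (fun ω => M.w i ω a * M.x i ω) P := by
    refine (hC i 0 2 (by omega) (by omega)).1.mono' (by fun_prop)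
      (Eventually.of_forall fun ω => ?_)
    rw [Real.norm_eq_abs, abs_mul, pow_zero, one_mul, sq]
    exact mul_le_mul (hwa ω) (abs_x_le i ω) (abs_nonneg _) (norm_nonneg _)
  have hind1 : IndepFun (fun ω => M.w i ω a) (M.u i) P :=
    ((hreg.u_indep_w i).comp (φ := id) (ψ := fun v : EuclideanSpace ℝ (Fin (p + 1)) => v a)
      measurable_id (by fun_prop)).symm
  have hmc : Measurable fun v : ℝ × EuclideanSpace ℝ (Fin p) => consE v a * v.1 := by
    have := measurable_consE (p := p)
    fun_prop
  have hind2 : IndepFun (fun ω => M.w i ω a * M.x i ω) (fun ω => M.β i ω - M.meanβ) P :=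
    ((hM.β_indep_w i).comp (φ := fun v : ℝ => v - M.meanβ)
      (ψ := fun v : ℝ × EuclideanSpace ℝ (Fin p) => consE v a * v.1) (by fun_prop) hmc).symm
  have hβi : Integrable (fun ω => M.β i ω - M.meanβ) P :=
    (hM.integrable_β i).sub (integrable_const _)
  have e : (fun ω => M.w i ω a * M.ξ i ω) = fun ω => M.w i ω a * M.u i ω +
      M.w i ω a * M.x i ω * (M.β i ω - M.meanβ) := by
    ext ω
    rw [ξ]
    ring
  have i1 : Integrable (fun ω => M.w i ω a * M.u i ω) P := hind1.integrable_mul hwi hui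
  have i2 : Integrable (fun ω => M.w i ω a * M.x i ω * (M.β i ω - M.meanβ)) P :=
    hind2.integrable_mul hwx hβi
  rw [e]
  refine ⟨i1.add i2, ?_⟩
  rw [integral_add i1 i2, hind1.integral_fun_mul_eq_mul_integral hwi.1 hui.1,
    hind2.integral_fun_mul_eq_mul_integral hwx.1 hβi.1, hM.mean_u,
    integral_sub (hM.integrable_β i) (integrable_const _), hM.integral_β]
  simp

lemma mulE_norm_le {ι κ : Type*} [Fintype ι] [Fintype κ] [DecidableEq ι] (B : Matrix κ ι ℝ) :
    ∃ C : ℝ, 0 ≤ C ∧ ∀ v : EuclideanSpace ℝ ι, ‖mulE B v‖ ≤ C * ‖v‖ := by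
  refine ⟨‖(Matrix.toLpLin 2 2 B).toContinuousLinearMap‖, norm_nonneg _, fun v => ?_⟩
  exact (Matrix.toLpLin 2 2 B).toContinuousLinearMap.le_opNorm v

/-- Asymptotic normality of linear images of the least squares score. -/
lemma tendstoInDistribution_score (hM : M.IsModel P) (hreg : M.Regularity P Qww qwy)
    (hV : M.ScoreVariance P Vwξ) {κ : Type*} [Fintype κ] [DecidableEq κ]
    (B : Matrix κ (Fin (p + 1)) ℝ) :
    TendstoInDistribution (fun (n : ℕ) ω => √(n : ℝ) • mulE B (M.score n ω)) atTop
      (id : EuclideanSpace ℝ κ → EuclideanSpace ℝ κ) (fun _ => P)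
      (multivariateGaussian 0 (B * Vwξ * Bᵀ)) := by
  set X : ℕ → Ω → EuclideanSpace ℝ κ := fun i ω => mulE B (M.ξ i ω • M.w i ω) with hX
  have hsum : (fun (n : ℕ) ω => √(n : ℝ) • mulE B (M.score n ω)) =
      fun (n : ℕ) ω => (√(n : ℝ))⁻¹ • ∑ i ∈ Finset.range n, X i ω := by
    ext n ω k
    simp only [hX, PiLp.smul_apply, smul_eq_mul, WithLp.ofLp_sum, Finset.sum_apply, mulE,
      Matrix.mulVec, dotProduct, score, WithLp.ofLp_smul, Pi.smul_apply]
    rw [← sqrt_mul_avg, avg_sum]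
    congr 1
    refine Finset.sum_congr rfl fun a _ => ?_
    rw [← avg_const_mul]
    congr 1
    ext i
    ring
  rw [hsum]
  obtain ⟨C, hC0, hC⟩ := hreg.exists_score_moment hM
  obtain ⟨D, hD0, hD⟩ := mulE_norm_le B
  have hXm : ∀ i, Measurable (X i) := fun i => by
    have h1 : ∀ a, Measurable fun ω => M.w i ω a := fun a => hM.measurable_w_apply i a
    have h2 := hM.measurable_ξ i
    refine (WithLp.measurable_toLp 2 _).comp (measurable_pi_lambda _ fun k => ?_)
    simp only [Matrix.mulVec, dotProduct, WithLp.ofLp_smul, Pi.smul_apply, smul_eq_mul]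
    exact Finset.measurable_fun_sum _ fun a _ => (h2.mul (h1 a)).const_mul _
  have hXle : ∀ i ω, ‖X i ω‖ ^ 3 ≤ D ^ 3 * (‖M.w i ω‖ * |M.ξ i ω|) ^ 3 := fun i ω => by
    rw [← mul_pow]
    gcongr
    refine (hD _).trans (le_of_eq ?_)
    rw [norm_smul, Real.norm_eq_abs, mul_comm |_|]
  have hX3 : ∀ i, Integrable (fun ω => ‖X i ω‖ ^ 3) P := fun i => by
    refine ((hC i).1.const_mul (D ^ 3)).mono' ((hXm i).norm.pow_const 3).aestronglyMeasurable
      (Eventually.of_forall fun ω => ?_)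
    rw [Real.norm_eq_abs, abs_of_nonneg (by positivity)]
    exact hXle i ω
  have hinner : ∀ i (t : EuclideanSpace ℝ κ) ω, inner ℝ (X i ω) t =
      ∑ a, (Bᵀ *ᵥ t.ofLp) a * (M.w i ω a * M.ξ i ω) := by
    intro i t ω
    have h1 : inner ℝ (X i ω) t = (B *ᵥ (M.ξ i ω • (M.w i ω).ofLp)) ⬝ᵥ t.ofLp := by
      rw [PiLp.inner_apply, dotProduct]
      refine Finset.sum_congr rfl fun k _ => ?_
      simp [hX, mulE, mul_comm]
    rw [h1, dotProduct_comm, Matrix.dotProduct_mulVec, ← Matrix.mulVec_transpose, dotProduct]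
    refine Finset.sum_congr rfl fun a _ => ?_
    simp only [Pi.smul_apply, smul_eq_mul]
    ring
  have hW2 : ∀ i a b, Integrable (fun ω => M.w i ω a * M.w i ω b * M.ξ i ω ^ 2) P := by
    intro i a b
    have h1 := hM.measurable_w_apply i a
    have h2 := hM.measurable_w_apply i b
    have h3 := hM.measurable_ξ i
    refine ((integrable_const 1).add (hC i).1).mono' (by fun_prop)
      (Eventually.of_forall fun ω => ?_)
    have ha : |M.w i ω a| ≤ ‖M.w i ω‖ := PiLp.norm_apply_le (M.w i ω) a
    have hb : |M.w i ω b| ≤ ‖M.w i ω‖ := PiLp.norm_apply_le (M.w i ω) b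
    rw [Real.norm_eq_abs, abs_mul, abs_mul, abs_pow]
    have h4 : |M.w i ω a| * |M.w i ω b| * |M.ξ i ω| ^ 2 ≤ (‖M.w i ω‖ * |M.ξ i ω|) ^ 2 := by
      rw [mul_pow]
      gcongr
      rw [sq]
      gcongr
    refine h4.trans ?_
    simp only [Pi.add_apply]
    set v := ‖M.w i ω‖ * |M.ξ i ω|
    have hv : 0 ≤ v := by positivity
    rcases le_or_gt v 1 with h | h
    · have := pow_le_one₀ (n := 2) hv h
      have := pow_nonneg hv 3
      linarith
    · have := pow_le_pow_right₀ h.le (show 2 ≤ 3 by norm_num)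
      linarith
  have hpsd : (B * Vwξ * Bᵀ).PosSemidef := by
    have := hV.pos.posSemidef.mul_mul_conjTranspose_same B
    simpa using this
  refine tendstoInDistribution_inv_sqrt_smul_sum (C := D ^ 3 * C) ?_ hXm hX3 ?_ ?_ hpsd ?_
  -- Each summand is the same measurable function of its own observation, so independence across
  -- observations is inherited.
  · have hmf : Measurable fun v : ℝ × EuclideanSpace ℝ (Fin p) × ℝ × ℝ =>
        mulE B ((v.2.2.2 + v.1 * (v.2.2.1 - M.meanβ)) • consE (v.1, v.2.1)) := by
      refine (WithLp.measurable_toLp 2 _).comp (measurable_pi_lambda _ fun k => ?_)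
      simp only [Matrix.mulVec, dotProduct, WithLp.ofLp_smul, Pi.smul_apply, smul_eq_mul]
      have hc := measurable_consE (p := p)
      refine Finset.measurable_fun_sum _ fun a _ => Measurable.const_mul (Measurable.mul ?_ ?_) _
      · fun_prop
      · have : Measurable fun v : ℝ × EuclideanSpace ℝ (Fin p) × ℝ × ℝ => consE (v.1, v.2.1) :=
          hc.comp (by fun_prop)
        fun_prop
    exact hM.indep.comp (fun _ v => mulE B ((v.2.2.2 + v.1 * (v.2.2.1 - M.meanβ)) •
      consE (v.1, v.2.1))) fun _ => hmf
  · intro i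
    refine (integral_mono (hX3 i) ((hC i).1.const_mul (D ^ 3)) (hXle i)).trans ?_
    rw [integral_const_mul]
    exact mul_le_mul_of_nonneg_left (hC i).2 (by positivity)
  · intro i t
    simp_rw [hinner]
    rw [integral_finsetSum _ fun a _ => ((hreg.integral_w_mul_ξ hM i a).1.const_mul _)]
    refine Finset.sum_eq_zero fun a _ => ?_
    rw [integral_const_mul, (hreg.integral_w_mul_ξ hM i a).2, mul_zero]
  · intro t
    set c := Bᵀ *ᵥ t.ofLp with hc
    have h1 : ∀ n, (avg n fun i => ∫ ω, inner ℝ (X i ω) t ^ 2 ∂P) =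
        ∑ a, ∑ b, c a * c b * M.meanWξ P n a b := by
      intro n
      have h2 : ∀ i, ∫ ω, inner ℝ (X i ω) t ^ 2 ∂P =
          ∑ a, ∑ b, c a * c b * ∫ ω, M.w i ω a * M.w i ω b * M.ξ i ω ^ 2 ∂P := by
        intro i
        have h3 : ∀ ω, inner ℝ (X i ω) t ^ 2 =
            ∑ a, ∑ b, c a * c b * (M.w i ω a * M.w i ω b * M.ξ i ω ^ 2) := fun ω => by
          rw [hinner, sq, Finset.sum_mul_sum]
          refine Finset.sum_congr rfl fun a _ => Finset.sum_congr rfl fun b _ => ?_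
          ring
        simp_rw [h3]
        rw [integral_finsetSum _ fun a _ => integrable_finsetSum _ fun b _ =>
          (hW2 i a b).const_mul _]
        refine Finset.sum_congr rfl fun a _ => ?_
        rw [integral_finsetSum _ fun b _ => (hW2 i a b).const_mul _]
        refine Finset.sum_congr rfl fun b _ => ?_
        rw [integral_const_mul]
      simp_rw [h2]
      rw [avg_sum]
      refine Finset.sum_congr rfl fun a _ => ?_
      rw [avg_sum]
      refine Finset.sum_congr rfl fun b _ => ?_
      rw [avg_const_mul]
      rfl
    simp_rw [h1]
    have h4 : t.ofLp ⬝ᵥ (B * Vwξ * Bᵀ) *ᵥ t.ofLp = ∑ a, ∑ b, c a * c b * Vwξ a b := by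
      rw [← Matrix.mulVec_mulVec, ← Matrix.mulVec_mulVec, Matrix.dotProduct_mulVec,
        ← Matrix.mulVec_transpose, ← hc, dotProduct]
      refine Finset.sum_congr rfl fun a _ => ?_
      rw [Matrix.mulVec, dotProduct, Finset.mul_sum]
      exact Finset.sum_congr rfl fun b _ => by ring
    rw [h4]
    have h5 : Tendsto (M.meanWξ P) atTop (𝓝 Vwξ) :=
      tendsto_matrix_of_norm_sub (hV.lim.trans_tendsto tendsto_rootRate)
    refine tendsto_finsetSum _ fun a _ => tendsto_finsetSum _ fun b _ => Tendsto.const_mul _ ?_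
    exact ((continuous_id.matrix_elem a b).tendsto _).comp h5

end RCModel

lemma norm_le_sum_abs {ι : Type*} [Fintype ι] (v : EuclideanSpace ℝ ι) : ‖v‖ ≤ ∑ j, |v j| := by
  refine le_of_sq_le_sq ?_ (Finset.sum_nonneg fun j _ => abs_nonneg _)
  rw [EuclideanSpace.real_norm_sq_eq]
  simp_rw [← sq_abs (v _)]
  exact Finset.sum_sq_le_sq_sum_of_nonneg fun j _ => abs_nonneg (v j)

/-! ### Asymptotic normality of the least squares estimator -/

namespace RCModel

variable {Ω : Type*} {p K : ℕ} {M : RCModel Ω p K}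
variable [MeasurableSpace Ω] {P : Measure Ω}
variable {Qww : Matrix (Fin (p + 1)) (Fin (p + 1)) ℝ} {qwy : EuclideanSpace ℝ (Fin (p + 1))}
  {Vwξ : Matrix (Fin (p + 1)) (Fin (p + 1)) ℝ}

lemma Regularity.tendsto_Q (hreg : M.Regularity P Qww qwy) :
    Tendsto (fun a : ℕ × Ω => M.Q a.1 a.2) (whp P) (𝓝 Qww) := by
  have h1 : Tendsto (fun a : ℕ × Ω => M.Q a.1 a.2 - M.meanQ P a.1) (whp P) (𝓝 0) :=
    tendsto_matrix_sub_zero_of_norm hreg.Q_lln.tendsto_zero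
  have h2 : Tendsto (M.meanQ P) atTop (𝓝 Qww) :=
    tendsto_matrix_of_norm_sub (hreg.meanQ_lim.trans_tendsto tendsto_rootRate)
  have := h1.add (h2.comp tendsto_fst_whp)
  simpa using this

lemma mulE_sub {ι κ : Type*} [Fintype ι] (A B : Matrix κ ι ℝ) (v : EuclideanSpace ℝ ι) :
    mulE (A - B) v = mulE A v - mulE B v := by
  ext k
  simp [mulE, Matrix.sub_mulVec]

variable [IsProbabilityMeasure P]

/-- Asymptotic normality of the least squares estimator of `γ`. -/
theorem tendstoInDistribution_γhat (hM : M.IsModel P) (hreg : M.Regularity P Qww qwy)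
    (hV : M.ScoreVariance P Vwξ) :
    TendstoInDistribution (fun (n : ℕ) ω => √(n : ℝ) • (M.γhat n ω - M.γ)) atTop
      (id : EuclideanSpace ℝ (Fin p) → EuclideanSpace ℝ (Fin p)) (fun _ => P)
      (multivariateGaussian 0 ((Qww⁻¹ * Vwξ * Qww⁻¹).submatrix Fin.succ Fin.succ)) := by
  set B : Matrix (Fin p) (Fin (p + 1)) ℝ := Qww⁻¹.submatrix Fin.succ id with hB
  have hQs : (Qww⁻¹)ᵀ = Qww⁻¹ := by
    rw [Matrix.transpose_nonsing_inv]
    congr 1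
    have := hreg.Qww_pos.isHermitian
    rwa [Matrix.IsHermitian, Matrix.conjTranspose_eq_transpose_of_trivial] at this
  have hcov : (Qww⁻¹ * Vwξ * Qww⁻¹).submatrix Fin.succ Fin.succ = B * Vwξ * Bᵀ := by
    rw [hB, Matrix.transpose_submatrix, hQs, Matrix.submatrix_mul _ _ _ id _ Function.bijective_id,
      Matrix.submatrix_mul _ _ _ id _ Function.bijective_id, Matrix.submatrix_id_id]
  rw [hcov]
  have hdet : IsUnit Qww.det := hreg.Qww_pos.det_pos.ne'.isUnit
  -- It remains to replace `Q_n⁻¹` by its limit: the error is a matrix tending to zero times `√n`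
  -- times the score.
  refine tendstoInDistribution_of_tendstoInMeasure_sub _ _ (tendstoInDistribution_score hM hreg hV B)
    ?_ fun n => ?_
  · refine (tendsto_whp_iff (c := (0 : EuclideanSpace ℝ (Fin p)))).1 ?_
    -- Tightness of the whole score comes from its own central limit theorem, taken with the
    -- identity matrix.
    have hS := bddInProb_norm_of_tendstoInDistribution
      (tendstoInDistribution_score hM hreg hV (1 : Matrix (Fin (p + 1)) (Fin (p + 1)) ℝ))
    have hinv := tendsto_matrix_inv hdet hreg.tendsto_Q
    have hev : ∀ᶠ a : ℕ × Ω in whp P, IsUnit (M.Q a.1 a.2).det := by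
      have h1 : Tendsto (fun a : ℕ × Ω => (M.Q a.1 a.2).det) (whp P) (𝓝 Qww.det) :=
        (Continuous.matrix_det continuous_id).continuousAt.tendsto.comp hreg.tendsto_Q
      filter_upwards [h1.eventually_ne hdet.ne_zero] with a ha
      exact isUnit_iff_ne_zero.2 ha
    have hlim : Tendsto (fun a : ℕ × Ω => ∑ j : Fin p, ∑ b,
        ‖√(a.1 : ℝ) • mulE (1 : Matrix (Fin (p + 1)) (Fin (p + 1)) ℝ) (M.score a.1 a.2)‖ *
        |(M.Q a.1 a.2)⁻¹ j.succ b - Qww⁻¹ j.succ b|) (whp P) (𝓝 0) := by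
      have h0 : (0 : ℝ) = ∑ j : Fin p, ∑ b : Fin (p + 1), 0 := by simp
      rw [h0]
      refine tendsto_finsetSum _ fun j _ => tendsto_finsetSum _ fun b _ => ?_
      refine hS.mul_tendsto_zero ?_
      have h1 := ((continuous_id.matrix_elem j.succ b).tendsto _).comp hinv
      have h2 := (h1.sub_const (Qww⁻¹ j.succ b)).abs
      simpa using h2
    refine squeeze_zero_norm' ?_ hlim
    filter_upwards [hev] with a ha
    have e : (√(a.1 : ℝ) • (M.γhat a.1 a.2 - M.γ)) - √(a.1 : ℝ) • mulE B (M.score a.1 a.2) =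
        √(a.1 : ℝ) • mulE ((M.Q a.1 a.2)⁻¹.submatrix Fin.succ id - B) (M.score a.1 a.2) := by
      rw [γhat_sub_eq ha, mulE_sub, smul_sub]
    simp only [Pi.sub_apply]
    rw [e]
    have h1 : mulE (1 : Matrix (Fin (p + 1)) (Fin (p + 1)) ℝ) (M.score a.1 a.2) =
        M.score a.1 a.2 := by simp [mulE]
    rw [h1]
    refine (norm_le_sum_abs _).trans ?_
    refine Finset.sum_le_sum fun j _ => ?_
    simp only [PiLp.smul_apply, mulE, Matrix.mulVec, dotProduct, smul_eq_mul, Finset.mul_sum]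
    refine (Finset.abs_sum_le_sum_abs _ _).trans (Finset.sum_le_sum fun b _ => ?_)
    have h2 : |√(a.1 : ℝ) * M.score a.1 a.2 b| ≤ ‖√(a.1 : ℝ) • M.score a.1 a.2‖ :=
      PiLp.norm_apply_le (√(a.1 : ℝ) • M.score a.1 a.2) b
    calc |√(a.1 : ℝ) * (((M.Q a.1 a.2)⁻¹.submatrix Fin.succ id - B) j b * M.score a.1 a.2 b)|
        = |√(a.1 : ℝ) * M.score a.1 a.2 b| * |(M.Q a.1 a.2)⁻¹ j.succ b - Qww⁻¹ j.succ b| := by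
          rw [← abs_mul]
          congr 1
          simp only [hB, Matrix.sub_apply, Matrix.submatrix_apply, id]
          ring
      _ ≤ _ := by gcongr
  · have := hM.measurable_γhat n
    exact (by fun_prop : Measurable fun ω => √(n : ℝ) • (M.γhat n ω - M.γ)).aemeasurable

end RCModel

/-! ### First-order expansions that survive pointwise limits -/

/-- Induction on `r`: the remainder for `r + 1` is `(e - d)` times that for `r`, plus `r d²
e^(r-1)`, and `r (r - 1) + r ≤ (r + 1) r`. For `r < 2` the truncated exponent is harmless, since the
coefficient is zero. -/
lemma abs_sub_pow_taylor_le (e d : ℝ) (r : ℕ) :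
    |(e - d) ^ r - e ^ r + r * e ^ (r - 1) * d| ≤
      r * (r - 1) * (d ^ 2 * (|e| + |d|) ^ (r - 2)) := by
  induction r with
  | zero => simp
  | succ r ih =>
    rcases Nat.eq_zero_or_pos r with rfl | hr
    · simp
    obtain ⟨k, rfl⟩ : ∃ k, r = k + 1 := ⟨r - 1, by omega⟩
    simp only [Nat.add_sub_cancel, show k + 1 + 1 - 2 = k by omega] at ih ⊢
    set T := |e| + |d| with hT
    have hT0 : 0 ≤ T := by positivity
    have heT : |e| ≤ T := by linarith [abs_nonneg d]
    have hedT : |e - d| ≤ T := abs_sub _ _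
    have e1 : (e - d) ^ (k + 1 + 1) - e ^ (k + 1 + 1) + ((k + 1 + 1 : ℕ) : ℝ) * e ^ (k + 1) * d =
        (e - d) * ((e - d) ^ (k + 1) - e ^ (k + 1) + ((k + 1 : ℕ) : ℝ) * e ^ k * d) +
          ((k + 1 : ℕ) : ℝ) * (d ^ 2 * e ^ k) := by
      push_cast
      ring
    have hk : T * (((k + 1 : ℕ) : ℝ) * (((k + 1 : ℕ) : ℝ) - 1) * (d ^ 2 * T ^ (k + 1 - 2))) ≤
        ((k + 1 : ℕ) : ℝ) * (((k + 1 : ℕ) : ℝ) - 1) * (d ^ 2 * T ^ k) := by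
      rcases Nat.eq_zero_or_pos k with rfl | hk
      · simp
      · obtain ⟨j, rfl⟩ : ∃ j, k = j + 1 := ⟨k - 1, by omega⟩
        simp only [show j + 1 + 1 - 2 = j by omega]
        exact le_of_eq (by ring)
    rw [e1]
    refine (abs_add_le _ _).trans ?_
    rw [abs_mul]
    have h1 : |e - d| * |(e - d) ^ (k + 1) - e ^ (k + 1) + ((k + 1 : ℕ) : ℝ) * e ^ k * d| ≤
        T * (((k + 1 : ℕ) : ℝ) * (((k + 1 : ℕ) : ℝ) - 1) * (d ^ 2 * T ^ (k + 1 - 2))) :=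
      mul_le_mul hedT ih (abs_nonneg _) hT0
    have h2 : |((k + 1 : ℕ) : ℝ) * (d ^ 2 * e ^ k)| ≤ ((k + 1 : ℕ) : ℝ) * (d ^ 2 * T ^ k) := by
      rw [abs_mul, abs_mul, abs_pow e, abs_of_nonneg (sq_nonneg d), Nat.abs_cast]
      gcongr
    have h3 : 0 ≤ ((k + 1 : ℕ) : ℝ) * (d ^ 2 * T ^ k) := by positivity
    push_cast at *
    nlinarith

/-- A pointwise limit of functions with a uniform first order expansion at `γ` is differentiable
there, and the gradients converge. -/
lemma exists_hasFDerivAt_of_tendsto {ι : Type*} [Fintype ι] [DecidableEq ι]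
    {f : ℕ → EuclideanSpace ℝ ι → ℝ}
    {F : EuclideanSpace ℝ ι → ℝ} {a : ℕ → ι → ℝ} {γ : EuclideanSpace ℝ ι} {C : ℝ}
    (hf : ∀ g, Tendsto (fun n => f n g) atTop (𝓝 (F g)))
    (hexp : ∀ n δ, ‖δ‖ ≤ 1 → |f n (γ + δ) - f n γ - ∑ j, a n j * δ j| ≤ ‖δ‖ ^ 2 * C) :
    ∃ a₀ : ι → ℝ, (∀ j, Tendsto (fun n => a n j) atTop (𝓝 (a₀ j))) ∧
      ∃ L : EuclideanSpace ℝ ι →L[ℝ] ℝ, (∀ v, L v = ∑ j, a₀ j * v j) ∧ HasFDerivAt F L γ := by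
  have hcauchy : ∀ j, CauchySeq fun n => a n j := by
    intro j
    rw [Metric.cauchySeq_iff]
    intro ε hε
    -- A step of length `t` along the `j`-th axis recovers `a n j` from values of `f n` up to `t C`.
    -- Four errors of at most `t ε / 8` arise: two from the convergence of `f n` at the two points,
    -- two from the remainders.
    set t : ℝ := min 1 (ε / (8 * (|C| + 1))) with ht
    have ht0 : 0 < t := lt_min one_pos (by positivity)
    have ht1 : t ≤ 1 := min_le_left _ _
    have htC : |C| * t ≤ ε / 8 := by
      have h1 : t ≤ ε / (8 * (|C| + 1)) := min_le_right _ _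
      calc |C| * t ≤ (|C| + 1) * (ε / (8 * (|C| + 1))) := by gcongr; linarith
        _ = ε / 8 := by field_simp
    set δ : EuclideanSpace ℝ ι := EuclideanSpace.single j t with hδ
    have hδn : ‖δ‖ = t := by simp [hδ, abs_of_pos ht0]
    have hsum : ∀ n, ∑ k, a n k * δ k = a n j * t := fun n => by simp [hδ]
    obtain ⟨N1, h1⟩ := Metric.cauchySeq_iff.1 (hf (γ + δ)).cauchySeq (t * (ε / 8)) (by positivity)
    obtain ⟨N2, h2⟩ := Metric.cauchySeq_iff.1 (hf γ).cauchySeq (t * (ε / 8)) (by positivity)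
    refine ⟨max N1 N2, fun m hm n hn => ?_⟩
    have h3 := h1 m ((le_max_left _ _).trans hm) n ((le_max_left _ _).trans hn)
    have h4 := h2 m ((le_max_right _ _).trans hm) n ((le_max_right _ _).trans hn)
    have h5 := hexp m δ (by rw [hδn]; exact ht1)
    have h6 := hexp n δ (by rw [hδn]; exact ht1)
    rw [hsum, hδn] at h5 h6
    rw [Real.dist_eq] at h3 h4 ⊢
    have h7 : t ^ 2 * C ≤ t * (ε / 8) := by
      nlinarith [le_abs_self C]
    have h8 : |(a m j - a n j) * t| < t * ε := by
      rw [abs_lt]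
      rw [abs_lt] at h3 h4
      rw [abs_le] at h5 h6
      constructor <;> nlinarith
    rw [abs_mul, abs_of_pos ht0, mul_comm] at h8
    exact lt_of_mul_lt_mul_left h8 ht0.le
  choose a₀ ha₀ using fun j => cauchySeq_tendsto_of_complete (hcauchy j)
  refine ⟨a₀, ha₀, ∑ j, a₀ j • (EuclideanSpace.proj j : EuclideanSpace ℝ ι →L[ℝ] ℝ), ?_, ?_⟩
  · intro v
    simp
  · have hlim : ∀ δ, ‖δ‖ ≤ 1 → |F (γ + δ) - F γ - ∑ j, a₀ j * δ j| ≤ ‖δ‖ ^ 2 * C := by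
      intro δ hδ
      have h1 : Tendsto (fun n => |f n (γ + δ) - f n γ - ∑ j, a n j * δ j|) atTop
          (𝓝 |F (γ + δ) - F γ - ∑ j, a₀ j * δ j|) :=
        (((hf _).sub (hf _)).sub (tendsto_finsetSum _ fun j _ => (ha₀ j).mul_const _)).abs
      exact le_of_tendsto h1 (Eventually.of_forall fun n => hexp n δ hδ)
    rw [hasFDerivAt_iff_isLittleO_nhds_zero]
    have hO : (fun δ => F (γ + δ) - F γ -
        (∑ j, a₀ j • (EuclideanSpace.proj j : EuclideanSpace ℝ ι →L[ℝ] ℝ)) δ) =O[𝓝 0]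
        fun δ => ‖δ‖ ^ 2 := by
      refine Asymptotics.IsBigO.of_bound |C| ?_
      filter_upwards [Metric.ball_mem_nhds (0 : EuclideanSpace ℝ ι) one_pos] with δ hδ
      rw [mem_ball_zero_iff] at hδ
      have h1 := hlim δ hδ.le
      have hL : (∑ j, a₀ j • (EuclideanSpace.proj j : EuclideanSpace ℝ ι →L[ℝ] ℝ)) δ =
          ∑ j, a₀ j * δ j := by simp
      rw [hL, Real.norm_eq_abs, Real.norm_eq_abs, abs_pow, abs_norm]
      have h2 : ‖δ‖ ^ 2 * C ≤ |C| * ‖δ‖ ^ 2 := by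
        rw [mul_comm]
        gcongr
        exact le_abs_self C
      exact h1.trans h2
    refine hO.trans_isLittleO ?_
    have := Asymptotics.isLittleO_norm_pow_id (E' := EuclideanSpace ℝ ι) (n := 2) one_lt_two
    exact this

/-! ### Integrable envelopes for the sample moments -/

namespace RCModel

variable {Ω : Type*} {p K : ℕ} {M : RCModel Ω p K}

lemma ytilde_true (i : ℕ) (ω : Ω) : M.ytilde M.γ i ω = M.x i ω * M.β i ω + M.u i ω := by
  simp only [ytilde, y]
  ring

lemma ytilde_eq (g : EuclideanSpace ℝ (Fin p)) (i : ℕ) (ω : Ω) :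
    M.ytilde g i ω = M.ytilde M.γ i ω - inner ℝ (M.z i ω) (g - M.γ) := by
  simp only [ytilde, inner_sub_right]
  ring

variable [MeasurableSpace Ω] {P : Measure Ω}
variable {Qww : Matrix (Fin (p + 1)) (Fin (p + 1)) ℝ} {qwy : EuclideanSpace ℝ (Fin (p + 1))}

lemma IsModel.measurable_ytilde (hM : M.IsModel P) (g : EuclideanSpace ℝ (Fin p)) (i : ℕ) :
    Measurable (M.ytilde g i) := by
  have h1 := hM.measurable_y i
  have h2 := hM.meas_z i
  unfold ytilde
  fun_prop

variable [IsProbabilityMeasure P]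

lemma IsModel.exists_abs_ytilde_le (hM : M.IsModel P) :
    ∃ B : ℝ, 1 ≤ B ∧ ∀ i, ∀ᵐ ω ∂P, |M.ytilde M.γ i ω| + ‖M.w i ω‖ ≤ |M.u i ω| + B * ‖M.w i ω‖ := by
  obtain ⟨B, h1, -, h3⟩ := hM.exists_bound_β
  refine ⟨B + 1, by linarith, fun i => ?_⟩
  filter_upwards [h3 i] with ω hω
  rw [ytilde_true]
  have h4 : |M.x i ω * M.β i ω| ≤ B * ‖M.w i ω‖ := by
    rw [abs_mul, mul_comm]
    exact mul_le_mul hω (abs_x_le i ω) (abs_nonneg _) (by linarith)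
  have := abs_add_le (M.x i ω * M.β i ω) (M.u i ω)
  linarith

/-- Uniform moment bounds for the envelopes of the sample moments. -/
lemma Regularity.envelope_moments (hreg : M.Regularity P Qww qwy) {B : ℝ} (hB : 1 ≤ B) :
    ∃ C : ℝ, 0 ≤ C ∧ ∀ i a b, a ≤ 2 * K - 1 → a + b ≤ 4 * K - 2 →
      Integrable (fun ω => (|M.u i ω| + B * ‖M.w i ω‖) ^ a * ‖M.w i ω‖ ^ b) P ∧
      ∫ ω, (|M.u i ω| + B * ‖M.w i ω‖) ^ a * ‖M.w i ω‖ ^ b ∂P ≤ C := by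
  obtain ⟨C, hC0, hC⟩ := hreg.mixed_moments
  refine ⟨2 ^ (2 * K) * (C + B ^ (2 * K) * C), by positivity, fun i a b ha hab => ?_⟩
  have h1 := hC i a b ha (by omega)
  have h2 := hC i 0 (a + b) (by omega) hab
  have hm : AEStronglyMeasurable
      (fun ω => (|M.u i ω| + B * ‖M.w i ω‖) ^ a * ‖M.w i ω‖ ^ b) P := by
    rcases Nat.eq_zero_or_pos K with rfl | hK
    · have ha0 : a = 0 := by omega
      have hb0 : b = 0 := by omega
      subst ha0 hb0
      simpa using aestronglyMeasurable_const
    · have h3 := (hC i 1 0 (by omega) (by omega)).1.aestronglyMeasurable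
      have h4 := (hC i 0 1 (by omega) (by omega)).1.aestronglyMeasurable
      simp only [pow_one, pow_zero, mul_one, one_mul] at h3 h4
      exact ((h3.add (h4.const_mul B)).pow a).mul (h4.pow b)
  have hle : ∀ ω, (|M.u i ω| + B * ‖M.w i ω‖) ^ a * ‖M.w i ω‖ ^ b ≤
      2 ^ (2 * K) * (|M.u i ω| ^ a * ‖M.w i ω‖ ^ b +
        B ^ (2 * K) * (|M.u i ω| ^ 0 * ‖M.w i ω‖ ^ (a + b))) := by
    intro ω
    have h3 : (|M.u i ω| + B * ‖M.w i ω‖) ^ a ≤ 2 ^ (a - 1) * (|M.u i ω| ^ a +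
        (B * ‖M.w i ω‖) ^ a) := add_pow_le (abs_nonneg _) (by positivity) a
    have h4 : (2 : ℝ) ^ (a - 1) ≤ 2 ^ (2 * K) := pow_le_pow_right₀ (by norm_num) (by omega)
    have h5 : B ^ a ≤ B ^ (2 * K) := pow_le_pow_right₀ hB (by omega)
    calc (|M.u i ω| + B * ‖M.w i ω‖) ^ a * ‖M.w i ω‖ ^ b
        ≤ (2 ^ (2 * K) * (|M.u i ω| ^ a + B ^ (2 * K) * ‖M.w i ω‖ ^ a)) * ‖M.w i ω‖ ^ b := by
          gcongr
          refine h3.trans ?_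
          rw [mul_pow]
          gcongr
      _ = _ := by rw [pow_add]; ring
  have hdom := (h1.1.add (h2.1.const_mul (B ^ (2 * K)))).const_mul (2 ^ (2 * K))
  have hint : Integrable (fun ω => (|M.u i ω| + B * ‖M.w i ω‖) ^ a * ‖M.w i ω‖ ^ b) P := by
    refine hdom.mono' hm (Eventually.of_forall fun ω => ?_)
    rw [Real.norm_eq_abs, abs_of_nonneg (by positivity)]
    exact hle ω
  refine ⟨hint, (integral_mono hint hdom hle).trans ?_⟩
  simp only [Pi.add_apply]
  rw [integral_const_mul, integral_add h1.1 (h2.1.const_mul _), integral_const_mul]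
  have := h1.2
  have := h2.2
  gcongr

end RCModel

/-! ### Laws of large numbers at the critical moment orders -/

namespace RCModel

variable {Ω : Type*} {p K S : ℕ} {M : RCModel Ω p K}
variable [MeasurableSpace Ω] {P : Measure Ω}
variable {Qww : Matrix (Fin (p + 1)) (Fin (p + 1)) ℝ} {qwy : EuclideanSpace ℝ (Fin (p + 1))}
variable {Θ : Set (EuclideanSpace ℝ (ThetaIdx K))} {Sig : Set (EuclideanSpace ℝ (SigmaIdx K))}
  {σ₀ : EuclideanSpace ℝ (SigmaIdx K)} {An : ℕ → Ω → Matrix (MomIdx K S) (MomIdx K S) ℝ}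
  {A : Matrix (MomIdx K S) (MomIdx K S) ℝ}

lemma GMMConditions.tendsto_avg_x_pow (hgmm : M.GMMConditions P S Θ Sig σ₀ An A) {m : ℕ}
    (hm : m ≤ S) :
    Tendsto (fun a : ℕ × Ω => avg a.1 (fun i => M.x i a.2 ^ m) -
      avg a.1 fun i => ∫ ω, M.x i ω ^ m ∂P) (whp P) (𝓝 0) := by
  have h := (hgmm.moment_lln 0 m (by omega) (by omega)).tendsto_zero
  simp only [pow_zero, one_mul] at h
  exact h.congr fun a => avg_sub _ _ _

variable [IsProbabilityMeasure P]

/-- Products of powers of errors and regressors below the critical orders are negligible. -/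
lemma Regularity.negligible_mixed (hreg : M.Regularity P Qww qwy) {a b : ℕ}
    (ha : a + 1 ≤ 2 * K - 1) (hb : b + 1 ≤ 4 * K - 2) :
    Negligible P fun i ω => |M.u i ω| ^ a * ‖M.w i ω‖ ^ b := by
  obtain ⟨C, hC0, hC⟩ := hreg.mixed_moments
  refine (negligible_const (P := P) 1).of_approx (fun _ => integrable_const 1)
    (fun i => (hC i a b (by omega) (by omega)).1) fun η hη => ?_
  -- One moment is to spare in each variable: where both are at most `R` the product is bounded by a
  -- constant, and elsewhere one extra factor divided by `R` dominates it.
  set R : ℝ := max 1 (2 * C / η) with hR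
  have hR1 : 1 ≤ R := le_max_left _ _
  have hRη : 2 * C / R ≤ η := by
    rw [div_le_iff₀ (by linarith), mul_comm η, ← div_le_iff₀ hη]
    exact le_max_right _ _
  refine ⟨R ^ (a + b), one_le_pow₀ hR1, fun i ω => (|M.u i ω| ^ (a + 1) * ‖M.w i ω‖ ^ b +
    |M.u i ω| ^ a * ‖M.w i ω‖ ^ (b + 1)) / R, fun i => ?_⟩
  have h1 := hC i (a + 1) b ha (by omega)
  have h2 := hC i a (b + 1) (by omega) hb
  refine ⟨(h1.1.add h2.1).div_const R, ?_, Eventually.of_forall fun ω => ?_⟩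
  · have e : ∀ ω, |(|M.u i ω| ^ (a + 1) * ‖M.w i ω‖ ^ b +
        |M.u i ω| ^ a * ‖M.w i ω‖ ^ (b + 1)) / R| = (|M.u i ω| ^ (a + 1) * ‖M.w i ω‖ ^ b +
        |M.u i ω| ^ a * ‖M.w i ω‖ ^ (b + 1)) / R := fun ω => abs_of_nonneg (by positivity)
    simp_rw [e]
    rw [integral_div, integral_add h1.1 h2.1]
    refine le_trans ?_ hRη
    have := h1.2
    have := h2.2
    gcongr
    linarith
  · have e1 : |(|M.u i ω| ^ a * ‖M.w i ω‖ ^ b)| = |M.u i ω| ^ a * ‖M.w i ω‖ ^ b :=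
      abs_of_nonneg (by positivity)
    have e2 : |(|M.u i ω| ^ (a + 1) * ‖M.w i ω‖ ^ b + |M.u i ω| ^ a * ‖M.w i ω‖ ^ (b + 1)) / R| =
        (|M.u i ω| ^ (a + 1) * ‖M.w i ω‖ ^ b + |M.u i ω| ^ a * ‖M.w i ω‖ ^ (b + 1)) / R :=
      abs_of_nonneg (by positivity)
    rw [e1, e2, abs_one, mul_one]
    set v := |M.u i ω| with hv
    set w := ‖M.w i ω‖ with hw
    have hv0 : 0 ≤ v := abs_nonneg _
    have hw0 : 0 ≤ w := norm_nonneg _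
    have hR0 : 0 < R := by linarith
    have p1 : 0 ≤ v ^ (a + 1) * w ^ b := by positivity
    have p2 : 0 ≤ v ^ a * w ^ (b + 1) := by positivity
    have p3 : 0 ≤ R ^ (a + b) := by positivity
    have p4 : 0 ≤ v ^ a * w ^ b := by positivity
    by_cases hvR : v ≤ R
    · by_cases hwR : w ≤ R
      · have : v ^ a * w ^ b ≤ R ^ (a + b) := by
          rw [pow_add]
          gcongr
        have : 0 ≤ (v ^ (a + 1) * w ^ b + v ^ a * w ^ (b + 1)) / R := by positivity
        linarith
      · have : v ^ a * w ^ b ≤ (v ^ (a + 1) * w ^ b + v ^ a * w ^ (b + 1)) / R := by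
          rw [le_div_iff₀ hR0, pow_succ w b]
          nlinarith
        linarith
    · have : v ^ a * w ^ b ≤ (v ^ (a + 1) * w ^ b + v ^ a * w ^ (b + 1)) / R := by
        rw [le_div_iff₀ hR0]
        have : v ^ (a + 1) * w ^ b = v ^ a * w ^ b * v := by ring
        nlinarith
      linarith

lemma Regularity.integrable_x_pow (hM : M.IsModel P) (hreg : M.Regularity P Qww qwy) (i : ℕ)
    {m : ℕ} (hm : m ≤ 4 * K - 2) : Integrable (fun ω => M.x i ω ^ m) P := by
  obtain ⟨C, hC0, hC⟩ := hreg.mixed_moments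
  refine (hC i 0 m (by omega) hm).1.mono' ((hM.meas_x i).pow_const m).aestronglyMeasurable
    (Eventually.of_forall fun ω => ?_)
  rw [Real.norm_eq_abs, abs_pow, pow_zero, one_mul]
  gcongr
  exact abs_x_le i ω

/-- The delicate case is `m + 1 = 4K - 2`, where boundedness of the moments gives no uniform
integrability. This order is even, so `x^(m+1)` is nonnegative and the assumed convergence of its
averages makes it negligible by the converse weak law. Where `‖z‖ ≤ R |x|` the product is at most `R
|x|^(m+1)`; elsewhere it is at most `‖w‖^(m+1) / R`, small in mean. -/
lemma GMMConditions.negligible_x_pow_mul_z (hM : M.IsModel P) (hreg : M.Regularity P Qww qwy)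
    (hgmm : M.GMMConditions P S Θ Sig σ₀ An A) (hS' : S ≤ 4 * K - 2) {m : ℕ} (hm : m + 1 ≤ S) :
    Negligible P fun i ω => |M.x i ω| ^ m * ‖M.z i ω‖ := by
  have hK := hM.two_le
  obtain ⟨C, hC0, hC⟩ := hreg.mixed_moments
  have hmw : ∀ i, Measurable fun ω => |M.x i ω| ^ m * ‖M.z i ω‖ := fun i => by
    have := hM.meas_x i
    have := hM.meas_z i
    fun_prop
  have hle : ∀ i ω, |M.x i ω| ^ m * ‖M.z i ω‖ ≤ |M.u i ω| ^ 0 * ‖M.w i ω‖ ^ (m + 1) := by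
    intro i ω
    rw [pow_zero, one_mul, pow_succ]
    have := abs_x_le (M := M) i ω
    have := norm_z_le (M := M) i ω
    gcongr
  have hint : ∀ i, Integrable (fun ω => |M.x i ω| ^ m * ‖M.z i ω‖) P := fun i => by
    refine (hC i 0 (m + 1) (by omega) (by omega)).1.mono' (hmw i).aestronglyMeasurable
      (Eventually.of_forall fun ω => ?_)
    rw [Real.norm_eq_abs, abs_of_nonneg (by positivity)]
    exact hle i ω
  rcases lt_or_ge (m + 1) (4 * K - 2) with hlt | hge
  · refine (hreg.negligible_mixed (a := 0) (b := m + 1) (by omega) (by omega)).of_approx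
      (fun i => (hC i 0 (m + 1) (by omega) (by omega)).1) hint fun η hη =>
      ⟨1, le_rfl, fun _ _ => 0, fun i => ⟨integrable_const 0, by simpa using hη.le,
        Eventually.of_forall fun ω => ?_⟩⟩
    rw [abs_mul, abs_pow, abs_abs, abs_norm, one_mul, abs_zero, add_zero]
    exact (hle i ω).trans (le_abs_self _)
  · have hmS : m + 1 = S := by omega
    have heven : Even (m + 1) := ⟨2 * K - 1, by omega⟩
    have hxn : Negligible P fun i ω => M.x i ω ^ (m + 1) := by
      refine negligible_of_tendsto_avg_sub (C := C) ?_ (fun i => (hM.meas_x i).pow_const _)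
        (fun i => hreg.integrable_x_pow hM i (by omega)) (fun i ω => heven.pow_nonneg _) (fun i => ?_)
        (hgmm.tendsto_avg_x_pow hm)
      · exact hM.indep.comp (fun _ v => v.1 ^ (m + 1)) fun _ => by fun_prop
      · have h1 := hC i 0 (m + 1) (by omega) (by omega)
        refine (integral_mono (hreg.integrable_x_pow hM i (by omega)) h1.1 fun ω => ?_).trans h1.2
        simp only [pow_zero, one_mul]
        refine (le_abs_self _).trans ?_
        rw [abs_pow]
        have := abs_x_le (M := M) i ω
        gcongr
    refine hxn.of_approx (fun i => hreg.integrable_x_pow hM i (by omega)) hint fun η hη => ?_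
    set R : ℝ := max 1 (C / η) with hR
    have hR1 : 1 ≤ R := le_max_left _ _
    have hR0 : 0 < R := by linarith
    have hRη : C / R ≤ η := by
      rw [div_le_iff₀ hR0, mul_comm η, ← div_le_iff₀ hη]
      exact le_max_right _ _
    have h1 := fun i => hC i 0 (m + 1) (by omega) (by omega)
    refine ⟨R, hR1, fun i ω => (|M.u i ω| ^ 0 * ‖M.w i ω‖ ^ (m + 1)) / R, fun i =>
      ⟨(h1 i).1.div_const R, ?_, Eventually.of_forall fun ω => ?_⟩⟩
    · have e : ∀ ω, |(|M.u i ω| ^ 0 * ‖M.w i ω‖ ^ (m + 1)) / R| =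
          (|M.u i ω| ^ 0 * ‖M.w i ω‖ ^ (m + 1)) / R := fun ω => abs_of_nonneg (by positivity)
      simp_rw [e]
      rw [integral_div]
      refine le_trans ?_ hRη
      have := (h1 i).2
      gcongr
    · have e1 : |(|M.u i ω| ^ 0 * ‖M.w i ω‖ ^ (m + 1)) / R| =
          (|M.u i ω| ^ 0 * ‖M.w i ω‖ ^ (m + 1)) / R := abs_of_nonneg (by positivity)
      rw [e1, abs_mul, abs_pow, abs_abs, abs_norm, abs_pow]
      have hx := abs_x_le (M := M) i ω
      have hz := norm_z_le (M := M) i ω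
      have hx0 := abs_nonneg (M.x i ω)
      have hz0 := norm_nonneg (M.z i ω)
      have q1 : 0 ≤ (|M.u i ω| ^ 0 * ‖M.w i ω‖ ^ (m + 1)) / R := by positivity
      have q2 : 0 ≤ R * |M.x i ω| ^ (m + 1) := by positivity
      rcases le_total ‖M.z i ω‖ (R * |M.x i ω|) with h | h
      · have : |M.x i ω| ^ m * ‖M.z i ω‖ ≤ |M.x i ω| ^ m * (R * |M.x i ω|) := by gcongr
        have e : |M.x i ω| ^ m * (R * |M.x i ω|) = R * |M.x i ω| ^ (m + 1) := by ring
        linarith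
      · have h2 : |M.x i ω| ^ m * ‖M.z i ω‖ ≤ (|M.u i ω| ^ 0 * ‖M.w i ω‖ ^ (m + 1)) / R := by
          rw [le_div_iff₀ hR0, pow_zero, one_mul]
          obtain ⟨k, rfl⟩ : ∃ k, m = k + 1 := ⟨m - 1, by omega⟩
          calc |M.x i ω| ^ (k + 1) * ‖M.z i ω‖ * R
              = |M.x i ω| ^ k * (R * |M.x i ω|) * ‖M.z i ω‖ := by ring
            _ ≤ ‖M.w i ω‖ ^ k * ‖M.w i ω‖ * ‖M.w i ω‖ := by
                gcongr
                exact h.trans hz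
            _ = _ := by ring
        linarith

/-- Law of large numbers for the gradient of the sample moments in `γ`. -/
lemma GMMConditions.tendsto_avg_gradient (hM : M.IsModel P) (hreg : M.Regularity P Qww qwy)
    (hgmm : M.GMMConditions P S Θ Sig σ₀ An A) (hS' : S ≤ 4 * K - 2) {r s : ℕ}
    (hr : r + 1 ≤ 2 * K - 1) (hrs : r + 1 + s ≤ S) (j : Fin p) :
    (∀ i, Integrable (fun ω => M.ytilde M.γ i ω ^ r * M.x i ω ^ s * M.z i ω j) P) ∧
    Tendsto (fun a : ℕ × Ω =>
      avg a.1 (fun i => M.ytilde M.γ i a.2 ^ r * M.x i a.2 ^ s * M.z i a.2 j) -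
      avg a.1 fun i => ∫ ω, M.ytilde M.γ i ω ^ r * M.x i ω ^ s * M.z i ω j ∂P) (whp P) (𝓝 0) := by
  have hK := hM.two_le
  obtain ⟨B, hB1, hB⟩ := hM.exists_abs_ytilde_le
  obtain ⟨B', hB1', -, hB'⟩ := hM.exists_bound_β
  obtain ⟨C, hC0, hC⟩ := hreg.mixed_moments
  obtain ⟨C', hC0', hC'⟩ := hreg.envelope_moments hB1
  have hmZ : ∀ i, Measurable fun ω => M.ytilde M.γ i ω ^ r * M.x i ω ^ s * M.z i ω j := fun i => by
    have h1 := hM.measurable_ytilde M.γ i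
    have h2 := hM.meas_x i
    have h3 := hM.meas_z i
    fun_prop
  have hint : ∀ i, Integrable (fun ω => M.ytilde M.γ i ω ^ r * M.x i ω ^ s * M.z i ω j) P := by
    intro i
    refine (hC' i r (s + 1) (by omega) (by omega)).1.mono' (hmZ i).aestronglyMeasurable ?_
    filter_upwards [hB i] with ω hω
    rw [Real.norm_eq_abs, abs_mul, abs_mul, abs_pow, abs_pow, pow_succ, ← mul_assoc]
    have h1 := abs_x_le (M := M) i ω
    have h2 := (abs_z_le (M := M) i ω j).trans (norm_z_le i ω)
    have h3 := norm_nonneg (M.w i ω)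
    gcongr
    linarith
  refine ⟨hint, ?_⟩
  have hneg : Negligible P fun i ω => M.ytilde M.γ i ω ^ r * M.x i ω ^ s * M.z i ω j := by
    -- The gradient term is dominated by `|x|^(r+s) ‖z‖`, possibly of top order, and `|u|^r
    -- ‖w‖^(s+1)`, which for `r ≥ 1` lies strictly below both critical orders. For `r = 0` the first
    -- alone suffices, and the second could be critical.
    have hT1 := hgmm.negligible_x_pow_mul_z hM hreg hS' (m := r + s) (by omega)
    have hT1i : ∀ i, Integrable (fun ω => |M.x i ω| ^ (r + s) * ‖M.z i ω‖) P := fun i => by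
      refine (hC i 0 (r + s + 1) (by omega) (by omega)).1.mono' ?_ (Eventually.of_forall fun ω => ?_)
      · have := hM.meas_x i
        have := hM.meas_z i
        fun_prop
      · rw [Real.norm_eq_abs, abs_of_nonneg (by positivity), pow_zero, one_mul, pow_succ]
        have := abs_x_le (M := M) i ω
        have := norm_z_le (M := M) i ω
        gcongr
    rcases Nat.eq_zero_or_pos r with rfl | hr0
    · refine hT1.of_approx hT1i hint fun η hη =>
        ⟨1, le_rfl, fun _ _ => 0, fun i => ⟨integrable_const 0, by simpa using hη.le,
          Eventually.of_forall fun ω => ?_⟩⟩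
      rw [pow_zero, one_mul, zero_add, abs_mul, abs_pow, abs_mul, abs_pow, abs_abs, abs_norm,
        abs_zero, add_zero, one_mul]
      have := abs_z_le (M := M) i ω j
      gcongr
    · have hT2 := hreg.negligible_mixed (a := r) (b := s + 1) (by omega) (by omega)
      have hT2i := fun i => (hC i r (s + 1) (by omega) (by omega)).1
      refine (hT1.add hT2 hT1i hT2i).of_approx (fun i => (hT1i i).add (hT2i i)) hint fun η hη =>
        ⟨2 ^ r * B' ^ r, one_le_mul_of_one_le_of_one_le (one_le_pow₀ (by norm_num))
          (one_le_pow₀ hB1'), fun _ _ => 0, fun i => ⟨integrable_const 0, by simpa using hη.le, ?_⟩⟩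
      filter_upwards [hB' i] with ω hω
      rw [abs_zero, add_zero, abs_of_nonneg (by positivity : 0 ≤ |M.x i ω| ^ (r + s) * ‖M.z i ω‖ +
        |M.u i ω| ^ r * ‖M.w i ω‖ ^ (s + 1)), abs_mul, abs_mul, abs_pow, abs_pow, ytilde_true]
      have hx := abs_x_le (M := M) i ω
      have hz := abs_z_le (M := M) i ω j
      have hzw := norm_z_le (M := M) i ω
      have h1 : |M.x i ω * M.β i ω + M.u i ω| ≤ B' * |M.x i ω| + |M.u i ω| := by
        refine (abs_add_le _ _).trans ?_
        rw [abs_mul, mul_comm]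
        gcongr
      have h2 : (B' * |M.x i ω| + |M.u i ω|) ^ r ≤ 2 ^ (r - 1) * ((B' * |M.x i ω|) ^ r +
          |M.u i ω| ^ r) := add_pow_le (by positivity) (abs_nonneg _) r
      have h3 : (2 : ℝ) ^ (r - 1) ≤ 2 ^ r := pow_le_pow_right₀ (by norm_num) (by omega)
      have h4 : 1 ≤ B' ^ r := one_le_pow₀ hB1'
      calc |M.x i ω * M.β i ω + M.u i ω| ^ r * |M.x i ω| ^ s * |M.z i ω j|
          ≤ (2 ^ r * (B' ^ r * |M.x i ω| ^ r + B' ^ r * |M.u i ω| ^ r)) * |M.x i ω| ^ s *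
              ‖M.z i ω‖ := by
            gcongr
            calc |M.x i ω * M.β i ω + M.u i ω| ^ r ≤ (B' * |M.x i ω| + |M.u i ω|) ^ r := by gcongr
              _ ≤ 2 ^ (r - 1) * ((B' * |M.x i ω|) ^ r + |M.u i ω| ^ r) := h2
              _ ≤ 2 ^ r * (B' ^ r * |M.x i ω| ^ r + B' ^ r * |M.u i ω| ^ r) := by
                rw [mul_pow]
                gcongr
                exact le_mul_of_one_le_left (by positivity) h4
        _ = 2 ^ r * B' ^ r * (|M.x i ω| ^ (r + s) * ‖M.z i ω‖ +
              |M.u i ω| ^ r * (|M.x i ω| ^ s * ‖M.z i ω‖)) := by rw [pow_add]; ring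
        _ ≤ _ := by
            rw [pow_succ]
            gcongr
  refine hneg.tendsto_avg_sub ?_ hmZ hint
  refine hM.indep.comp (fun _ v => ((v.1 * v.2.2.1 + inner ℝ v.2.1 M.γ + v.2.2.2) -
    inner ℝ v.2.1 M.γ) ^ r * v.1 ^ s * v.2.1 j) fun _ => ?_
  fun_prop

end RCModel

lemma abs_avg_le (n : ℕ) (f : ℕ → ℝ) : |avg n f| ≤ avg n fun i => |f i| := by
  rw [avg, avg, abs_mul, abs_of_nonneg (by positivity : (0 : ℝ) ≤ (n : ℝ)⁻¹)]
  gcongr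
  exact Finset.abs_sum_le_sum_abs _ _

lemma avg_mono (n : ℕ) {f g : ℕ → ℝ} (h : ∀ i, f i ≤ g i) : avg n f ≤ avg n g := by
  unfold avg
  gcongr with i
  exact h i

lemma avg_le_of_le {n : ℕ} {f : ℕ → ℝ} {C : ℝ} (hC : 0 ≤ C) (h : ∀ i, f i ≤ C) : avg n f ≤ C := by
  rcases Nat.eq_zero_or_pos n with rfl | hn
  · simpa [avg] using hC
  · have hn' : (0 : ℝ) < n := by exact_mod_cast hn
    rw [avg, inv_mul_le_iff₀ hn']
    refine (Finset.sum_le_sum fun i _ => h i).trans ?_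
    simp

lemma integral_avg {Ω : Type*} [MeasurableSpace Ω] {P : Measure Ω} {f : ℕ → Ω → ℝ}
    (hf : ∀ i, Integrable (f i) P) (n : ℕ) :
    ∫ ω, avg n (fun i => f i ω) ∂P = avg n fun i => ∫ ω, f i ω ∂P := by
  simp only [avg]
  rw [integral_const_mul, integral_finsetSum _ fun i _ => hf i]

lemma integrable_avg {Ω : Type*} [MeasurableSpace Ω] {P : Measure Ω} {f : ℕ → Ω → ℝ}
    (hf : ∀ i, Integrable (f i) P) (n : ℕ) : Integrable (fun ω => avg n fun i => f i ω) P := by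
  simp only [avg]
  exact (integrable_finsetSum _ fun i _ => hf i).const_mul _

lemma bddInProb_avg {Ω : Type*} [MeasurableSpace Ω] {P : Measure Ω} {f : ℕ → Ω → ℝ} {C : ℝ}
    (hf : ∀ i, Integrable (f i) P) (hC0 : 0 ≤ C) (hC : ∀ i, ∫ ω, |f i ω| ∂P ≤ C) :
    BddInProb P fun n ω => avg n fun i => f i ω := by
  refine BddInProb.of_integral_le (C := C) (Eventually.of_forall fun n => integrable_avg hf n)
    (Eventually.of_forall fun n => ?_)
  refine le_trans ?_ (avg_le_of_le (n := n) hC0 hC)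
  rw [← integral_avg (fun i => (hf i).abs)]
  exact integral_mono (integrable_avg hf n).abs (integrable_avg (fun i => (hf i).abs) n)
    fun ω => abs_avg_le n _

/-! ### Expansion of the moments in the regression coefficient -/

namespace RCModel

variable {Ω : Type*} {p K S : ℕ} {M : RCModel Ω p K}
variable [MeasurableSpace Ω] {P : Measure Ω} [IsProbabilityMeasure P]
variable {Qww : Matrix (Fin (p + 1)) (Fin (p + 1)) ℝ} {qwy : EuclideanSpace ℝ (Fin (p + 1))}
variable {Θ : Set (EuclideanSpace ℝ (ThetaIdx K))} {Sig : Set (EuclideanSpace ℝ (SigmaIdx K))}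
  {σ₀ : EuclideanSpace ℝ (SigmaIdx K)} {An : ℕ → Ω → Matrix (MomIdx K S) (MomIdx K S) ℝ}
  {A : Matrix (MomIdx K S) (MomIdx K S) ℝ}

/-- First order expansion of the moments in `γ`, with an envelope for the remainder. -/
lemma Regularity.exists_envelope (hM : M.IsModel P) (hreg : M.Regularity P Qww qwy)
    (hS' : S ≤ 4 * K - 2) {r s : ℕ} (hr : r + 1 ≤ 2 * K - 1) (hrs : r + 1 + s ≤ S) :
    ∃ (H : ℕ → Ω → ℝ) (C : ℝ), 0 ≤ C ∧ (∀ i, Integrable (H i) P) ∧ (∀ i, ∫ ω, |H i ω| ∂P ≤ C) ∧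
      ∀ i, ∀ᵐ ω ∂P, ∀ δ : EuclideanSpace ℝ (Fin p), ‖δ‖ ≤ 1 →
        |M.ytilde (M.γ + δ) i ω ^ (r + 1) * M.x i ω ^ s - M.ytilde M.γ i ω ^ (r + 1) * M.x i ω ^ s +
          ∑ j, ((r + 1 : ℕ) : ℝ) * (M.ytilde M.γ i ω ^ r * M.x i ω ^ s * M.z i ω j) * δ j| ≤
        ‖δ‖ ^ 2 * H i ω := by
  obtain ⟨B, hB1, hB⟩ := hM.exists_abs_ytilde_le
  obtain ⟨C, hC0, hC⟩ := hreg.envelope_moments hB1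
  -- At `r = 0` the moment is affine in `γ` and the factor `r` removes the envelope, whose order `s
  -- + 2` could exceed the available moments; for `r ≥ 1` the total order is `r + 1 + s ≤ S`.
  refine ⟨fun i ω => ((r + 1 : ℕ) : ℝ) * r * ((|M.u i ω| + B * ‖M.w i ω‖) ^ (r - 1) *
    ‖M.w i ω‖ ^ (s + 2)), ((r + 1 : ℕ) : ℝ) * r * C, by positivity, fun i => ?_, fun i => ?_,
    fun i => ?_⟩
  · rcases Nat.eq_zero_or_pos r with rfl | hr0
    · simp
    · exact (hC i (r - 1) (s + 2) (by omega) (by omega)).1.const_mul _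
  · rcases Nat.eq_zero_or_pos r with rfl | hr0
    · simp
    · have h1 := hC i (r - 1) (s + 2) (by omega) (by omega)
      have e : ∀ ω, |((r + 1 : ℕ) : ℝ) * r * ((|M.u i ω| + B * ‖M.w i ω‖) ^ (r - 1) *
          ‖M.w i ω‖ ^ (s + 2))| = ((r + 1 : ℕ) : ℝ) * r * ((|M.u i ω| + B * ‖M.w i ω‖) ^ (r - 1) *
          ‖M.w i ω‖ ^ (s + 2)) := fun ω => abs_of_nonneg (by positivity)
      simp_rw [e]
      rw [integral_const_mul]
      exact mul_le_mul_of_nonneg_left h1.2 (by positivity)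
  · filter_upwards [hB i] with ω hω δ hδ
    set e := M.ytilde M.γ i ω with he
    set d := inner ℝ (M.z i ω) δ with hd
    have hw0 := norm_nonneg (M.w i ω)
    have hdle : |d| ≤ ‖M.w i ω‖ * ‖δ‖ :=
      (abs_real_inner_le_norm _ _).trans (by have := norm_z_le (M := M) i ω; gcongr)
    have hdw : |d| ≤ ‖M.w i ω‖ := hdle.trans (mul_le_of_le_one_right hw0 hδ)
    have hy : M.ytilde (M.γ + δ) i ω = e - d := by
      rw [ytilde_eq, add_sub_cancel_left]
    have hsum : ∑ j, ((r + 1 : ℕ) : ℝ) * (e ^ r * M.x i ω ^ s * M.z i ω j) * δ j =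
        ((r + 1 : ℕ) : ℝ) * e ^ r * d * M.x i ω ^ s := by
      rw [hd, PiLp.inner_apply, Finset.mul_sum, Finset.sum_mul]
      refine Finset.sum_congr rfl fun j _ => ?_
      simp only [RCLike.inner_apply, conj_trivial]
      ring
    rw [hy, hsum]
    have h1 := abs_sub_pow_taylor_le e d (r + 1)
    simp only [Nat.add_sub_cancel, show r + 1 - 2 = r - 1 by omega] at h1
    have e1 : (e - d) ^ (r + 1) * M.x i ω ^ s - e ^ (r + 1) * M.x i ω ^ s +
        ((r + 1 : ℕ) : ℝ) * e ^ r * d * M.x i ω ^ s =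
        ((e - d) ^ (r + 1) - e ^ (r + 1) + ((r + 1 : ℕ) : ℝ) * e ^ r * d) * M.x i ω ^ s := by ring
    rw [e1, abs_mul, abs_pow]
    have hx := abs_x_le (M := M) i ω
    have hd2 : d ^ 2 ≤ (‖M.w i ω‖ * ‖δ‖) ^ 2 := by
      rw [← sq_abs]
      gcongr
    have e2 : ((r + 1 : ℕ) : ℝ) - 1 = r := by push_cast; ring
    rw [e2] at h1
    calc |(e - d) ^ (r + 1) - e ^ (r + 1) + ((r + 1 : ℕ) : ℝ) * e ^ r * d| * |M.x i ω| ^ s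
        ≤ (((r + 1 : ℕ) : ℝ) * r * ((‖M.w i ω‖ * ‖δ‖) ^ 2 *
            (|M.u i ω| + B * ‖M.w i ω‖) ^ (r - 1))) * ‖M.w i ω‖ ^ s := by
          refine mul_le_mul (h1.trans ?_) (by gcongr) (by positivity) (by positivity)
          have hT : (|e| + |d|) ^ (r - 1) ≤ (|M.u i ω| + B * ‖M.w i ω‖) ^ (r - 1) :=
            pow_le_pow_left₀ (by positivity) (by linarith) _
          gcongr
      _ = _ := by ring

/-- The population moments are differentiable in `γ`, and the sample moments at the least squares
estimator have the corresponding expansion. -/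
lemma exists_moment_expansion (hM : M.IsModel P) (hreg : M.Regularity P Qww qwy)
    (hgmm : M.GMMConditions P S Θ Sig σ₀ An A) (hS' : S ≤ 4 * K - 2)
    {ρ : ℕ → ℕ → EuclideanSpace ℝ (Fin p) → ℝ} (hρ : M.IsPopMoment P S ρ)
    (hγ : Tendsto (fun a : ℕ × Ω => M.γhat a.1 a.2 - M.γ) (whp P) (𝓝 0)) {r s : ℕ}
    (hr : r + 1 ≤ 2 * K - 1) (hrs : r + 1 + s ≤ S) :
    ∃ L : EuclideanSpace ℝ (Fin p) →L[ℝ] ℝ, HasFDerivAt (ρ (r + 1) s) L M.γ ∧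
      (fun a : ℕ × Ω =>
        (avg a.1 fun i => M.ytilde (M.γhat a.1 a.2) i a.2 ^ (r + 1) * M.x i a.2 ^ s) -
        (avg a.1 fun i => M.ytilde M.γ i a.2 ^ (r + 1) * M.x i a.2 ^ s) -
        L (M.γhat a.1 a.2 - M.γ)) =o[whp P] fun a => M.γhat a.1 a.2 - M.γ := by
  obtain ⟨H, C, hC0, hHi, hHC, hH⟩ := hreg.exists_envelope hM hS' hr hrs
  obtain ⟨B, hB1, hB⟩ := hM.exists_abs_ytilde_le
  obtain ⟨C', hC0', hC'⟩ := hreg.envelope_moments hB1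
  have hgrad := fun j => hgmm.tendsto_avg_gradient hM hreg hS' hr hrs j
  have hbase : ∀ i, Integrable (fun ω => M.ytilde M.γ i ω ^ (r + 1) * M.x i ω ^ s) P := by
    intro i
    refine (hC' i (r + 1) s hr (by omega)).1.mono' ?_ ?_
    · have h1 := hM.measurable_ytilde M.γ i
      have h2 := hM.meas_x i
      fun_prop
    · filter_upwards [hB i] with ω hω
      rw [Real.norm_eq_abs, abs_mul, abs_pow, abs_pow]
      have h1 := abs_x_le (M := M) i ω
      have h3 := norm_nonneg (M.w i ω)
      gcongr
      linarith
  have hgi : ∀ i (δ : EuclideanSpace ℝ (Fin p)), Integrable (fun ω => ∑ j, ((r + 1 : ℕ) : ℝ) *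
      (M.ytilde M.γ i ω ^ r * M.x i ω ^ s * M.z i ω j) * δ j) P := fun i δ =>
    integrable_finsetSum _ fun j _ => (((hgrad j).1 i).const_mul _).mul_const _
  have hrem : ∀ i (δ : EuclideanSpace ℝ (Fin p)), ‖δ‖ ≤ 1 → Integrable (fun ω =>
      M.ytilde (M.γ + δ) i ω ^ (r + 1) * M.x i ω ^ s - M.ytilde M.γ i ω ^ (r + 1) * M.x i ω ^ s +
      ∑ j, ((r + 1 : ℕ) : ℝ) * (M.ytilde M.γ i ω ^ r * M.x i ω ^ s * M.z i ω j) * δ j) P := by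
    intro i δ hδ
    refine ((hHi i).const_mul (‖δ‖ ^ 2)).mono' ?_ ?_
    · have h1 := hM.measurable_ytilde M.γ i
      have h2 := hM.meas_x i
      have h3 := hM.measurable_ytilde (M.γ + δ) i
      exact ((by fun_prop : Measurable fun ω => M.ytilde (M.γ + δ) i ω ^ (r + 1) * M.x i ω ^ s -
        M.ytilde M.γ i ω ^ (r + 1) * M.x i ω ^ s).aestronglyMeasurable).add (hgi i δ).1
    · filter_upwards [hH i] with ω hω
      exact hω δ hδ
  have hshift : ∀ i (δ : EuclideanSpace ℝ (Fin p)), ‖δ‖ ≤ 1 → Integrable (fun ω =>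
      M.ytilde (M.γ + δ) i ω ^ (r + 1) * M.x i ω ^ s) P := by
    intro i δ hδ
    refine (((hrem i δ hδ).sub (hgi i δ)).add (hbase i)).congr (Eventually.of_forall fun ω => ?_)
    simp
  -- Taking means in the pointwise expansion keeps the remainder bounded uniformly in `n`. Thus the
  -- pointwise limit `ρ` inherits differentiability, and the averaged mean gradients converge
  -- without a separate assumption.
  obtain ⟨a₀, ha₀, L, hL, hLd⟩ := exists_hasFDerivAt_of_tendsto (C := C)
    (f := fun n g => avg n fun i => ∫ ω, M.ytilde g i ω ^ (r + 1) * M.x i ω ^ s ∂P)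
    (F := ρ (r + 1) s) (γ := M.γ)
    (a := fun n j => -(((r + 1 : ℕ) : ℝ) * avg n fun i =>
      ∫ ω, M.ytilde M.γ i ω ^ r * M.x i ω ^ s * M.z i ω j ∂P))
    (fun g => hρ (r + 1) s hr hrs g) (by
      intro n δ hδ
      have e : (avg n fun i => ∫ ω, M.ytilde (M.γ + δ) i ω ^ (r + 1) * M.x i ω ^ s ∂P) -
          (avg n fun i => ∫ ω, M.ytilde M.γ i ω ^ (r + 1) * M.x i ω ^ s ∂P) -
          ∑ j, -(((r + 1 : ℕ) : ℝ) * avg n fun i =>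
            ∫ ω, M.ytilde M.γ i ω ^ r * M.x i ω ^ s * M.z i ω j ∂P) * δ j =
          avg n fun i => ∫ ω, (M.ytilde (M.γ + δ) i ω ^ (r + 1) * M.x i ω ^ s -
            M.ytilde M.γ i ω ^ (r + 1) * M.x i ω ^ s + ∑ j, ((r + 1 : ℕ) : ℝ) *
              (M.ytilde M.γ i ω ^ r * M.x i ω ^ s * M.z i ω j) * δ j) ∂P := by
        have h1 : ∀ i, ∫ ω, (M.ytilde (M.γ + δ) i ω ^ (r + 1) * M.x i ω ^ s -
            M.ytilde M.γ i ω ^ (r + 1) * M.x i ω ^ s + ∑ j, ((r + 1 : ℕ) : ℝ) *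
              (M.ytilde M.γ i ω ^ r * M.x i ω ^ s * M.z i ω j) * δ j) ∂P =
            ∫ ω, M.ytilde (M.γ + δ) i ω ^ (r + 1) * M.x i ω ^ s ∂P -
            ∫ ω, M.ytilde M.γ i ω ^ (r + 1) * M.x i ω ^ s ∂P +
            ∑ j, (((r + 1 : ℕ) : ℝ) * δ j) *
              ∫ ω, M.ytilde M.γ i ω ^ r * M.x i ω ^ s * M.z i ω j ∂P := by
          intro i
          have h2 : Integrable (fun ω => M.ytilde (M.γ + δ) i ω ^ (r + 1) * M.x i ω ^ s -
            M.ytilde M.γ i ω ^ (r + 1) * M.x i ω ^ s) P := (hshift i δ hδ).sub (hbase i)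
          rw [integral_add h2 (hgi i δ), integral_sub (hshift i δ hδ) (hbase i),
            integral_finsetSum _ fun j _ => (((hgrad j).1 i).const_mul _).mul_const _]
          congr 1
          refine Finset.sum_congr rfl fun j _ => ?_
          rw [integral_mul_const, integral_const_mul]
          ring
        simp_rw [h1]
        rw [avg_add, avg_sub, avg_sum, sub_eq_add_neg _ (∑ j, _), ← Finset.sum_neg_distrib]
        congr 1
        refine Finset.sum_congr rfl fun j _ => ?_
        rw [avg_const_mul]
        ring
      rw [e]
      refine (abs_avg_le _ _).trans (avg_le_of_le (by positivity) fun i => ?_)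
      refine abs_integral_le_integral_abs.trans ?_
      have h3 : ∫ ω, ‖δ‖ ^ 2 * H i ω ∂P ≤ ‖δ‖ ^ 2 * C := by
        rw [integral_const_mul]
        have := (integral_mono (hHi i) (hHi i).abs fun ω => le_abs_self _).trans (hHC i)
        gcongr
      refine le_trans (integral_mono_ae (hrem i δ hδ).abs ((hHi i).const_mul _) ?_) h3
      filter_upwards [hH i] with ω hω
      exact hω δ hδ)
  refine ⟨L, hLd, ?_⟩
  have hbdd := bddInProb_avg hHi hC0 hHC
  set c : ℕ × Ω → Fin p → ℝ := fun a j => ((r + 1 : ℕ) : ℝ) * avg a.1 fun i =>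
    M.ytilde M.γ i a.2 ^ r * M.x i a.2 ^ s * M.z i a.2 j with hc
  have hclim : ∀ j, Tendsto (fun a => c a j + a₀ j) (whp P) (𝓝 0) := by
    intro j
    have h1 := ((hgrad j).2.const_mul ((r + 1 : ℕ) : ℝ)).sub ((ha₀ j).comp tendsto_fst_whp)
    have h2 := h1.add_const (a₀ j)
    simp only [mul_zero, zero_sub, neg_add_cancel] at h2
    refine h2.congr fun a => ?_
    simp only [Function.comp_apply, hc]
    ring
  -- The exceptional null set must not depend on `δ`, because the random value `γhat - γ` is
  -- substituted for it.
  have hall : ∀ᶠ a : ℕ × Ω in whp P, ∀ i, ∀ δ : EuclideanSpace ℝ (Fin p), ‖δ‖ ≤ 1 →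
        |M.ytilde (M.γ + δ) i a.2 ^ (r + 1) * M.x i a.2 ^ s -
          M.ytilde M.γ i a.2 ^ (r + 1) * M.x i a.2 ^ s + ∑ j, ((r + 1 : ℕ) : ℝ) *
          (M.ytilde M.γ i a.2 ^ r * M.x i a.2 ^ s * M.z i a.2 j) * δ j| ≤ ‖δ‖ ^ 2 * H i a.2 :=
    eventually_whp_of_forall_ae (p := fun _ ω => ∀ i, ∀ δ : EuclideanSpace ℝ (Fin p), ‖δ‖ ≤ 1 →
        |M.ytilde (M.γ + δ) i ω ^ (r + 1) * M.x i ω ^ s -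
          M.ytilde M.γ i ω ^ (r + 1) * M.x i ω ^ s + ∑ j, ((r + 1 : ℕ) : ℝ) *
          (M.ytilde M.γ i ω ^ r * M.x i ω ^ s * M.z i ω j) * δ j| ≤ ‖δ‖ ^ 2 * H i ω)
      fun _ => ae_all_iff.2 hH
  have hsmall : ∀ᶠ a : ℕ × Ω in whp P, ‖M.γhat a.1 a.2 - M.γ‖ ≤ 1 := by
    have := hγ.norm
    rw [norm_zero] at this
    exact this.eventually_le_const one_pos
  -- The relative error of the expansion: the averaged envelope times the step, plus the deviation
  -- of the sample gradient from its limit.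
  have hq : Tendsto (fun a : ℕ × Ω => (avg a.1 fun i => H i a.2) * ‖M.γhat a.1 a.2 - M.γ‖ +
      ∑ j, |c a j + a₀ j|) (whp P) (𝓝 0) := by
    have h1 : Tendsto (fun a : ℕ × Ω => (avg a.1 fun i => H i a.2) * ‖M.γhat a.1 a.2 - M.γ‖)
        (whp P) (𝓝 0) := hbdd.mul_tendsto_zero (by simpa using hγ.norm)
    have h2 : Tendsto (fun a => ∑ j, |c a j + a₀ j|) (whp P) (𝓝 0) := by
      have h3 := tendsto_finsetSum (Finset.univ : Finset (Fin p)) fun j _ => (hclim j).abs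
      simpa using h3
    simpa using h1.add h2
  rw [Asymptotics.isLittleO_iff]
  intro ε hε
  filter_upwards [hall, hsmall, hq.eventually_le_const hε] with a h1 h2 h3
  set δ := M.γhat a.1 a.2 - M.γ with hδ
  have hγδ : M.γhat a.1 a.2 = M.γ + δ := by rw [hδ]; abel
  have e : (avg a.1 fun i => M.ytilde (M.γhat a.1 a.2) i a.2 ^ (r + 1) * M.x i a.2 ^ s) -
        (avg a.1 fun i => M.ytilde M.γ i a.2 ^ (r + 1) * M.x i a.2 ^ s) - L δ =
      (avg a.1 fun i => M.ytilde (M.γ + δ) i a.2 ^ (r + 1) * M.x i a.2 ^ s -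
          M.ytilde M.γ i a.2 ^ (r + 1) * M.x i a.2 ^ s + ∑ j, ((r + 1 : ℕ) : ℝ) *
          (M.ytilde M.γ i a.2 ^ r * M.x i a.2 ^ s * M.z i a.2 j) * δ j) -
      ∑ j, (c a j + a₀ j) * δ j := by
    rw [hγδ, avg_add, avg_sub, avg_sum, hL]
    have h5 : ∀ j, (avg a.1 fun i => ((r + 1 : ℕ) : ℝ) *
          (M.ytilde M.γ i a.2 ^ r * M.x i a.2 ^ s * M.z i a.2 j) * δ j) = c a j * δ j := fun j => by
      simp only [hc]
      rw [← avg_const_mul, mul_comm, ← avg_const_mul]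
      congr 1
      ext i
      ring
    simp_rw [h5, add_mul]
    rw [Finset.sum_add_distrib]
    ring
  rw [e, Real.norm_eq_abs]
  refine (abs_sub _ _).trans ?_
  have h6 : |avg a.1 fun i => M.ytilde (M.γ + δ) i a.2 ^ (r + 1) * M.x i a.2 ^ s -
          M.ytilde M.γ i a.2 ^ (r + 1) * M.x i a.2 ^ s + ∑ j, ((r + 1 : ℕ) : ℝ) *
          (M.ytilde M.γ i a.2 ^ r * M.x i a.2 ^ s * M.z i a.2 j) * δ j| ≤
      ((avg a.1 fun i => H i a.2) * ‖δ‖) * ‖δ‖ := by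
    refine (abs_avg_le _ _).trans ((avg_mono _ fun i => h1 i δ h2).trans (le_of_eq ?_))
    rw [avg_const_mul]
    ring
  have h7 : |∑ j, (c a j + a₀ j) * δ j| ≤ (∑ j, |c a j + a₀ j|) * ‖δ‖ := by
    rw [Finset.sum_mul]
    refine (Finset.abs_sum_le_sum_abs _ _).trans (Finset.sum_le_sum fun j _ => ?_)
    rw [abs_mul]
    gcongr
    exact PiLp.norm_apply_le δ j
  refine (add_le_add h6 h7).trans ?_
  rw [← add_mul]
  gcongr

end RCModel

/-! ### Categorical distributions and their moments -/

section Identification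

open Polynomial

variable {K : ℕ}

lemma sum_probOf (hK : 1 ≤ K) (θ : EuclideanSpace ℝ (ThetaIdx K)) : ∑ k, probOf θ k = 1 := by
  obtain ⟨n, rfl⟩ : ∃ n, K = n + 1 := ⟨K - 1, by omega⟩
  rw [Fin.sum_univ_castSucc]
  have h1 : ∀ k : Fin n, probOf θ k.castSucc = θ (Sum.inl k) := fun k => by
    simp [probOf]
  have h2 : probOf θ (Fin.last n) = 1 - ∑ j : Fin n, θ (Sum.inl j) := by
    simp [probOf]
  simp_rw [h1, h2]
  ring

lemma hMom_zero (hK : 1 ≤ K) (θ : EuclideanSpace ℝ (ThetaIdx K)) : hMom θ 0 = 1 := by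
  simp [hMom, sum_probOf hK]

/-- Low order moments fix the means of all low degree polynomials, so test polynomials can be chosen
freely. -/
lemma sum_probOf_mul_eval (θ : EuclideanSpace ℝ (ThetaIdx K)) (f : ℝ[X]) {N : ℕ}
    (hN : f.natDegree < N) :
    ∑ k, probOf θ k * f.eval (suppOf θ k) = ∑ j ∈ Finset.range N, f.coeff j * hMom θ j := by
  simp_rw [Polynomial.eval_eq_sum_range' hN, Finset.mul_sum, hMom]
  rw [Finset.sum_comm]
  refine Finset.sum_congr rfl fun j _ => ?_
  rw [Finset.mul_sum]
  exact Finset.sum_congr rfl fun k _ => by ring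

lemma natDegree_prod_X_sub_C_erase (b : Fin K → ℝ) (k : Fin K) :
    (∏ l ∈ Finset.univ.erase k, (X - C (b l))).natDegree = K - 1 := by
  rw [natDegree_prod_of_monic _ _ fun l _ => monic_X_sub_C _]
  simp

/-- Test with the polynomial of degree `(K - 1) + K` that vanishes at all atoms of `θ'` and at all
atoms of `θ` but the `k`-th. Its mean is zero under `θ'`, but under `θ` it is nonzero if that atom
is missing from `θ'`. -/
lemma range_suppOf_subset {θ θ' : EuclideanSpace ℝ (ThetaIdx K)} (hθ : Admissible θ)
    (h : ∀ j, j ≤ 2 * K - 1 → hMom θ j = hMom θ' j) :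
    Set.range (suppOf θ) ⊆ Set.range (suppOf θ') := by
  rintro _ ⟨k, rfl⟩
  by_contra hk
  have hK : 1 ≤ K := Nat.one_le_iff_ne_zero.2 (by rintro rfl; exact k.elim0)
  set f : ℝ[X] := (∏ l ∈ Finset.univ.erase k, (X - C (suppOf θ l))) *
    ∏ l, (X - C (suppOf θ' l)) with hf
  have hdeg : f.natDegree < 2 * K := by
    refine lt_of_le_of_lt natDegree_mul_le ?_
    rw [natDegree_prod_X_sub_C_erase, natDegree_prod_of_monic _ _ fun l _ => monic_X_sub_C _]
    simp
    omega
  have h1 : ∑ l, probOf θ l * f.eval (suppOf θ l) = ∑ l, probOf θ' l * f.eval (suppOf θ' l) := by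
    rw [sum_probOf_mul_eval θ f hdeg, sum_probOf_mul_eval θ' f hdeg]
    refine Finset.sum_congr rfl fun j hj => ?_
    rw [h j (by have := Finset.mem_range.1 hj; omega)]
  have h2 : ∀ l, f.eval (suppOf θ' l) = 0 := fun l => by
    rw [hf, eval_mul, eval_prod (s := Finset.univ), Finset.prod_eq_zero (Finset.mem_univ l)
      (by simp), mul_zero]
  have h3 : ∀ l, l ≠ k → f.eval (suppOf θ l) = 0 := fun l hl => by
    rw [hf, eval_mul, eval_prod, Finset.prod_eq_zero (Finset.mem_erase.2 ⟨hl, Finset.mem_univ l⟩)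
      (by simp), zero_mul]
  have h4 : f.eval (suppOf θ k) ≠ 0 := by
    rw [hf, eval_mul, eval_prod, eval_prod]
    refine mul_ne_zero (Finset.prod_ne_zero_iff.2 fun l hl => ?_)
      (Finset.prod_ne_zero_iff.2 fun l _ => ?_)
    · simp only [eval_sub, eval_X, eval_C]
      exact sub_ne_zero.2 fun e => (Finset.mem_erase.1 hl).1 (hθ.2.injective e).symm
    · simp only [eval_sub, eval_X, eval_C]
      exact sub_ne_zero.2 fun e => hk ⟨l, e.symm⟩
  rw [Finset.sum_eq_single k (fun l _ hl => by rw [h3 l hl, mul_zero]) (by simp)] at h1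
  simp only [h2, mul_zero, Finset.sum_const_zero] at h1
  exact (mul_ne_zero (hθ.1 k).1.ne' h4) h1

/-- A categorical distribution with `K` categories is determined by its first `2K-1` moments. -/
lemma eq_of_hMom_eq {θ θ' : EuclideanSpace ℝ (ThetaIdx K)} (hθ : Admissible θ)
    (hθ' : Admissible θ') (h : ∀ j, j ≤ 2 * K - 1 → hMom θ j = hMom θ' j) : θ = θ' := by
  have hs : suppOf θ = suppOf θ' := (hθ.2.range_inj hθ'.2).1
    (Set.Subset.antisymm (range_suppOf_subset hθ h)
      (range_suppOf_subset hθ' fun j hj => (h j hj).symm))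
  have hp : ∀ k, probOf θ k = probOf θ' k := by
    intro k
    have hK : 1 ≤ K := Nat.one_le_iff_ne_zero.2 (by rintro rfl; exact k.elim0)
    -- With the supports equal, this Lagrange polynomial isolates the probability of the `k`-th
    -- atom.
    set f : ℝ[X] := ∏ l ∈ Finset.univ.erase k, (X - C (suppOf θ l)) with hf
    have hdeg : f.natDegree < 2 * K := by
      rw [hf, natDegree_prod_X_sub_C_erase]
      omega
    have h1 : ∑ l, probOf θ l * f.eval (suppOf θ l) =
        ∑ l, probOf θ' l * f.eval (suppOf θ' l) := by
      rw [sum_probOf_mul_eval θ f hdeg, sum_probOf_mul_eval θ' f hdeg]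
      refine Finset.sum_congr rfl fun j hj => ?_
      rw [h j (by have := Finset.mem_range.1 hj; omega)]
    have h3 : ∀ l, l ≠ k → f.eval (suppOf θ l) = 0 := fun l hl => by
      rw [hf, eval_prod, Finset.prod_eq_zero (Finset.mem_erase.2 ⟨hl, Finset.mem_univ l⟩) (by simp)]
    have h4 : f.eval (suppOf θ k) ≠ 0 := by
      rw [hf, eval_prod]
      refine Finset.prod_ne_zero_iff.2 fun l hl => ?_
      simp only [eval_sub, eval_X, eval_C]
      exact sub_ne_zero.2 fun e => (Finset.mem_erase.1 hl).1 (hθ.2.injective e).symm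
    rw [← hs, Finset.sum_eq_single k (fun l _ hl => by rw [h3 l hl, mul_zero]) (by simp),
      Finset.sum_eq_single k (fun l _ hl => by rw [h3 l hl, mul_zero]) (by simp)] at h1
    exact mul_right_cancel₀ h4 h1
  ext j
  rcases j with j | k
  · have hj : (j : ℕ) < K := by have := j.2; omega
    have := hp ⟨j, hj⟩
    simpa [probOf, j.2] using this
  · exact congrFun hs k

/-- The derivative of `probOf`, which is affine. -/
def dprob (v : EuclideanSpace ℝ (ThetaIdx K)) (k : Fin K) : ℝ :=
  if h : (k : ℕ) < K - 1 then v (Sum.inl ⟨k, h⟩) else -∑ j : Fin (K - 1), v (Sum.inl j)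

/-- The derivative of `hMom` at `θ` in the direction `v`. -/
def dhMom (θ v : EuclideanSpace ℝ (ThetaIdx K)) (j : ℕ) : ℝ :=
  ∑ k, (dprob v k * suppOf θ k ^ j + probOf θ k * (j * suppOf θ k ^ (j - 1) * suppOf v k))

lemma probOf_add_smul (θ v : EuclideanSpace ℝ (ThetaIdx K)) (t : ℝ) (k : Fin K) :
    probOf (θ + t • v) k = probOf θ k + t * dprob v k := by
  simp only [probOf, dprob]
  split_ifs
  · simp
  · simp only [PiLp.add_apply, PiLp.smul_apply, smul_eq_mul, Finset.sum_add_distrib,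
      ← Finset.mul_sum]
    ring

lemma suppOf_add_smul (θ v : EuclideanSpace ℝ (ThetaIdx K)) (t : ℝ) (k : Fin K) :
    suppOf (θ + t • v) k = suppOf θ k + t * suppOf v k := by
  simp [suppOf]

lemma hasDerivAt_hMom (θ v : EuclideanSpace ℝ (ThetaIdx K)) (j : ℕ) :
    HasDerivAt (fun t : ℝ => hMom (θ + t • v) j) (dhMom θ v j) 0 := by
  simp only [hMom, dhMom, probOf_add_smul, suppOf_add_smul]
  refine HasDerivAt.fun_sum fun k _ => ?_
  have h1 : HasDerivAt (fun t : ℝ => probOf θ k + t * dprob v k) (dprob v k) 0 := by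
    simpa using ((hasDerivAt_id (0 : ℝ)).mul_const (dprob v k)).const_add (probOf θ k)
  have h2 : HasDerivAt (fun t : ℝ => suppOf θ k + t * suppOf v k) (suppOf v k) 0 := by
    simpa using ((hasDerivAt_id (0 : ℝ)).mul_const (suppOf v k)).const_add (suppOf θ k)
  simpa using h1.fun_mul (h2.fun_pow j)

lemma sum_dprob (hK : 1 ≤ K) (v : EuclideanSpace ℝ (ThetaIdx K)) : ∑ k, dprob v k = 0 := by
  obtain ⟨n, rfl⟩ : ∃ n, K = n + 1 := ⟨K - 1, by omega⟩
  rw [Fin.sum_univ_castSucc]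
  have h1 : ∀ k : Fin n, dprob v k.castSucc = v (Sum.inl k) := fun k => by
    simp [dprob]
  have h2 : dprob v (Fin.last n) = -∑ j : Fin n, v (Sum.inl j) := by
    simp [dprob]
  simp_rw [h1, h2]
  ring

lemma dhMom_zero (hK : 1 ≤ K) (θ v : EuclideanSpace ℝ (ThetaIdx K)) : dhMom θ v 0 = 0 := by
  simp [dhMom, sum_dprob hK]

lemma sum_dprob_mul_eval (θ v : EuclideanSpace ℝ (ThetaIdx K)) (f : ℝ[X]) {N : ℕ}
    (hN : f.natDegree < N) :
    ∑ k, (dprob v k * f.eval (suppOf θ k) +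
      probOf θ k * (f.derivative.eval (suppOf θ k) * suppOf v k)) =
      ∑ j ∈ Finset.range N, f.coeff j * dhMom θ v j := by
  have hd : ∀ x, f.derivative.eval x = ∑ j ∈ Finset.range N, f.coeff j * (j * x ^ (j - 1)) := by
    intro x
    have e : f = ∑ j ∈ Finset.range N, C (f.coeff j) * X ^ j := by
      conv_lhs => rw [f.as_sum_range' N hN]
      simp [← C_mul_X_pow_eq_monomial]
    conv_lhs => rw [e]
    simp [derivative_X_pow, eval_finsetSum]
  simp_rw [hd, Polynomial.eval_eq_sum_range' hN, dhMom, Finset.mul_sum]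
  rw [Finset.sum_comm]
  refine Finset.sum_congr rfl fun k _ => ?_
  rw [Finset.sum_mul, Finset.mul_sum, ← Finset.sum_add_distrib]
  exact Finset.sum_congr rfl fun j _ => by ring

/-- Hermite interpolation. With `g` vanishing at all atoms but the `k`-th, `(X - b_k) g²` has degree
`2K - 1`, double zeros at the other atoms and a simple zero at `b_k`, which isolates the increment
of `b_k`. Once these increments vanish, `g` isolates that of the `k`-th probability. -/
lemma eq_zero_of_dhMom_eq_zero {θ v : EuclideanSpace ℝ (ThetaIdx K)} (hθ : Admissible θ)
    (h : ∀ j, j ≤ 2 * K - 1 → dhMom θ v j = 0) : v = 0 := by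
  have hpoly : ∀ f : ℝ[X], f.natDegree < 2 * K →
      ∑ k, (dprob v k * f.eval (suppOf θ k) +
        probOf θ k * (f.derivative.eval (suppOf θ k) * suppOf v k)) = 0 := by
    intro f hf
    rw [sum_dprob_mul_eval θ v f hf]
    refine Finset.sum_eq_zero fun j hj => ?_
    rw [h j (by have := Finset.mem_range.1 hj; omega), mul_zero]
  have hb : ∀ k, suppOf v k = 0 := by
    intro k
    have hK : 1 ≤ K := Nat.one_le_iff_ne_zero.2 (by rintro rfl; exact k.elim0)
    set g : ℝ[X] := ∏ l ∈ Finset.univ.erase k, (X - C (suppOf θ l)) with hg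
    have hgdeg : g.natDegree = K - 1 := natDegree_prod_X_sub_C_erase _ _
    have hg0 : ∀ l, l ≠ k → g.eval (suppOf θ l) = 0 := fun l hl => by
      rw [hg, eval_prod, Finset.prod_eq_zero (Finset.mem_erase.2 ⟨hl, Finset.mem_univ l⟩) (by simp)]
    have hgk : g.eval (suppOf θ k) ≠ 0 := by
      rw [hg, eval_prod]
      refine Finset.prod_ne_zero_iff.2 fun l hl => ?_
      simp only [eval_sub, eval_X, eval_C]
      exact sub_ne_zero.2 fun e => (Finset.mem_erase.1 hl).1 (hθ.2.injective e).symm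
    have h1 := hpoly ((X - C (suppOf θ k)) * g ^ 2) (by
      refine lt_of_le_of_lt natDegree_mul_le ?_
      have := natDegree_pow_le (p := g) (n := 2)
      rw [hgdeg] at this
      rw [natDegree_X_sub_C]
      omega)
    rw [Finset.sum_eq_single k] at h1
    · simp [derivative_mul, derivative_pow] at h1
      rcases h1 with h1 | h1 | h1
      · exact absurd h1 (hθ.1 k).1.ne'
      · exact absurd h1 hgk
      · exact h1
    · intro l _ hl
      simp [derivative_mul, derivative_pow, hg0 l hl]
    · simp
  have hp : ∀ k, dprob v k = 0 := by
    intro k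
    have hK : 1 ≤ K := Nat.one_le_iff_ne_zero.2 (by rintro rfl; exact k.elim0)
    set g : ℝ[X] := ∏ l ∈ Finset.univ.erase k, (X - C (suppOf θ l)) with hg
    have hgdeg : g.natDegree = K - 1 := natDegree_prod_X_sub_C_erase _ _
    have hg0 : ∀ l, l ≠ k → g.eval (suppOf θ l) = 0 := fun l hl => by
      rw [hg, eval_prod, Finset.prod_eq_zero (Finset.mem_erase.2 ⟨hl, Finset.mem_univ l⟩) (by simp)]
    have hgk : g.eval (suppOf θ k) ≠ 0 := by
      rw [hg, eval_prod]
      refine Finset.prod_ne_zero_iff.2 fun l hl => ?_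
      simp only [eval_sub, eval_X, eval_C]
      exact sub_ne_zero.2 fun e => (Finset.mem_erase.1 hl).1 (hθ.2.injective e).symm
    have h1 := hpoly g (by omega)
    rw [Finset.sum_eq_single k (fun l _ hl => by rw [hg0 l hl, hb]; ring) (by simp)] at h1
    rw [hb k, mul_zero, mul_zero, add_zero] at h1
    exact (mul_eq_zero.1 h1).resolve_right hgk
  ext j
  rcases j with j | k
  · have hj : (j : ℕ) < K := by have := j.2; omega
    have := hp ⟨j, hj⟩
    simpa [dprob, j.2] using this
  · exact hb k

/-- The Jacobian of the first `2K-1` moments is onto. -/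
lemma exists_dhMom_eq (hK : 1 ≤ K) {θ : EuclideanSpace ℝ (ThetaIdx K)} (hθ : Admissible θ)
    (c : ℕ → ℝ) (hc : c 0 = 0) :
    ∃ v : EuclideanSpace ℝ (ThetaIdx K), ∀ j, j ≤ 2 * K - 1 → dhMom θ v j = c j := by
  have hadd : ∀ v w j, dhMom θ (v + w) j = dhMom θ v j + dhMom θ w j := by
    intro v w j
    simp only [dhMom, ← Finset.sum_add_distrib]
    refine Finset.sum_congr rfl fun k _ => ?_
    have h1 : dprob (v + w) k = dprob v k + dprob w k := by
      simp only [dprob]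
      split_ifs
      · simp
      · simp [Finset.sum_add_distrib, add_comm]
    have h2 : suppOf (v + w) k = suppOf v k + suppOf w k := by simp [suppOf]
    rw [h1, h2]
    ring
  have hsmul : ∀ (t : ℝ) v j, dhMom θ (t • v) j = t * dhMom θ v j := by
    intro t v j
    simp only [dhMom, Finset.mul_sum]
    refine Finset.sum_congr rfl fun k _ => ?_
    have h1 : dprob (t • v) k = t * dprob v k := by
      simp only [dprob]
      split_ifs
      · simp
      · simp [Finset.mul_sum]
    have h2 : suppOf (t • v) k = t * suppOf v k := by simp [suppOf]
    rw [h1, h2]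
    ring
  let T : EuclideanSpace ℝ (ThetaIdx K) →ₗ[ℝ] (Fin (2 * K - 1) → ℝ) :=
    { toFun := fun v j => dhMom θ v (j + 1)
      map_add' := fun v w => funext fun j => hadd v w _
      map_smul' := fun t v => funext fun j => hsmul t v _ }
  have hinj : Function.Injective T := by
    refine (injective_iff_map_eq_zero T).2 fun v hv => eq_zero_of_dhMom_eq_zero hθ fun j hj => ?_
    rcases Nat.eq_zero_or_pos j with rfl | hj0
    · exact dhMom_zero hK θ v
    · have := congrFun hv ⟨j - 1, by omega⟩
      simp only [T, LinearMap.coe_mk, AddHom.coe_mk, Pi.zero_apply] at this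
      rwa [Nat.sub_add_cancel hj0] at this
  -- The system is square: `(K - 1) + K` coordinates against `2K - 1` moments.
  have hsurj : Function.Surjective T := by
    refine (LinearMap.injective_iff_surjective_of_finrank_eq_finrank ?_).1 hinj
    simp
    omega
  obtain ⟨v, hv⟩ := hsurj fun j => c (j + 1)
  refine ⟨v, fun j hj => ?_⟩
  rcases Nat.eq_zero_or_pos j with rfl | hj0
  · rw [dhMom_zero hK, hc]
  · have := congrFun hv ⟨j - 1, by omega⟩
    simp only [T, LinearMap.coe_mk, AddHom.coe_mk] at this
    rwa [Nat.sub_add_cancel hj0] at this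

end Identification

/-! ### Solving the moment equations order by order -/

section MomentSums

variable {K : ℕ}

/-- The moment of order `(r, s)` implied by `(θ, σ)` when the regressor has moments `m`. -/
def momSum (m : ℕ → ℝ) (θ : EuclideanSpace ℝ (ThetaIdx K)) (σ : EuclideanSpace ℝ (SigmaIdx K))
    (r s : ℕ) : ℝ :=
  ∑ t ∈ Finset.range (r + 1), (r.choose t : ℝ) * m (r - t + s) * sigmaExt σ t * hMom θ (r - t)

lemma sigmaExt_zero (σ : EuclideanSpace ℝ (SigmaIdx K)) : sigmaExt σ 0 = 1 := by simp [sigmaExt]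

lemma sigmaExt_one (σ : EuclideanSpace ℝ (SigmaIdx K)) : sigmaExt σ 1 = 0 := by simp [sigmaExt]

/-- Isolates the two quantities that are new at order `k + 1`, namely `h_{k+1}` from the first
summand and `σ_{k+1}` from the last; the others involve lower orders only. -/
lemma momSum_succ (hK : 1 ≤ K) (m : ℕ → ℝ) (θ : EuclideanSpace ℝ (ThetaIdx K))
    (σ : EuclideanSpace ℝ (SigmaIdx K)) (k s : ℕ) :
    momSum m θ σ (k + 1) s = ∑ t ∈ Finset.range k, ((k + 1).choose (t + 1) : ℝ) *
        m (k + 1 - (t + 1) + s) * sigmaExt σ (t + 1) * hMom θ (k + 1 - (t + 1)) +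
      (m (k + 1 + s) * hMom θ (k + 1) + m s * sigmaExt σ (k + 1)) := by
  rw [momSum, Finset.sum_range_succ, Finset.sum_range_succ']
  simp only [Nat.choose_zero_right, Nat.choose_self, sigmaExt_zero, Nat.sub_zero, Nat.sub_self,
    hMom_zero hK, zero_add, Nat.cast_one]
  ring

/-- The implied moments identify the parameters unless the regressor moments factor. -/
lemma eq_of_momSum_eq {S : ℕ} (hK : 1 ≤ K) (hS : 2 * K - 1 < S) {m : ℕ → ℝ} (m0 : m 0 = 1)
    (m2 : m 2 ≠ 0)
    (hne : ∀ r, 2 ≤ r → r ≤ 2 * K - 1 → ∃ s, r + s ≤ S ∧ m (r + s) ≠ m r * m s)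
    {θ θ' : EuclideanSpace ℝ (ThetaIdx K)} {σ σ' : EuclideanSpace ℝ (SigmaIdx K)}
    (hθ : Admissible θ) (hθ' : Admissible θ')
    (h : ∀ r s, 1 ≤ r → r ≤ 2 * K - 1 → r + s ≤ S → momSum m θ σ r s = momSum m θ' σ' r s) :
    θ = θ' ∧ σ = σ' := by
  have key : ∀ r, r ≤ 2 * K - 1 → hMom θ r = hMom θ' r ∧ sigmaExt σ r = sigmaExt σ' r := by
    intro r
    induction r using Nat.strong_induction_on with
    | _ r ih =>
      intro hr
      rcases r with _ | k
      · simp [hMom_zero hK, sigmaExt_zero]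
      have hrest : ∀ s, ∑ t ∈ Finset.range k, ((k + 1).choose (t + 1) : ℝ) *
          m (k + 1 - (t + 1) + s) * sigmaExt σ (t + 1) * hMom θ (k + 1 - (t + 1)) =
          ∑ t ∈ Finset.range k, ((k + 1).choose (t + 1) : ℝ) *
          m (k + 1 - (t + 1) + s) * sigmaExt σ' (t + 1) * hMom θ' (k + 1 - (t + 1)) := by
        intro s
        refine Finset.sum_congr rfl fun t ht => ?_
        have ht := Finset.mem_range.1 ht
        rw [(ih (t + 1) (by omega) (by omega)).2, (ih (k + 1 - (t + 1)) (by omega) (by omega)).1]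
      -- Each `s` gives a linear equation for the two new differences. The equation for `s = 0` and
      -- one for an `s` at which the moments do not factor form a nonsingular system.
      have heq : ∀ s, k + 1 + s ≤ S →
          m (k + 1 + s) * (hMom θ (k + 1) - hMom θ' (k + 1)) +
            m s * (sigmaExt σ (k + 1) - sigmaExt σ' (k + 1)) = 0 := by
        intro s hs
        have := h (k + 1) s (by omega) hr hs
        rw [momSum_succ hK, momSum_succ hK, hrest s] at this
        linarith
      -- At order one there is no unknown `σ`; the equation with `s = 1` is used, since `m 2 ≠ 0`
      -- while `m 1` may vanish.
      rcases Nat.eq_zero_or_pos k with rfl | hk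
      · have := heq 1 (by omega)
        rw [zero_add, sigmaExt_one, sigmaExt_one, sub_zero, mul_zero, add_zero] at this
        rw [zero_add, sigmaExt_one, sigmaExt_one]
        exact ⟨sub_eq_zero.1 ((mul_eq_zero.1 this).resolve_left m2), rfl⟩
      · obtain ⟨s, hs, hms⟩ := hne (k + 1) (by omega) hr
        have h0 := heq 0 (by omega)
        have h1 := heq s hs
        rw [add_zero, m0, one_mul] at h0
        have h2 : (m (k + 1 + s) - m (k + 1) * m s) * (hMom θ (k + 1) - hMom θ' (k + 1)) = 0 := by
          linear_combination h1 - m s * h0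
        have h3 := (mul_eq_zero.1 h2).resolve_left (sub_ne_zero.2 hms)
        rw [h3, mul_zero, zero_add] at h0
        exact ⟨sub_eq_zero.1 h3, sub_eq_zero.1 h0⟩
  refine ⟨eq_of_hMom_eq hθ hθ' fun j hj => (key j hj).1, ?_⟩
  ext j
  have := (key (j + 2) (by have := j.2; omega)).2
  simpa [sigmaExt] using this

/-- The linear part of `sigmaExt`. -/
def dsigma (τ : EuclideanSpace ℝ (SigmaIdx K)) (q : ℕ) : ℝ :=
  if h : 2 ≤ q ∧ q - 2 < 2 * K - 2 then τ ⟨q - 2, h.2⟩ else 0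

lemma sigmaExt_add_smul (σ τ : EuclideanSpace ℝ (SigmaIdx K)) (t : ℝ) (q : ℕ) :
    sigmaExt (σ + t • τ) q = sigmaExt σ q + t * dsigma τ q := by
  simp only [sigmaExt, dsigma]
  rcases Nat.eq_zero_or_pos q with rfl | hq
  · simp
  · rw [if_neg hq.ne', if_neg hq.ne']
    split_ifs <;> simp

lemma hasDerivAt_momSum (m : ℕ → ℝ) (θ v : EuclideanSpace ℝ (ThetaIdx K))
    (σ τ : EuclideanSpace ℝ (SigmaIdx K)) (r s : ℕ) :
    HasDerivAt (fun t : ℝ => momSum m (θ + t • v) (σ + t • τ) r s)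
      (∑ t ∈ Finset.range (r + 1), (r.choose t : ℝ) * m (r - t + s) *
        (dsigma τ t * hMom θ (r - t) + sigmaExt σ t * dhMom θ v (r - t))) 0 := by
  unfold momSum
  refine HasDerivAt.fun_sum fun t _ => ?_
  have h1 : HasDerivAt (fun a : ℝ => sigmaExt (σ + a • τ) t) (dsigma τ t) 0 := by
    simp_rw [sigmaExt_add_smul]
    simpa using ((hasDerivAt_id (0 : ℝ)).mul_const (dsigma τ t)).const_add (sigmaExt σ t)
  have h2 := ((h1.mul (hasDerivAt_hMom θ v (r - t))).const_mul ((r.choose t : ℝ) * m (r - t + s)))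
  simp only [zero_smul, add_zero, Pi.mul_apply] at h2
  refine h2.congr_of_eventuallyEq (Eventually.of_forall fun a => ?_)
  change _ = _ * (_ * _)
  ring

/-- Adding a small variance to `β` changes `h_j` by a multiple of `j.choose 2 * h_{j-2}`; if `x² =
A`, taking `A` times as much variance out of `u` compensates. Formally, the two sums cancel after
shifting `t` by two, since `r.choose t * (r - t).choose 2 = r.choose (t + 2) * (t + 2).choose 2`. -/
lemma sum_kernel_eq_zero {m f g : ℕ → ℝ} {A : ℝ} {S r s : ℕ}
    (hm : ∀ j, j + 2 ≤ S → m (j + 2) = A * m j) (hrs : r + s ≤ S) :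
    ∑ t ∈ Finset.range (r + 1), (r.choose t : ℝ) * m (r - t + s) *
      (-A * t.choose 2 * f (t - 2) * g (r - t) + f t * ((r - t).choose 2 * g (r - t - 2))) = 0 := by
  simp_rw [mul_add]
  rw [Finset.sum_add_distrib]
  rcases r with _ | _ | k
  · simp
  · simp [Finset.sum_range_succ]
  rw [Finset.sum_range_succ', Finset.sum_range_succ']
  rw [Finset.sum_range_succ (n := k + 2), Finset.sum_range_succ (n := k + 1)]
  have e1 : (k + 1 + 1 - (k + 1)).choose 2 = 0 := by
    rw [show k + 1 + 1 - (k + 1) = 1 by omega]; rfl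
  have e2 : (k + 1 + 1 - (k + 2)).choose 2 = 0 := by
    rw [show k + 1 + 1 - (k + 2) = 0 by omega]; rfl
  have e3 : (0 + 1).choose 2 = 0 := rfl
  have e4 : (0).choose 2 = 0 := rfl
  rw [e1, e2, e3, e4]
  simp only [Nat.cast_zero, mul_zero, zero_mul, add_zero]
  rw [← Finset.sum_add_distrib]
  refine Finset.sum_eq_zero fun t ht => ?_
  have ht : t < k + 1 := Finset.mem_range.1 ht
  have hc : ((k + 2).choose t : ℝ) * (k + 2 - t).choose 2 =
      (k + 2).choose (t + 2) * (t + 2).choose 2 := by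
    have h := Nat.choose_mul (n := k + 2) (k := t + 2) (s := t) (by omega)
    rw [Nat.choose_symm_of_eq_add (show t + 2 = t + 2 from rfl), Nat.add_sub_cancel_left] at h
    exact_mod_cast h.symm
  have h1 : k + 1 + 1 - (t + 1 + 1) = k + 1 + 1 - t - 2 := by omega
  have h2 : k + 1 + 1 - t + s = (k + 1 + 1 - t - 2 + s) + 2 := by omega
  rw [h2, hm _ (by omega), h1, show t + 1 + 1 - 2 = t by omega]
  linear_combination (A * m (k + 1 + 1 - t - 2 + s) * f t * g (k + 1 + 1 - t - 2)) * hc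

/-- If the regressor moments are those of a variable of constant modulus, then the implied moments
are constant to first order along some line. -/
lemma exists_hasDerivAt_momSum_eq_zero (hK : 2 ≤ K) {S : ℕ} {m : ℕ → ℝ} {A : ℝ} (hA : A ≠ 0)
    (hm : ∀ j, j + 2 ≤ S → m (j + 2) = A * m j) {θ : EuclideanSpace ℝ (ThetaIdx K)}
    (hθ : Admissible θ) (σ : EuclideanSpace ℝ (SigmaIdx K)) :
    ∃ v : EuclideanSpace ℝ (ThetaIdx K), ∃ τ : EuclideanSpace ℝ (SigmaIdx K), τ ≠ 0 ∧
      ∀ r s, r ≤ 2 * K - 1 → r + s ≤ S →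
        HasDerivAt (fun t : ℝ => momSum m (θ + t • v) (σ + t • τ) r s) 0 0 := by
  -- The variance shift leaves the categorical family, but its effect on the first `2K - 1` moments
  -- is matched by a tangent vector of the family.
  obtain ⟨v, hv⟩ := exists_dhMom_eq (by omega) hθ (fun j => j.choose 2 * hMom θ (j - 2)) (by simp)
  let τ : EuclideanSpace ℝ (SigmaIdx K) :=
    WithLp.toLp 2 fun j => -A * ((j : ℕ) + 2).choose 2 * sigmaExt σ j
  have hτ : ∀ q, q ≤ 2 * K - 1 → dsigma τ q = -A * q.choose 2 * sigmaExt σ (q - 2) := by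
    intro q hq
    rw [dsigma]
    split_ifs with h
    · simp only [τ]
      rw [Nat.sub_add_cancel h.1]
    · rw [Nat.choose_eq_zero_of_lt (by omega)]
      simp
  refine ⟨v, τ, fun h => ?_, fun r s hr hrs => ?_⟩
  -- The `σ_2` component of the direction is `-A`, which is not zero.
  · have := congrArg (fun τ => dsigma τ 2) h
    change dsigma τ 2 = dsigma 0 2 at this
    rw [hτ 2 (by omega)] at this
    simp [dsigma, sigmaExt_zero, hA] at this
  · convert hasDerivAt_momSum m θ v σ τ r s using 1
    rw [← sum_kernel_eq_zero (f := sigmaExt σ) (g := hMom θ) hm hrs]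
    refine Finset.sum_congr rfl fun t ht => ?_
    have := Finset.mem_range.1 ht
    rw [hτ t (by omega), hv (r - t) (by omega)]

end MomentSums

/-! ### The rank condition excludes regressors of constant modulus -/

section Jacobian

lemma mulE_jacobian {ι κ : Type*} [Fintype ι] [DecidableEq ι] [Fintype κ]
    (f : EuclideanSpace ℝ ι → EuclideanSpace ℝ κ) (a v : EuclideanSpace ℝ ι) :
    mulE (jacobian f a) v = fderiv ℝ f a v := by
  have hv : v = ∑ i, v i • EuclideanSpace.single i (1 : ℝ) := by
    ext j
    simp [Finset.sum_apply, Pi.single_apply]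
  ext k
  conv_rhs => rw [hv]
  simp [mulE, jacobian, Matrix.mulVec, dotProduct, mul_comm]

variable {K : ℕ}

lemma thetaPart_stack (θ : EuclideanSpace ℝ (ThetaIdx K)) (σ : EuclideanSpace ℝ (SigmaIdx K)) :
    thetaPart (stack θ σ) = θ := rfl

lemma sigmaPart_stack (θ : EuclideanSpace ℝ (ThetaIdx K)) (σ : EuclideanSpace ℝ (SigmaIdx K)) :
    sigmaPart (stack θ σ) = σ := rfl

lemma stack_add_smul (θ v : EuclideanSpace ℝ (ThetaIdx K)) (σ τ : EuclideanSpace ℝ (SigmaIdx K))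
    (t : ℝ) : stack θ σ + t • stack v τ = stack (θ + t • v) (σ + t • τ) := by
  ext j
  rcases j with j | j <;> simp [stack]

lemma continuous_stack :
    Continuous fun a : EuclideanSpace ℝ (ThetaIdx K) × EuclideanSpace ℝ (SigmaIdx K) =>
      stack a.1 a.2 := by
  unfold stack
  refine (PiLp.continuous_toLp 2 _).comp (continuous_pi fun j => ?_)
  rcases j with j | j <;> simp <;> fun_prop

lemma differentiable_sigmaExt_mul_hMom (t j : ℕ) :
    Differentiable ℝ fun η : EuclideanSpace ℝ (EtaIdx K) =>
      sigmaExt (sigmaPart η) t * hMom (thetaPart η) j := by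
  refine Differentiable.mul ?_ ?_
  · simp only [sigmaExt, sigmaPart]
    split_ifs <;> fun_prop
  · unfold hMom
    refine Differentiable.fun_sum fun k _ => Differentiable.mul ?_ (Differentiable.pow ?_ _)
    · simp only [probOf, thetaPart]
      split_ifs <;> fun_prop
    · simp only [suppOf, thetaPart]
      fun_prop

lemma momSum_eq_sum (m : ℕ → ℝ) (η : EuclideanSpace ℝ (EtaIdx K)) (r s : ℕ) :
    momSum m (thetaPart η) (sigmaPart η) r s = ∑ t ∈ Finset.range (r + 1),
      (r.choose t : ℝ) * m (r - t + s) * (sigmaExt (sigmaPart η) t * hMom (thetaPart η) (r - t)) :=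
  Finset.sum_congr rfl fun _ _ => by ring

lemma differentiable_momSum (m : ℕ → ℝ) (r s : ℕ) :
    Differentiable ℝ fun η : EuclideanSpace ℝ (EtaIdx K) =>
      momSum m (thetaPart η) (sigmaPart η) r s := by
  simp_rw [momSum_eq_sum]
  exact Differentiable.fun_sum fun t _ => (differentiable_sigmaExt_mul_hMom t _).const_mul _

lemma gPop_apply {p S : ℕ} (ρ : ℕ → ℕ → EuclideanSpace ℝ (Fin p) → ℝ)
    (θ : EuclideanSpace ℝ (ThetaIdx K)) (σ : EuclideanSpace ℝ (SigmaIdx K))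
    (g : EuclideanSpace ℝ (Fin p)) (rs : MomIdx K S) :
    gPop S ρ θ σ g rs = momSum (fun j => ρ 0 j g) θ σ (rs.1 + 1) rs.2 - ρ (rs.1 + 1) rs.2 g := rfl

lemma differentiable_gPop {p S : ℕ} (ρ : ℕ → ℕ → EuclideanSpace ℝ (Fin p) → ℝ)
    (g : EuclideanSpace ℝ (Fin p)) :
    Differentiable ℝ fun η : EuclideanSpace ℝ (EtaIdx K) =>
      gPop S ρ (thetaPart η) (sigmaPart η) g := by
  rw [differentiable_euclidean]
  intro rs
  simp_rw [gPop_apply]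
  exact (differentiable_momSum _ _ _).sub_const _

/-- Under the full rank condition the regressor does not have constant modulus. -/
lemma not_moments_eq_of_rank (hK : 2 ≤ K) {p S : ℕ} (ρ : ℕ → ℕ → EuclideanSpace ℝ (Fin p) → ℝ)
    {θ : EuclideanSpace ℝ (ThetaIdx K)} (hθ : Admissible θ) (σ : EuclideanSpace ℝ (SigmaIdx K))
    (g : EuclideanSpace ℝ (Fin p)) {A : Matrix (MomIdx K S) (MomIdx K S) ℝ}
    (hrank : ((GEta S ρ θ σ g)ᵀ * A * GEta S ρ θ σ g).PosDef) {a : ℝ} (ha : a ≠ 0) :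
    ¬ ∀ j, j + 2 ≤ S → ρ 0 (j + 2) g = a * ρ 0 j g := by
  intro hm
  obtain ⟨v, τ, hτ, hd⟩ := exists_hasDerivAt_momSum_eq_zero hK (m := fun j => ρ 0 j g) ha hm hθ σ
  have hne : stack v τ ≠ 0 := fun h => hτ (by
    have := congrArg sigmaPart h
    rw [sigmaPart_stack] at this
    rw [this]; rfl)
  have hker : mulE (GEta S ρ θ σ g) (stack v τ) = 0 := by
    rw [GEta, mulE_jacobian]
    have h1 := ((differentiable_gPop (S := S) ρ g) (stack θ σ)).hasFDerivAt
    have h2 : HasDerivAt (fun t : ℝ => stack θ σ + t • stack v τ) (stack v τ) 0 := by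
      simpa using ((hasDerivAt_id (0 : ℝ)).smul_const (stack v τ)).const_add (stack θ σ)
    have h3 := HasFDerivAt.comp_hasDerivAt_of_eq (0 : ℝ) h1 h2 (by simp)
    ext rs
    have h4 : HasDerivAt (fun t : ℝ => gPop S ρ (thetaPart (stack θ σ + t • stack v τ))
        (sigmaPart (stack θ σ + t • stack v τ)) g rs)
        (fderiv ℝ (fun η => gPop S ρ (thetaPart η) (sigmaPart η) g) (stack θ σ) (stack v τ) rs) 0 :=
      ((EuclideanSpace.proj rs : _ →L[ℝ] ℝ).hasFDerivAt.comp_hasDerivAt (0 : ℝ) h3 :)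
    refine h4.unique ?_
    simp_rw [stack_add_smul, thetaPart_stack, sigmaPart_stack, gPop_apply]
    have := rs.2.2
    simpa using (hd (rs.1 + 1) rs.2 (by have := rs.1.2; omega) (by omega)).sub_const
      (ρ (rs.1 + 1) rs.2 g)
  have hpos := hrank.dotProduct_mulVec_pos (x := (stack v τ).ofLp) (fun h => hne (by
    ext j; exact congrFun h j))
  have h0 : GEta S ρ θ σ g *ᵥ (stack v τ).ofLp = 0 := congrArg WithLp.ofLp hker
  rw [← Matrix.mulVec_mulVec, h0] at hpos
  simp at hpos

end Jacobian

/-! ### Factoring moments force constant modulus -/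

section FactoringMoments

/-- The two sides differ by `X (X^k - A^k) (X - A)`, nonnegative by monotonicity of powers. -/
lemma pow_sub_mul_sub_ge {X A : ℝ} (hX : 0 ≤ X) (hA : 0 ≤ A) (k : ℕ) :
    A ^ k * (X - A) ^ 2 ≤ (X ^ (k + 1) - A ^ (k + 1)) * (X - A) := by
  have h : (X ^ (k + 1) - A ^ (k + 1)) * (X - A) - A ^ k * (X - A) ^ 2 =
      X * ((X ^ k - A ^ k) * (X - A)) := by ring
  have h2 : 0 ≤ (X ^ k - A ^ k) * (X - A) := by
    rcases le_total X A with h | h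
    · exact mul_nonneg_of_nonpos_of_nonpos (sub_nonpos.2 (pow_le_pow_left₀ hX h k))
        (sub_nonpos.2 h)
    · exact mul_nonneg (sub_nonneg.2 (pow_le_pow_left₀ hA h k)) (sub_nonneg.2 h)
  have := mul_nonneg hX h2
  linarith

/-- Twice the right side equals `(x - a)² (x^(2l) + a^(2l)) + (x^(2l) - a^(2l)) (x² - a²)`, and the
second term is nonnegative. -/
lemma odd_pow_sub_mul_sub_ge (x a : ℝ) (l : ℕ) :
    (a ^ 2) ^ l / 2 * (x - a) ^ 2 ≤ (x ^ (2 * l + 1) - a ^ (2 * l + 1)) * (x - a) := by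
  have h : 2 * ((x ^ (2 * l + 1) - a ^ (2 * l + 1)) * (x - a)) =
      (x - a) ^ 2 * ((x ^ 2) ^ l + (a ^ 2) ^ l) + ((x ^ 2) ^ l - (a ^ 2) ^ l) * (x ^ 2 - a ^ 2) := by
    simp only [pow_succ]
    ring
  have h2 : 0 ≤ ((x ^ 2) ^ l - (a ^ 2) ^ l) * (x ^ 2 - a ^ 2) := by
    rcases l with _ | l
    · simp
    · exact le_trans (by positivity) (pow_sub_mul_sub_ge (sq_nonneg x) (sq_nonneg a) l)
  have h3 : 0 ≤ (x - a) ^ 2 * (x ^ 2) ^ l := by positivity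
  linarith

lemma abs_le_add_sq_div {ε : ℝ} (hε : 0 < ε) (d : ℝ) : |d| ≤ ε + d ^ 2 / ε := by
  rw [← sq_abs d, ← sub_le_iff_le_add', le_div_iff₀ hε]
  nlinarith [sq_nonneg (|d| - ε), abs_nonneg d, hε.le, mul_nonneg (abs_nonneg d) hε.le]

variable {Ω : Type*} [MeasurableSpace Ω] {P : Measure Ω} {X : ℕ → Ω → ℝ} {m : ℕ → ℝ}
  {N S : ℕ} {C : ℝ}

lemma integrable_pow_of_abs {Y : Ω → ℝ} (hY : Measurable Y) {j : ℕ}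
    (h : Integrable (fun ω => |Y ω| ^ j) P) : Integrable (fun ω => Y ω ^ j) P :=
  h.mono' (hY.pow_const j).aestronglyMeasurable (Eventually.of_forall fun ω => by simp)

/-- If `X² = A` up to a nonnegative function of `X` that vanishes on average, then the averaged
moments of `X` satisfy `m (j + 2) = A m j`. -/
lemma moments_eq_of_dominated (hX : ∀ i, Measurable (X i)) (hC0 : 0 ≤ C)
    (hC : ∀ i j, j ≤ N → Integrable (fun ω => |X i ω| ^ j) P ∧ ∫ ω, |X i ω| ^ j ∂P ≤ C)
    (hm : ∀ j, j ≤ S → Tendsto (fun n => avg n fun i => ∫ ω, X i ω ^ j ∂P) atTop (𝓝 (m j)))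
    {h : ℝ → ℝ} (hint : ∀ i, Integrable (fun ω => h (X i ω)) P) (h0 : ∀ x, 0 ≤ h x)
    (hlim : Tendsto (fun n => avg n fun i => ∫ ω, h (X i ω) ∂P) atTop (𝓝 0)) {A : ℝ}
    (hdom : ∀ R ε : ℝ, 0 < R → 0 < ε → ∃ D, 0 ≤ D ∧ ∀ x, |x| ≤ R → |x ^ 2 - A| ≤ ε + D * h x)
    {j : ℕ} (hjS : j + 2 ≤ S) (hjN : j + 3 ≤ N) : m (j + 2) = A * m j := by
  -- For `|x| ≤ R` the domination is used with `ε = 1 / R`; for `|x| > R` the factor `|x| / R ≥ 1`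
  -- trades the error for a moment of order `j + 3`. First `n`, then `R`, tends to infinity.
  have hbound : ∀ R : ℝ, 1 ≤ R → |m (j + 2) - A * m j| ≤ (2 + |A|) * C * R⁻¹ := by
    intro R hR
    have hR0 : 0 < R := by linarith
    obtain ⟨D, hD0, hD⟩ := hdom R R⁻¹ hR0 (by positivity)
    have hpt : ∀ x : ℝ, |x ^ (j + 2) - A * x ^ j| ≤
        R⁻¹ * |x| ^ j + R ^ j * D * h x + (1 + |A|) * R⁻¹ * |x| ^ (j + 3) := by
      intro x
      have e : |x ^ (j + 2) - A * x ^ j| = |x| ^ j * |x ^ 2 - A| := by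
        rw [← abs_pow, ← abs_mul]; congr 1; ring
      rw [e]
      have p1 : 0 ≤ R⁻¹ * |x| ^ j := by positivity
      have p2 : 0 ≤ R ^ j * D * h x := mul_nonneg (by positivity) (h0 x)
      have p3 : 0 ≤ (1 + |A|) * R⁻¹ * |x| ^ (j + 3) := by positivity
      rcases le_or_gt |x| R with hx | hx
      · have q1 : |x| ^ j * |x ^ 2 - A| ≤ |x| ^ j * (R⁻¹ + D * h x) :=
          mul_le_mul_of_nonneg_left (hD x hx) (by positivity)
        have q2 : |x| ^ j * (D * h x) ≤ R ^ j * (D * h x) :=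
          mul_le_mul_of_nonneg_right (pow_le_pow_left₀ (abs_nonneg x) hx j)
            (mul_nonneg hD0 (h0 x))
        linarith
      · have hx1 : 1 ≤ |x| := hR.trans hx.le
        have q1 : |x ^ 2 - A| ≤ (1 + |A|) * |x| ^ 2 := by
          have : 1 ≤ |x| ^ 2 := one_le_pow₀ hx1
          have t := abs_sub (x ^ 2) A
          rw [abs_pow] at t
          nlinarith [abs_nonneg A]
        have q2 : 1 ≤ R⁻¹ * |x| := by
          rw [← div_eq_inv_mul, le_div_iff₀ hR0]
          linarith
        have q3 : |x| ^ j * |x ^ 2 - A| ≤ |x| ^ j * ((1 + |A|) * |x| ^ 2) :=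
          mul_le_mul_of_nonneg_left q1 (by positivity)
        have q4 : |x| ^ j * ((1 + |A|) * |x| ^ 2) ≤
            |x| ^ j * ((1 + |A|) * |x| ^ 2) * (R⁻¹ * |x|) :=
          le_mul_of_one_le_right (by positivity) q2
        have q5 : |x| ^ j * ((1 + |A|) * |x| ^ 2) * (R⁻¹ * |x|) =
          (1 + |A|) * R⁻¹ * |x| ^ (j + 3) := by ring
        linarith
    have i1 : ∀ i, Integrable (fun ω => X i ω ^ (j + 2)) P := fun i =>
      integrable_pow_of_abs (hX i) (hC i _ (by omega)).1
    have i2 : ∀ i, Integrable (fun ω => X i ω ^ j) P := fun i =>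
      integrable_pow_of_abs (hX i) (hC i _ (by omega)).1
    have hi : ∀ i, |∫ ω, X i ω ^ (j + 2) ∂P - A * ∫ ω, X i ω ^ j ∂P| ≤
        (2 + |A|) * C * R⁻¹ + R ^ j * D * ∫ ω, h (X i ω) ∂P := by
      intro i
      rw [← integral_const_mul, ← integral_sub (i1 i) ((i2 i).const_mul A)]
      refine (abs_integral_le_integral_abs).trans ?_
      have c1 := hC i j (by omega)
      have c2 := hC i (j + 3) hjN
      have i3 := (((c1.1.const_mul R⁻¹).add ((hint i).const_mul (R ^ j * D))).add
        (c2.1.const_mul ((1 + |A|) * R⁻¹)))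
      refine (integral_mono ((i1 i).sub ((i2 i).const_mul A)).abs i3 fun ω => hpt (X i ω)).trans ?_
      rw [integral_add' ((c1.1.const_mul R⁻¹).add ((hint i).const_mul (R ^ j * D)))
        (c2.1.const_mul ((1 + |A|) * R⁻¹)), integral_add' (c1.1.const_mul R⁻¹)
        ((hint i).const_mul (R ^ j * D)), integral_const_mul, integral_const_mul,
        integral_const_mul]
      have t1 : R⁻¹ * ∫ ω, |X i ω| ^ j ∂P ≤ R⁻¹ * C :=
        mul_le_mul_of_nonneg_left c1.2 (by positivity)
      have t2 : (1 + |A|) * R⁻¹ * ∫ ω, |X i ω| ^ (j + 3) ∂P ≤ (1 + |A|) * R⁻¹ * C :=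
        mul_le_mul_of_nonneg_left c2.2 (by positivity)
      linarith
    have hn : ∀ n, |(avg n fun i => ∫ ω, X i ω ^ (j + 2) ∂P) -
        A * avg n fun i => ∫ ω, X i ω ^ j ∂P| ≤
        (2 + |A|) * C * R⁻¹ + R ^ j * D * avg n fun i => ∫ ω, h (X i ω) ∂P := by
      intro n
      rw [← avg_const_mul, ← avg_sub]
      refine (abs_avg_le _ _).trans ((avg_mono n hi).trans ?_)
      rw [avg_add]
      exact add_le_add (avg_le_of_le (by positivity) fun _ => le_rfl) (avg_const_mul _ _ _).le
    have l1 := ((hm (j + 2) hjS).sub ((hm j (by omega)).const_mul A)).abs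
    have l2 := (hlim.const_mul (R ^ j * D)).const_add ((2 + |A|) * C * R⁻¹)
    rw [mul_zero, add_zero] at l2
    exact le_of_tendsto_of_tendsto' l1 l2 hn
  have hlim0 : Tendsto (fun R : ℝ => (2 + |A|) * C * R⁻¹) atTop (𝓝 0) := by
    simpa using tendsto_inv_atTop_zero.const_mul ((2 + |A|) * C)
  have := ge_of_tendsto hlim0 ((eventually_ge_atTop 1).mono hbound)
  exact sub_eq_zero.1 (abs_eq_zero.1 (le_antisymm this (abs_nonneg _)))

lemma integrable_pow_sub_mul_pow_sub [IsFiniteMeasure P] (hX : ∀ i, Measurable (X i))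
    (hC : ∀ i j, j ≤ N → Integrable (fun ω => |X i ω| ^ j) P) {r s : ℕ} (hrs : r + s ≤ N)
    (α c : ℝ) (i : ℕ) : Integrable (fun ω => (X i ω ^ r - α) * (X i ω ^ s - c)) P := by
  have i1 := integrable_pow_of_abs (hX i) (hC i (r + s) hrs)
  have i2 := integrable_pow_of_abs (hX i) (hC i r (by omega))
  have i3 := integrable_pow_of_abs (hX i) (hC i s (by omega))
  refine (((i1.sub (i2.const_mul c)).sub (i3.const_mul α)).add (integrable_const (c * α))).congr
    (Eventually.of_forall fun ω => ?_)
  simp only [Pi.add_apply, Pi.sub_apply]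
  ring

/-- Centering the second factor at `m s` makes the limit vanish for any `α`. This leaves `α` free to
be chosen so that the integrand is nonnegative. -/
lemma tendsto_avg_pow_sub_mul_pow_sub [IsProbabilityMeasure P] (hX : ∀ i, Measurable (X i))
    (hC : ∀ i j, j ≤ N → Integrable (fun ω => |X i ω| ^ j) P) (hSN : S ≤ N)
    (hm : ∀ j, j ≤ S → Tendsto (fun n => avg n fun i => ∫ ω, X i ω ^ j ∂P) atTop (𝓝 (m j)))
    {r s : ℕ} (hrs : r + s ≤ S) (hfac : m (r + s) = m r * m s) (α : ℝ) :
    Tendsto (fun n => avg n fun i => ∫ ω, (X i ω ^ r - α) * (X i ω ^ s - m s) ∂P) atTop (𝓝 0) := by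
  have h1 := (((hm (r + s) hrs).sub ((hm r (by omega)).const_mul (m s))).sub
    ((hm s (by omega)).const_mul α)).add_const (m s * α)
  rw [hfac, show m r * m s - m s * m r - α * m s + m s * α = 0 by ring] at h1
  refine h1.congr' ?_
  filter_upwards [eventually_gt_atTop 0] with n hn
  have hn' : (n : ℝ) ≠ 0 := by positivity
  have hc : avg n (fun _ => m s * α) = m s * α := by simp [avg, hn']
  rw [← hc, ← avg_const_mul, ← avg_const_mul, ← avg_sub, ← avg_sub, ← avg_add]
  congr 1
  funext i
  have i1 := integrable_pow_of_abs (hX i) (hC i (r + s) (by omega))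
  have i2 := integrable_pow_of_abs (hX i) (hC i r (by omega))
  have i3 := integrable_pow_of_abs (hX i) (hC i s (by omega))
  have e : ∀ ω, (X i ω ^ r - α) * (X i ω ^ s - m s) =
      X i ω ^ (r + s) - m s * X i ω ^ r - α * X i ω ^ s + m s * α := fun ω => by ring
  have j1 : Integrable (fun ω => X i ω ^ (r + s) - m s * X i ω ^ r) P := i1.sub (i2.const_mul _)
  have j2 : Integrable (fun ω => X i ω ^ (r + s) - m s * X i ω ^ r - α * X i ω ^ s) P :=
    j1.sub (i3.const_mul _)
  simp_rw [e]
  rw [integral_add j2 (integrable_const _), integral_sub j1 (i3.const_mul _),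
    integral_sub i1 (i2.const_mul _), integral_const_mul, integral_const_mul]
  simp

/-- Averaged moments that factor at some order are those of a variable of constant modulus. -/
lemma exists_moments_eq_of_factor [IsProbabilityMeasure P] (hX : ∀ i, Measurable (X i))
    (hC0 : 0 ≤ C)
    (hC : ∀ i j, j ≤ N → Integrable (fun ω => |X i ω| ^ j) P ∧ ∫ ω, |X i ω| ^ j ∂P ≤ C)
    (hSN : S ≤ N)
    (hm : ∀ j, j ≤ S → Tendsto (fun n => avg n fun i => ∫ ω, X i ω ^ j ∂P) atTop (𝓝 (m j)))
    (m2 : 0 < m 2) {r : ℕ} (hr : 2 ≤ r) (hrS : r + 1 ≤ S)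
    (hr_even : Even r → r + 2 ≤ S) (hr_top : S = N → r + 2 ≤ S)
    (hfac : ∀ s, r + s ≤ S → m (r + s) = m r * m s) :
    ∃ A, A ≠ 0 ∧ ∀ j, j + 2 ≤ S → m (j + 2) = A * m j := by
  -- The extra moment is missing only when `j + 2 = S = N`; factoring out `m r` then reduces this
  -- case to a lower order.
  suffices h : ∃ A, A ≠ 0 ∧ ∀ j, j + 2 ≤ S → j + 3 ≤ N → m (j + 2) = A * m j by
    obtain ⟨A, hA, h⟩ := h
    refine ⟨A, hA, fun j hj => ?_⟩
    by_cases hjN : j + 3 ≤ N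
    · exact h j hj hjN
    · have hS := hr_top (by omega)
      obtain ⟨s, hs⟩ : ∃ s, j = r + s := ⟨j - r, by omega⟩
      rw [hs, add_assoc, hfac (s + 2) (by omega), h s (by omega) (by omega), hfac s (by omega)]
      ring
  have hCi : ∀ i j, j ≤ N → Integrable (fun ω => |X i ω| ^ j) P := fun i j hj => (hC i j hj).1
  -- For even `r` the covariance with `x²` is used and `A = m 2`; for odd `r` the covariance with
  -- `x` itself, which concentrates `x` at `m 1`, so `A = m 1 ^ 2`. In the odd case `m 1 = 0` is
  -- impossible, as it would give `m 2 = 0`.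
  rcases Nat.even_or_odd r with he | ho
  · have hr2 := hr_even he
    obtain ⟨k, rfl⟩ : ∃ k, r = 2 * (k + 1) := by
      obtain ⟨k, rfl⟩ := he
      exact ⟨k - 1, by omega⟩
    have hge : ∀ x : ℝ, m 2 ^ k * (x ^ 2 - m 2) ^ 2 ≤
        (x ^ (2 * (k + 1)) - m 2 ^ (k + 1)) * (x ^ 2 - m 2) := fun x => by
      rw [pow_mul]
      exact pow_sub_mul_sub_ge (sq_nonneg x) m2.le k
    refine ⟨m 2, m2.ne', fun j hj hjN => moments_eq_of_dominated hX hC0 hC hm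
      (h := fun x => (x ^ (2 * (k + 1)) - m 2 ^ (k + 1)) * (x ^ 2 - m 2))
      (integrable_pow_sub_mul_pow_sub hX hCi (by omega) _ _)
      (fun x => le_trans (by positivity) (hge x))
      (tendsto_avg_pow_sub_mul_pow_sub hX hCi hSN hm hr2 (hfac 2 hr2) _) ?_ hj hjN⟩
    intro R ε hR hε
    refine ⟨(m 2 ^ k * ε)⁻¹, by positivity, fun x _ => (abs_le_add_sq_div hε _).trans ?_⟩
    gcongr
    calc (x ^ 2 - m 2) ^ 2 / ε = (m 2 ^ k * ε)⁻¹ * (m 2 ^ k * (x ^ 2 - m 2) ^ 2) := by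
          field_simp
      _ ≤ _ := mul_le_mul_of_nonneg_left (hge x) (by positivity)
  · obtain ⟨l, rfl⟩ := ho
    have hge := fun x => odd_pow_sub_mul_sub_ge x (m 1) l
    have hnn : ∀ x : ℝ, 0 ≤ (x ^ (2 * l + 1) - m 1 ^ (2 * l + 1)) * (x ^ 1 - m 1) := fun x => by
      rw [pow_one]
      exact le_trans (by positivity) (hge x)
    have hi := integrable_pow_sub_mul_pow_sub (P := P) hX hCi (r := 2 * l + 1) (s := 1) (by omega)
      (m 1 ^ (2 * l + 1)) (m 1)
    have hlim := tendsto_avg_pow_sub_mul_pow_sub hX hCi hSN hm hrS (hfac 1 hrS)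
      (m 1 ^ (2 * l + 1))
    by_cases ha : m 1 = 0
    · exfalso
      have := moments_eq_of_dominated hX hC0 hC hm
        (h := fun x => (x ^ (2 * l + 1) - m 1 ^ (2 * l + 1)) * (x ^ 1 - m 1)) hi hnn hlim
        (A := 0) ?_ (j := 0) (by omega) (by omega)
      · rw [zero_mul, zero_add] at this
        exact m2.ne' this
      · intro R ε hR hε
        refine ⟨(ε ^ l)⁻¹, by positivity, fun x _ => ?_⟩
        have e : (x ^ (2 * l + 1) - m 1 ^ (2 * l + 1)) * (x ^ 1 - m 1) = x ^ 2 * (x ^ 2) ^ l := by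
          rw [ha, zero_pow (by omega), ← pow_mul]; ring
        simp only [e]
        rw [sub_zero, abs_of_nonneg (sq_nonneg x)]
        rcases le_or_gt (x ^ 2) ε with hx | hx
        · have : 0 ≤ (ε ^ l)⁻¹ * (x ^ 2 * (x ^ 2) ^ l) := by positivity
          linarith
        · have h1 : ε ^ l ≤ (x ^ 2) ^ l := pow_le_pow_left₀ hε.le hx.le l
          have h2 : 1 ≤ (ε ^ l)⁻¹ * (x ^ 2) ^ l := by
            rw [← div_eq_inv_mul, le_div_iff₀ (by positivity)]
            linarith
          have h3 : x ^ 2 ≤ x ^ 2 * ((ε ^ l)⁻¹ * (x ^ 2) ^ l) :=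
            le_mul_of_one_le_right (sq_nonneg x) h2
          nlinarith
    · refine ⟨m 1 ^ 2, by positivity, fun j hj hjN => moments_eq_of_dominated hX hC0 hC hm
        (h := fun x => (x ^ (2 * l + 1) - m 1 ^ (2 * l + 1)) * (x ^ 1 - m 1)) hi hnn hlim ?_ hj hjN⟩
      intro R ε hR hε
      refine ⟨(R + |m 1|) ^ 2 * (ε * ((m 1 ^ 2) ^ l / 2))⁻¹, by positivity, fun x hx =>
        (abs_le_add_sq_div hε _).trans ?_⟩
      gcongr
      have h1 : (x ^ 2 - m 1 ^ 2) ^ 2 ≤ (R + |m 1|) ^ 2 * (x - m 1) ^ 2 := by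
        rw [show (x ^ 2 - m 1 ^ 2) ^ 2 = (x + m 1) ^ 2 * (x - m 1) ^ 2 by ring]
        gcongr ?_ * _
        rw [← sq_abs (x + m 1)]
        exact pow_le_pow_left₀ (abs_nonneg _) ((abs_add_le _ _).trans (by linarith)) 2
      have h2 := hge x
      calc (x ^ 2 - m 1 ^ 2) ^ 2 / ε ≤ (R + |m 1|) ^ 2 * (x - m 1) ^ 2 / ε := by gcongr
        _ = (R + |m 1|) ^ 2 * (ε * ((m 1 ^ 2) ^ l / 2))⁻¹ *
            ((m 1 ^ 2) ^ l / 2 * (x - m 1) ^ 2) := by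
          field_simp
        _ ≤ _ := by
          simp only [pow_one]
          exact mul_le_mul_of_nonneg_left h2 (by positivity)

end FactoringMoments

/-! ### The regressor moments do not factor -/

namespace RCModel

variable {Ω : Type*} {p K S : ℕ} {M : RCModel Ω p K}
variable [MeasurableSpace Ω] {P : Measure Ω}
variable {Qww : Matrix (Fin (p + 1)) (Fin (p + 1)) ℝ} {qwy : EuclideanSpace ℝ (Fin (p + 1))}
variable {ρ : ℕ → ℕ → EuclideanSpace ℝ (Fin p) → ℝ}

lemma IsPopMoment.tendsto_x_pow (hρ : M.IsPopMoment P S ρ) (g : EuclideanSpace ℝ (Fin p))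
    {j : ℕ} (hj : j ≤ S) :
    Tendsto (fun n => avg n fun i => ∫ ω, M.x i ω ^ j ∂P) atTop (𝓝 (ρ 0 j g)) := by
  simpa using hρ 0 j (by omega) (by omega) g

/-- At order `r = 0` the coefficient vector does not enter, so `γ` acts on `g₀` only through the
subtracted `ρ r s`. -/
lemma IsPopMoment.zero_left_eq (hρ : M.IsPopMoment P S ρ) (g g' : EuclideanSpace ℝ (Fin p))
    {j : ℕ} (hj : j ≤ S) : ρ 0 j g = ρ 0 j g' :=
  tendsto_nhds_unique (hρ.tendsto_x_pow g hj) (hρ.tendsto_x_pow g' hj)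

lemma IsPopMoment.zero_zero [IsProbabilityMeasure P] (hρ : M.IsPopMoment P S ρ) (g : EuclideanSpace ℝ (Fin p)) :
    ρ 0 0 g = 1 := by
  refine tendsto_nhds_unique (hρ.tendsto_x_pow g (Nat.zero_le S))
    (tendsto_const_nhds.congr' ?_)
  filter_upwards [eventually_gt_atTop 0] with n hn
  have hn' : (n : ℝ) ≠ 0 := by positivity
  simp [avg, hn']

/-- This limit is a diagonal entry of the positive definite `Qww`. -/
lemma Regularity.popMoment_two_pos (hreg : M.Regularity P Qww qwy) (hρ : M.IsPopMoment P S ρ)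
    (hS : 2 ≤ S) (g : EuclideanSpace ℝ (Fin p)) : 0 < ρ 0 2 g := by
  have h1 : Tendsto (fun n => M.meanQ P n 0 0) atTop (𝓝 (Qww 0 0)) := by
    have := tendsto_matrix_of_norm_sub (hreg.meanQ_lim.trans_tendsto tendsto_rootRate)
    exact (tendsto_pi_nhds.1 (tendsto_pi_nhds.1 this 0)) 0
  have h2 : ρ 0 2 g = Qww 0 0 := by
    refine tendsto_nhds_unique (hρ.tendsto_x_pow g hS) (h1.congr fun n => ?_)
    simp [meanQ, w, sq]
  rw [h2]
  exact hreg.Qww_pos.diag_pos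

/-- Under the full rank condition the regressor moments do not factor. -/
lemma IsPopMoment.exists_ne_mul [IsProbabilityMeasure P] (hM : M.IsModel P) (hreg : M.Regularity P Qww qwy)
    (hρ : M.IsPopMoment P S ρ) (hS : 2 * K - 1 < S) (hS' : S ≤ 4 * K - 2)
    {θ : EuclideanSpace ℝ (ThetaIdx K)} (hθ : Admissible θ) (σ : EuclideanSpace ℝ (SigmaIdx K))
    (g : EuclideanSpace ℝ (Fin p)) {A : Matrix (MomIdx K S) (MomIdx K S) ℝ}
    (hrank : ((GEta S ρ θ σ g)ᵀ * A * GEta S ρ θ σ g).PosDef) {r : ℕ} (hr : 2 ≤ r)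
    (hrK : r ≤ 2 * K - 1) : ∃ s, r + s ≤ S ∧ ρ 0 (r + s) g ≠ ρ 0 r g * ρ 0 s g := by
  have hK := hM.two_le
  by_contra! hcon
  obtain ⟨C, hC0, hC⟩ := hreg.mixed_moments
  have hCx : ∀ i j, j ≤ 4 * K - 2 → Integrable (fun ω => |M.x i ω| ^ j) P ∧
      ∫ ω, |M.x i ω| ^ j ∂P ≤ C := by
    intro i j hj
    have h1 := hC i 0 j (by omega) hj
    simp only [pow_zero, one_mul] at h1
    have h2 : Integrable (fun ω => |M.x i ω| ^ j) P := by
      simpa only [abs_pow] using (hreg.integrable_x_pow hM i hj).abs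
    exact ⟨h2, (integral_mono h2 h1.1 fun ω =>
      pow_le_pow_left₀ (abs_nonneg _) (abs_x_le i ω) j).trans h1.2⟩
  -- An even `r` is at most `2K - 2`, so `r + 2 ≤ 2K ≤ S`; and if `S = 4K - 2`, then `r + 2 ≤ 2K + 1
  -- ≤ S` because `K ≥ 2`.
  obtain ⟨a, ha, h⟩ := exists_moments_eq_of_factor (m := fun j => ρ 0 j g) hM.meas_x hC0 hCx hS'
    (fun j hj => hρ.tendsto_x_pow g hj) (hreg.popMoment_two_pos hρ (by omega) g) hr (by omega)
    (fun he => by obtain ⟨k, rfl⟩ := he; omega) (fun _ => by omega) hcon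
  exact not_moments_eq_of_rank hK ρ hθ σ g hrank ha h

end RCModel

/-! ### Minimum distance estimation along a filter -/

section Argmin

open Asymptotics

lemma isLittleO_inner_left {α F : Type*} [NormedAddCommGroup F] [InnerProductSpace ℝ F]
    {l : Filter α} {u v : α → F} {b : α → ℝ} (hu : u =o[l] b) (hv : v =O[l] b) :
    (fun a => inner ℝ (u a) (v a)) =o[l] fun a => b a ^ 2 := by
  have h : (fun a => inner ℝ (u a) (v a)) =O[l] fun a => ‖u a‖ * ‖v a‖ :=
    IsBigO.of_bound 1 (Eventually.of_forall fun a => by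
      rw [one_mul, norm_mul, norm_norm, norm_norm]
      exact norm_inner_le_norm _ _)
  simp_rw [sq]
  exact h.trans_isLittleO (hu.norm_left.mul_isBigO hv.norm_left)

lemma isLittleO_inner_right {α F : Type*} [NormedAddCommGroup F] [InnerProductSpace ℝ F]
    {l : Filter α} {u v : α → F} {b : α → ℝ} (hu : u =O[l] b) (hv : v =o[l] b) :
    (fun a => inner ℝ (u a) (v a)) =o[l] fun a => b a ^ 2 := by
  simp_rw [fun a => real_inner_comm (v a) (u a)]
  exact isLittleO_inner_left hv hu

/-- The difference is `⟨v, (T - A) v⟩ + ⟨v - w, A v⟩ + ⟨w, A (v - w)⟩`, each term with one factor of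
smaller order. It replaces the random criterion by a fixed quadratic form. -/
lemma isLittleO_quadratic_sub {α F : Type*} [NormedAddCommGroup F] [InnerProductSpace ℝ F]
    {l : Filter α} {T : α → F →L[ℝ] F} {A : F →L[ℝ] F} (hT : Tendsto T l (𝓝 A))
    {v w : α → F} {b : α → ℝ} (hw : w =O[l] b) (hvw : (fun a => v a - w a) =o[l] b) :
    (fun a => inner ℝ (v a) (T a (v a)) - inner ℝ (w a) (A (w a))) =o[l] fun a => b a ^ 2 := by
  have hv : v =O[l] b := by
    simpa using hvw.isBigO.add hw
  have h1 : (fun a => (T a - A) (v a)) =o[l] b := by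
    have hT0 : (fun a => ‖T a - A‖) =o[l] fun _ => (1 : ℝ) := by
      rw [isLittleO_one_iff]
      simpa using (tendsto_iff_norm_sub_tendsto_zero.1 hT)
    have := hT0.mul_isBigO hv.norm_left
    simp only [one_mul] at this
    exact (IsBigO.of_bound 1 (Eventually.of_forall fun a => by
      rw [one_mul, norm_mul, norm_norm, norm_norm]
      exact (T a - A).le_opNorm _)).trans_isLittleO this
  have hA : ∀ {u : α → F}, (fun a => A (u a)) =O[l] u := fun {u} => A.isBigO_comp u l
  have h2 := ((isLittleO_inner_right hv h1).add (isLittleO_inner_left hvw (hA.trans hv))).add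
    (isLittleO_inner_right hw (hA.trans_isLittleO hvw))
  refine h2.congr_left fun a => ?_
  simp only [map_sub, sub_apply, inner_sub_left, inner_sub_right]
  ring

/-- First-order expansion of minimum distance estimators. -/
theorem isLittleO_argmin_sub {α E F : Type*} [NormedAddCommGroup E] [NormedSpace ℝ E]
    [NormedAddCommGroup F] [InnerProductSpace ℝ F] {l : Filter α}
    {T : α → F →L[ℝ] F} {A : F →L[ℝ] F} (hT : Tendsto T l (𝓝 A))
    (hsym : ∀ v w, inner ℝ (A v) w = inner ℝ v (A w)) {c : ℝ} (hc : 0 < c)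
    (hA : ∀ v, c * ‖v‖ ^ 2 ≤ inner ℝ v (A v)) {G : E →L[ℝ] F} {c' : ℝ} (hc' : 0 < c')
    (hG : ∀ e, c' * ‖e‖ ≤ ‖G e‖) {L : F →L[ℝ] E}
    (hL : ∀ e v, inner ℝ (G e) (A (v - G (L v))) = 0)
    {g : α → E → F} {η₀ : E} {U : Set E} (hU : U ∈ 𝓝 η₀) {x : α → E} (hx : Tendsto x l (𝓝 η₀))
    (hg : ∀ y : α → E, Tendsto y l (𝓝 η₀) →
      (fun a => g a (y a) - g a η₀ - G (y a - η₀)) =o[l] fun a => y a - η₀)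
    (hZ : Tendsto (fun a => g a η₀) l (𝓝 0))
    (hmin : ∀ᶠ a in l, ∀ y ∈ U,
      inner ℝ (g a (x a)) (T a (g a (x a))) ≤ inner ℝ (g a y) (T a (g a y))) :
    (fun a => x a - η₀ + L (g a η₀)) =o[l] fun a => g a η₀ := by
  set Z : α → F := fun a => g a η₀ with hZdef
  set b : α → ℝ := fun a => ‖Z a‖ with hb
  have hZb : Z =O[l] b := (isBigO_refl Z l).norm_right
  have hGO : ∀ {u : α → E}, (fun a => G (u a)) =O[l] u := fun {u} => G.isBigO_comp u l
  have hLO : ∀ {u : α → F}, (fun a => L (u a)) =O[l] u := fun {u} => L.isBigO_comp u l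
  -- The rate comes first: comparison with `η₀` bounds the moments at `x` by a multiple of those at
  -- `η₀`, and the lower bound for `G` turns this into a bound for `x - η₀`.
  have hd : (fun a => x a - η₀) =O[l] b := by
    have e1 : ∀ᶠ a in l, ‖T a - A‖ ≤ c / 2 := by
      have := tendsto_iff_norm_sub_tendsto_zero.1 hT
      exact this.eventually_le_const (by positivity)
    have e2 := (hg x hx).bound (half_pos hc')
    refine IsBigO.of_bound ((√((‖A‖ + c / 2) / (c / 2)) + 1) / (c' / 2)) ?_
    filter_upwards [e1, e2, hmin] with a h1 h2 h3
    have h3 := h3 η₀ (mem_of_mem_nhds hU)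
    have hdiff : ∀ v, |inner ℝ v (T a v) - inner ℝ v (A v)| ≤ c / 2 * ‖v‖ ^ 2 := by
      intro v
      rw [← inner_sub_right, ← sub_apply]
      calc |inner ℝ v ((T a - A) v)| ≤ ‖v‖ * ‖(T a - A) v‖ := abs_real_inner_le_norm _ _
        _ ≤ ‖v‖ * (c / 2 * ‖v‖) := by
          gcongr
          exact ((T a - A).le_opNorm v).trans (by gcongr)
        _ = _ := by ring
    have h4 := abs_le.1 (hdiff (g a (x a)))
    have h5 := abs_le.1 (hdiff (Z a))
    have h6 : inner ℝ (Z a) (A (Z a)) ≤ ‖A‖ * ‖Z a‖ ^ 2 := by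
      calc inner ℝ (Z a) (A (Z a)) ≤ ‖Z a‖ * ‖A (Z a)‖ := real_inner_le_norm _ _
        _ ≤ ‖Z a‖ * (‖A‖ * ‖Z a‖) := by gcongr; exact A.le_opNorm _
        _ = _ := by ring
    have h7 := hA (g a (x a))
    have h8 : ‖g a (x a)‖ ^ 2 ≤ (‖A‖ + c / 2) / (c / 2) * ‖Z a‖ ^ 2 := by
      rw [div_mul_eq_mul_div, le_div_iff₀ (by positivity)]
      linarith
    have h9 : ‖g a (x a)‖ ≤ √((‖A‖ + c / 2) / (c / 2)) * ‖Z a‖ := by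
      refine le_of_sq_le_sq ?_ (by positivity)
      rw [mul_pow, Real.sq_sqrt (by positivity)]
      exact h8
    have h10 : ‖G (x a - η₀)‖ ≤ ‖g a (x a)‖ + ‖Z a‖ + c' / 2 * ‖x a - η₀‖ := by
      have e : G (x a - η₀) = g a (x a) - Z a - (g a (x a) - g a η₀ - G (x a - η₀)) := by
        simp only [hZdef]; abel
      rw [e]
      refine (norm_sub_le _ _).trans (add_le_add (norm_sub_le _ _) h2)
    have h11 := hG (x a - η₀)
    rw [hb, norm_norm, div_mul_eq_mul_div, le_div_iff₀ (by positivity)]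
    linarith
  -- The deviation from `η₀ - L Z`, the minimizer of the linearized criterion. By the orthogonality
  -- `hL` the linearized criterion at `x` exceeds its minimum by `⟨G e, A (G e)⟩`; since `x` is no
  -- worse than the competitor `η₀ - L Z`, this excess is `o(‖Z‖²)`.
  set e : α → E := fun a => x a - η₀ + L (Z a) with he
  have heO : e =O[l] b := hd.add (hLO.trans hZb)
  have hLZ : Tendsto (fun a => η₀ - L (Z a)) l (𝓝 η₀) := by
    simpa using tendsto_const_nhds.sub ((L.continuous.tendsto 0).comp hZ)
  have hw : (fun a => Z a - G (L (Z a))) =O[l] b := hZb.sub (hGO.trans (hLO.trans hZb))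
  have q1 := isLittleO_quadratic_sub hT (v := fun a => g a (x a))
    (w := fun a => G (e a) + (Z a - G (L (Z a)))) (b := b) ((hGO.trans heO).add hw) (by
      refine ((hg x hx).trans_isBigO hd).congr_left fun a => ?_
      simp only [he, map_add, hZdef]
      abel)
  have q2 := isLittleO_quadratic_sub hT (v := fun a => g a (η₀ - L (Z a)))
    (w := fun a => Z a - G (L (Z a))) (b := b) hw (by
      refine ((hg _ hLZ).trans_isBigO ?_).congr_left fun a => ?_
      · simpa using (hLO.trans hZb).neg_left
      · simp only [sub_sub_cancel_left, map_neg, hZdef]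
        abel)
  have q3 := q1.sub q2
  have hfin : ∀ᶠ a in l, c * c' ^ 2 * ‖e a‖ ^ 2 ≤
      ‖(inner ℝ (g a (x a)) (T a (g a (x a))) -
        inner ℝ (G (e a) + (Z a - G (L (Z a)))) (A (G (e a) + (Z a - G (L (Z a)))))) -
      (inner ℝ (g a (η₀ - L (Z a))) (T a (g a (η₀ - L (Z a)))) -
        inner ℝ (Z a - G (L (Z a))) (A (Z a - G (L (Z a)))))‖ := by
    filter_upwards [hmin, hLZ.eventually hU] with a h1 h2
    have h3 := h1 _ h2
    have h4 := hL (e a) (Z a)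
    have h5 : inner ℝ (Z a - G (L (Z a))) (A (G (e a))) = 0 := by
      rw [← hsym, real_inner_comm, h4]
    have h6 : inner ℝ (G (e a) + (Z a - G (L (Z a)))) (A (G (e a) + (Z a - G (L (Z a))))) =
        inner ℝ (G (e a)) (A (G (e a))) +
          inner ℝ (Z a - G (L (Z a))) (A (Z a - G (L (Z a)))) := by
      rw [A.map_add (G (e a)), inner_add_left, inner_add_right, inner_add_right, h4, h5]
      ring
    have h7 := hA (G (e a))
    have h8 : c' ^ 2 * ‖e a‖ ^ 2 ≤ ‖G (e a)‖ ^ 2 := by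
      rw [← mul_pow]
      exact pow_le_pow_left₀ (by positivity) (hG _) 2
    rw [Real.norm_eq_abs, h6]
    refine le_trans ?_ (neg_le_abs _)
    nlinarith
  have hsq : (fun a => ‖e a‖ ^ 2) =o[l] fun a => b a ^ 2 := by
    refine (IsBigO.of_bound (c * c' ^ 2)⁻¹ ?_).trans_isLittleO q3
    filter_upwards [hfin] with a h
    rw [← div_eq_inv_mul, le_div_iff₀ (by positivity), Real.norm_of_nonneg (by positivity)]
    linarith
  exact (IsLittleO.of_pow hsq two_ne_zero).of_norm_left.of_norm_right

end Argmin

/-! ### Matrices as operators and coercivity -/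

section Operators

/-- `mulE` as a continuous linear map. -/
def mulL {ι κ : Type*} [Fintype ι] [Fintype κ] (B : Matrix κ ι ℝ) :
    EuclideanSpace ℝ ι →L[ℝ] EuclideanSpace ℝ κ :=
  LinearMap.toContinuousLinearMap
    { toFun := mulE B
      map_add' := fun v w => by ext; simp [mulE, Matrix.mulVec_add]
      map_smul' := fun t v => by ext; simp [mulE, Matrix.mulVec_smul] }

lemma mulL_apply {ι κ : Type*} [Fintype ι] [Fintype κ] (B : Matrix κ ι ℝ)
    (v : EuclideanSpace ℝ ι) : mulL B v = mulE B v := rfl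

lemma tendsto_mulL {α ι κ : Type*} [Fintype ι] [Fintype κ] {l : Filter α}
    {B : α → Matrix κ ι ℝ} {B₀ : Matrix κ ι ℝ}
    (h : ∀ k i, Tendsto (fun a => B a k i) l (𝓝 (B₀ k i))) :
    Tendsto (fun a => mulL (B a)) l (𝓝 (mulL B₀)) := by
  let T : Matrix κ ι ℝ →ₗ[ℝ] (EuclideanSpace ℝ ι →L[ℝ] EuclideanSpace ℝ κ) :=
    { toFun := mulL
      map_add' := fun A B => by ext v; simp [mulL_apply, mulE, Matrix.add_mulVec]
      map_smul' := fun t A => by ext v; simp [mulL_apply, mulE, Matrix.smul_mulVec] }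
  exact (T.continuous_of_finiteDimensional.tendsto B₀).comp
    (tendsto_pi_nhds.2 fun k => tendsto_pi_nhds.2 fun i => h k i)

lemma mulE_mul {ι κ ν : Type*} [Fintype ι] [Fintype κ] (B : Matrix ν κ ℝ) (D : Matrix κ ι ℝ)
    (v : EuclideanSpace ℝ ι) : mulE (B * D) v = mulE B (mulE D v) := by
  simp [mulE, Matrix.mulVec_mulVec]

lemma inner_mulE_right {ι κ : Type*} [Fintype ι] [Fintype κ] (B : Matrix κ ι ℝ)
    (v : EuclideanSpace ℝ κ) (w : EuclideanSpace ℝ ι) :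
    inner ℝ v (mulE B w) = v.ofLp ⬝ᵥ (B *ᵥ w.ofLp) := by
  simp [mulE, PiLp.inner_apply, dotProduct, mul_comm]

lemma inner_mulE_left {ι κ : Type*} [Fintype ι] [Fintype κ] (B : Matrix κ ι ℝ)
    (v : EuclideanSpace ℝ ι) (w : EuclideanSpace ℝ κ) :
    inner ℝ (mulE B v) w = inner ℝ v (mulE Bᵀ w) := by
  rw [real_inner_comm, inner_mulE_right, inner_mulE_right, Matrix.dotProduct_mulVec,
    ← Matrix.mulVec_transpose, dotProduct_comm]

/-- The constant is the minimum of the quadratic form on the unit sphere; an empty index type, whose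
sphere is empty, is treated apart. -/
lemma exists_pos_mul_sq_le {ι : Type*} [Fintype ι] [DecidableEq ι] {A : Matrix ι ι ℝ}
    (hA : A.PosDef) : ∃ c > 0, ∀ v : EuclideanSpace ℝ ι, c * ‖v‖ ^ 2 ≤ inner ℝ v (mulE A v) := by
  have hcont : Continuous fun v : EuclideanSpace ℝ ι => inner ℝ v (mulE A v) :=
    continuous_id.inner (mulL A).continuous
  have hpos : ∀ v : EuclideanSpace ℝ ι, v ≠ 0 → 0 < inner ℝ v (mulE A v) := fun v hv => by
    rw [inner_mulE_right]
    simpa using hA.dotProduct_mulVec_pos (x := v.ofLp) (fun h => hv (by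
      ext j; exact congrFun h j))
  rcases isEmpty_or_nonempty ι with hι | hι
  · refine ⟨1, one_pos, fun v => ?_⟩
    rw [Subsingleton.elim v 0]
    simp
  · have hne : (Metric.sphere (0 : EuclideanSpace ℝ ι) 1).Nonempty :=
      NormedSpace.sphere_nonempty.2 zero_le_one
    obtain ⟨v₀, hv₀, hmin⟩ := (isCompact_sphere (0 : EuclideanSpace ℝ ι) 1).exists_isMinOn hne
      hcont.continuousOn
    have hv1 : ‖v₀‖ = 1 := by simpa using hv₀
    refine ⟨_, hpos v₀ (fun h => by simp [h] at hv1), fun v => ?_⟩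
    rcases eq_or_ne v 0 with rfl | hv
    · simp
    have hn : ‖v‖ ≠ 0 := norm_ne_zero_iff.2 hv
    have h1 : ‖v‖⁻¹ • v ∈ Metric.sphere (0 : EuclideanSpace ℝ ι) 1 := by
      simp [norm_smul, hn]
    have h2 := isMinOn_iff.1 hmin _ h1
    rw [← mulL_apply A (‖v‖⁻¹ • v), map_smul, real_inner_smul_left, real_inner_smul_right,
      mulL_apply] at h2
    calc _ ≤ ‖v‖⁻¹ * (‖v‖⁻¹ * inner ℝ v (mulE A v)) * ‖v‖ ^ 2 := by gcongr
      _ = _ := by field_simp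

/-- `c ‖e‖² ≤ ⟨G e, A (G e)⟩ ≤ ‖A‖ ‖G e‖²`; the added one in the constant guards against `‖A‖ = 0`.
-/
lemma exists_pos_mul_norm_le {ι κ : Type*} [Fintype ι] [Fintype κ] [DecidableEq ι]
    {A : Matrix κ κ ℝ} {G : Matrix κ ι ℝ} (hG : (Gᵀ * A * G).PosDef) :
    ∃ c > 0, ∀ e : EuclideanSpace ℝ ι, c * ‖e‖ ≤ ‖mulE G e‖ := by
  obtain ⟨c, hc, h⟩ := exists_pos_mul_sq_le hG
  refine ⟨√(c / (‖mulL A‖ + 1)), by positivity, fun e => ?_⟩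
  refine le_of_sq_le_sq ?_ (norm_nonneg _)
  rw [mul_pow, Real.sq_sqrt (by positivity), div_mul_eq_mul_div, div_le_iff₀ (by positivity)]
  have h1 := h e
  rw [mulE_mul, mulE_mul, ← inner_mulE_left] at h1
  have h2 : inner ℝ (mulE G e) (mulE A (mulE G e)) ≤ ‖mulE G e‖ * (‖mulL A‖ * ‖mulE G e‖) :=
    (real_inner_le_norm _ _).trans (by gcongr; exact (mulL A).le_opNorm _)
  nlinarith [sq_nonneg ‖mulE G e‖]

lemma isLittleO_euclidean {α ι H : Type*} [Fintype ι] [SeminormedAddCommGroup H] {l : Filter α}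
    {f : α → EuclideanSpace ℝ ι} {g : α → H} (h : ∀ j, (fun a => f a j) =o[l] g) : f =o[l] g := by
  have hs : (fun a => ∑ j, |f a j|) =o[l] g :=
    Asymptotics.IsLittleO.fun_sum fun j _ => by simpa using (h j).norm_left
  refine (Asymptotics.IsBigO.of_bound 1 (Eventually.of_forall fun a => ?_)).trans_isLittleO hs
  rw [one_mul, Real.norm_of_nonneg (Finset.sum_nonneg fun _ _ => abs_nonneg _)]
  exact norm_le_sum_abs _

lemma tendsto_euclidean {α ι : Type*} [Fintype ι] {l : Filter α}
    {f : α → EuclideanSpace ℝ ι} {v : EuclideanSpace ℝ ι}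
    (h : ∀ j, Tendsto (fun a => f a j) l (𝓝 (v j))) : Tendsto f l (𝓝 v) :=
  ((PiLp.continuous_toLp 2 _).tendsto _).comp (tendsto_pi_nhds.2 h)

end Operators

lemma tendsto_whp_zero_of_tendstoInDistribution {Ω Ω' E : Type*} [MeasurableSpace Ω]
    {P : Measure Ω} [MeasurableSpace Ω'] {P' : Measure Ω'} [IsProbabilityMeasure P]
    [IsProbabilityMeasure P'] [NormedAddCommGroup E] [NormedSpace ℝ E] [MeasurableSpace E]
    [BorelSpace E] {X : ℕ → Ω → E} {Z : Ω' → E}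
    (h : TendstoInDistribution (fun (n : ℕ) ω => √(n : ℝ) • X n ω) atTop Z (fun _ => P) P') :
    Tendsto (fun a : ℕ × Ω => X a.1 a.2) (whp P) (𝓝 0) := by
  rw [tendsto_zero_iff_norm_tendsto_zero]
  have h1 := bddInProb_norm_of_tendstoInDistribution h
  refine RootNBddInProb.tendsto_zero (X := fun n ω => ‖X n ω‖) ?_
  refine (show BddInProb P _ from ?_)
  convert h1 using 3
  rw [norm_smul, Real.norm_of_nonneg (Real.sqrt_nonneg _)]

/-- Negligible relative to a stochastically bounded sequence implies convergence in probability. -/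
lemma tendsto_whp_zero_of_isLittleO {Ω E : Type*} [MeasurableSpace Ω] {P : Measure Ω}
    [SeminormedAddCommGroup E] {f : ℕ × Ω → E} {b : ℕ → Ω → ℝ}
    (h : f =o[whp P] fun a => b a.1 a.2) (hb : BddInProb P b) : Tendsto f (whp P) (𝓝 0) := by
  obtain ⟨φ, hφ, he⟩ := Asymptotics.isLittleO_iff_exists_eq_mul.1 h.norm_left
  rw [tendsto_zero_iff_norm_tendsto_zero]
  refine (hb.mul_tendsto_zero hφ).congr' ?_
  filter_upwards [he] with a ha
  rw [ha, Pi.mul_apply, mul_comm]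

/-! ### Limits and derivatives of the sample moment function -/

namespace RCModel

variable {Ω : Type*} {p K S : ℕ} {M : RCModel Ω p K}

/-- The parameters `θ` and `σ` enter as in `g₀`, only with empirical moments of `x` as coefficients.
-/
lemma ghat_apply (n : ℕ) (ω : Ω) (θ : EuclideanSpace ℝ (ThetaIdx K))
    (σ : EuclideanSpace ℝ (SigmaIdx K)) (g : EuclideanSpace ℝ (Fin p)) (rs : MomIdx K S) :
    M.ghat S n ω θ σ g rs =
      momSum (fun j => avg n fun i => M.x i ω ^ j) θ σ (rs.1 + 1) rs.2 -
        avg n fun i => M.ytilde g i ω ^ ((rs.1 : ℕ) + 1) * M.x i ω ^ (rs.2 : ℕ) := by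
  simp only [ghat, momSum]
  rw [avg_sub, avg_sum]
  congr 1
  refine Finset.sum_congr rfl fun t _ => ?_
  rw [mul_assoc, mul_right_comm, ← avg_const_mul]
  congr 1
  funext i
  ring

variable [MeasurableSpace Ω] {P : Measure Ω}
variable {Qww : Matrix (Fin (p + 1)) (Fin (p + 1)) ℝ} {qwy : EuclideanSpace ℝ (Fin (p + 1))}
variable {Θ : Set (EuclideanSpace ℝ (ThetaIdx K))} {Sig : Set (EuclideanSpace ℝ (SigmaIdx K))}
  {σ₀ : EuclideanSpace ℝ (SigmaIdx K)} {An : ℕ → Ω → Matrix (MomIdx K S) (MomIdx K S) ℝ}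
  {A : Matrix (MomIdx K S) (MomIdx K S) ℝ}
variable {ρ : ℕ → ℕ → EuclideanSpace ℝ (Fin p) → ℝ}

lemma GMMConditions.tendsto_avg_ytilde (hgmm : M.GMMConditions P S Θ Sig σ₀ An A)
    (hρ : M.IsPopMoment P S ρ) {r s : ℕ} (hr : r ≤ 2 * K - 1) (hrs : r + s ≤ S) :
    Tendsto (fun a : ℕ × Ω => avg a.1 fun i => M.ytilde (M.γhat a.1 a.2) i a.2 ^ r * M.x i a.2 ^ s)
      (whp P) (𝓝 (ρ r s M.γ)) := by
  have h := (hgmm.moment_lln r s hr hrs).tendsto_zero.add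
    ((hρ r s hr hrs M.γ).comp tendsto_fst_whp)
  rw [zero_add] at h
  refine h.congr fun a => ?_
  simp only [avg_sub, Function.comp_apply, sub_add_cancel]

lemma GMMConditions.tendsto_avg_x_pow_popMoment (hgmm : M.GMMConditions P S Θ Sig σ₀ An A)
    (hρ : M.IsPopMoment P S ρ) {j : ℕ} (hj : j ≤ S) :
    Tendsto (fun a : ℕ × Ω => avg a.1 fun i => M.x i a.2 ^ j) (whp P) (𝓝 (ρ 0 j M.γ)) := by
  simpa using (hgmm.tendsto_avg_x_pow hj).add ((hρ.tendsto_x_pow M.γ hj).comp tendsto_fst_whp)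

/-- The sample moments at `γhat` converge continuously to the population moments. -/
lemma GMMConditions.tendsto_ghat (hgmm : M.GMMConditions P S Θ Sig σ₀ An A)
    (hρ : M.IsPopMoment P S ρ) {l : Filter (ℕ × Ω)} (hl : l ≤ whp P)
    {y : ℕ × Ω → EuclideanSpace ℝ (EtaIdx K)} {η : EuclideanSpace ℝ (EtaIdx K)}
    (hy : Tendsto y l (𝓝 η)) :
    Tendsto (fun a => M.ghat S a.1 a.2 (thetaPart (y a)) (sigmaPart (y a)) (M.γhat a.1 a.2)) l
      (𝓝 (gPop S ρ (thetaPart η) (sigmaPart η) M.γ)) := by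
  refine tendsto_euclidean fun rs => ?_
  have h1 := rs.1.2
  have h2 := rs.2.2
  simp_rw [ghat_apply, gPop_apply, momSum_eq_sum]
  refine Tendsto.sub (tendsto_finsetSum _ fun t ht => ?_)
    ((hgmm.tendsto_avg_ytilde hρ (by omega) (by omega)).mono_left hl)
  have ht := Finset.mem_range.1 ht
  exact (((hgmm.tendsto_avg_x_pow_popMoment hρ (by omega)).mono_left hl).const_mul _).mul
    (((differentiable_sigmaExt_mul_hMom t _).continuous.tendsto η).comp hy)

/-- The sample moments have the derivative `G₀` in the limit. -/
lemma GMMConditions.isLittleO_ghat_sub (hgmm : M.GMMConditions P S Θ Sig σ₀ An A)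
    (hρ : M.IsPopMoment P S ρ) (θ : EuclideanSpace ℝ (ThetaIdx K))
    (σ : EuclideanSpace ℝ (SigmaIdx K)) {y : ℕ × Ω → EuclideanSpace ℝ (EtaIdx K)}
    (hy : Tendsto y (whp P) (𝓝 (stack θ σ))) :
    (fun a => M.ghat S a.1 a.2 (thetaPart (y a)) (sigmaPart (y a)) (M.γhat a.1 a.2) -
      M.ghat S a.1 a.2 θ σ (M.γhat a.1 a.2) -
      mulE (GEta S ρ θ σ M.γ) (y a - stack θ σ)) =o[whp P] fun a => y a - stack θ σ := by
  have hpop := ((differentiable_gPop (S := S) ρ M.γ) (stack θ σ)).hasFDerivAt.isLittleO.comp_tendsto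
    hy
  refine isLittleO_euclidean fun rs => ?_
  have h1 := rs.1.2
  have h2 := rs.2.2
  have hpop' : (fun a => (gPop S ρ (thetaPart (y a)) (sigmaPart (y a)) M.γ rs -
      gPop S ρ θ σ M.γ rs - mulE (GEta S ρ θ σ M.γ) (y a - stack θ σ) rs)) =o[whp P]
      fun a => y a - stack θ σ := by
    refine (Asymptotics.IsBigO.of_bound 1 (Eventually.of_forall fun a => ?_)).trans_isLittleO hpop
    rw [one_mul, GEta, mulE_jacobian]
    exact PiLp.norm_apply_le ((gPop S ρ (thetaPart (y a)) (sigmaPart (y a)) M.γ -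
      gPop S ρ θ σ M.γ - _ : EuclideanSpace ℝ (MomIdx K S))) rs
  -- Sample minus population: the coefficient error is `o(1)` and the parameter factor is `O(y -
  -- η₀)`. Hence differentiability of the population function suffices.
  have hterm : ∀ t ∈ Finset.range ((rs.1 : ℕ) + 1 + 1),
      (fun a => ((((rs.1 : ℕ) + 1).choose t : ℝ) *
        ((avg a.1 fun i => M.x i a.2 ^ ((rs.1 : ℕ) + 1 - t + rs.2)) -
          ρ 0 ((rs.1 : ℕ) + 1 - t + rs.2) M.γ)) *
        (sigmaExt (sigmaPart (y a)) t * hMom (thetaPart (y a)) ((rs.1 : ℕ) + 1 - t) -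
          sigmaExt σ t * hMom θ ((rs.1 : ℕ) + 1 - t))) =o[whp P] fun a => y a - stack θ σ := by
    intro t ht
    have ht := Finset.mem_range.1 ht
    have o1 : (fun a : ℕ × Ω => ((((rs.1 : ℕ) + 1).choose t : ℝ) *
        ((avg a.1 fun i => M.x i a.2 ^ ((rs.1 : ℕ) + 1 - t + rs.2)) -
          ρ 0 ((rs.1 : ℕ) + 1 - t + rs.2) M.γ))) =o[whp P] fun _ => (1 : ℝ) := by
      rw [Asymptotics.isLittleO_one_iff]
      have := ((hgmm.tendsto_avg_x_pow_popMoment hρ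
        (j := (rs.1 : ℕ) + 1 - t + rs.2) (by omega)).sub_const
          (ρ 0 ((rs.1 : ℕ) + 1 - t + rs.2) M.γ)).const_mul (((rs.1 : ℕ) + 1).choose t : ℝ)
      simpa using this
    have o2 := ((differentiable_sigmaExt_mul_hMom t ((rs.1 : ℕ) + 1 - t))
      (stack θ σ)).isBigO_sub.comp_tendsto hy
    have := o1.mul_isBigO o2.norm_right
    simp only [one_mul] at this
    exact this.norm_right.of_norm_right.of_norm_right
  have hsum := Asymptotics.IsLittleO.fun_sum hterm
  refine (hsum.add hpop').congr_left fun a => ?_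
  simp only [PiLp.sub_apply, ghat_apply, gPop_apply]
  have e1 := momSum_eq_sum (fun j => avg a.1 fun i => M.x i a.2 ^ j) (y a) ((rs.1 : ℕ) + 1) rs.2
  have e2 := momSum_eq_sum (fun j => ρ 0 j M.γ) (y a) ((rs.1 : ℕ) + 1) rs.2
  have e3 := momSum_eq_sum (fun j => avg a.1 fun i => M.x i a.2 ^ j) (stack θ σ)
    ((rs.1 : ℕ) + 1) rs.2
  have e4 := momSum_eq_sum (fun j => ρ 0 j M.γ) (stack θ σ) ((rs.1 : ℕ) + 1) rs.2
  rw [thetaPart_stack, sigmaPart_stack] at e3 e4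
  rw [e1, e2, e3, e4]
  simp only [mul_sub, sub_mul, Finset.sum_sub_distrib]
  ring

variable [IsProbabilityMeasure P]

/-- The sample moments have the derivative `G_{0,γ}` in the limit. -/
lemma GMMConditions.isLittleO_ghat_γhat_sub (hM : M.IsModel P) (hreg : M.Regularity P Qww qwy)
    (hgmm : M.GMMConditions P S Θ Sig σ₀ An A) (hS' : S ≤ 4 * K - 2) (hρ : M.IsPopMoment P S ρ)
    (hγ : Tendsto (fun a : ℕ × Ω => M.γhat a.1 a.2 - M.γ) (whp P) (𝓝 0))
    (θ : EuclideanSpace ℝ (ThetaIdx K)) (σ : EuclideanSpace ℝ (SigmaIdx K)) :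
    (fun a : ℕ × Ω => M.ghat S a.1 a.2 θ σ (M.γhat a.1 a.2) - M.ghat S a.1 a.2 θ σ M.γ -
      mulE (GGamma S ρ θ σ M.γ) (M.γhat a.1 a.2 - M.γ)) =o[whp P]
      fun a => M.γhat a.1 a.2 - M.γ := by
  have hex : ∀ rs : MomIdx K S, ∃ L : EuclideanSpace ℝ (Fin p) →L[ℝ] ℝ,
      HasFDerivAt (ρ ((rs.1 : ℕ) + 1) rs.2) L M.γ ∧
      (fun a : ℕ × Ω => (avg a.1 fun i => M.ytilde (M.γhat a.1 a.2) i a.2 ^ ((rs.1 : ℕ) + 1) *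
          M.x i a.2 ^ (rs.2 : ℕ)) -
        (avg a.1 fun i => M.ytilde M.γ i a.2 ^ ((rs.1 : ℕ) + 1) * M.x i a.2 ^ (rs.2 : ℕ)) -
        L (M.γhat a.1 a.2 - M.γ)) =o[whp P] fun a => M.γhat a.1 a.2 - M.γ := fun rs => by
    have h1 := rs.1.2
    have h2 := rs.2.2
    exact exists_moment_expansion hM hreg hgmm hS' hρ hγ (by omega) (by omega)
  choose L hL1 hL2 using hex
  have hcomp : ∀ rs : MomIdx K S,
      HasFDerivAt (fun g => gPop S ρ θ σ g rs) (-L rs) M.γ := fun rs => by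
    have h1 := rs.1.2
    have h2 := rs.2.2
    have hconst : ∀ g, gPop S ρ θ σ g rs = momSum (fun j => ρ 0 j M.γ) θ σ (rs.1 + 1) rs.2 -
        ρ (rs.1 + 1) rs.2 g := fun g => by
      rw [gPop_apply]
      congr 1
      refine Finset.sum_congr rfl fun t ht => ?_
      have ht := Finset.mem_range.1 ht
      simp only
      rw [hρ.zero_left_eq g M.γ (by omega)]
    simp_rw [hconst]
    exact (hL1 rs).const_sub _
  have hdiff : DifferentiableAt ℝ (fun g => gPop S ρ θ σ g) M.γ :=
    differentiableAt_euclidean.2 fun rs => (hcomp rs).differentiableAt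
  have hG : ∀ (v : EuclideanSpace ℝ (Fin p)) rs, mulE (GGamma S ρ θ σ M.γ) v rs = -L rs v := by
    intro v rs
    rw [GGamma, mulE_jacobian]
    have h1 := (EuclideanSpace.proj rs : EuclideanSpace ℝ (MomIdx K S) →L[ℝ] ℝ).hasFDerivAt.comp
      M.γ hdiff.hasFDerivAt
    have h2 := h1.unique (hcomp rs)
    simpa using congrArg (fun T : EuclideanSpace ℝ (Fin p) →L[ℝ] ℝ => T v) h2
  refine isLittleO_euclidean fun rs => ((hL2 rs).neg_left).congr_left fun a => ?_
  simp only [PiLp.sub_apply, ghat_apply, hG]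
  ring

end RCModel

lemma tendsto_inner_clm_apply {α F : Type*} [NormedAddCommGroup F] [InnerProductSpace ℝ F]
    {l : Filter α} {T : α → F →L[ℝ] F} {T₀ : F →L[ℝ] F} {f : α → F} {v : F}
    (hT : Tendsto T l (𝓝 T₀)) (hf : Tendsto f l (𝓝 v)) :
    Tendsto (fun a => inner ℝ (f a) (T a (f a))) l (𝓝 (inner ℝ v (T₀ v))) := by
  have h : Continuous fun b : (F →L[ℝ] F) × F => b.1 b.2 := isBoundedBilinearMap_apply.continuous
  exact hf.inner ((h.tendsto (T₀, v)).comp (hT.prodMk_nhds hf))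

/-! ### Symmetry of centered normal laws -/

section Gaussian

lemma tendstoInDistribution_of_map_eq {Ω Ω' E : Type*} [MeasurableSpace Ω] {P : Measure Ω}
    [MeasurableSpace Ω'] {P' : Measure Ω'} [IsProbabilityMeasure P] [IsProbabilityMeasure P']
    [TopologicalSpace E] [MeasurableSpace E] [OpensMeasurableSpace E] {X : ℕ → Ω → E}
    {Z Z' : Ω' → E} (h : TendstoInDistribution X atTop Z (fun _ => P) P') (hZ' : AEMeasurable Z' P')
    (he : P'.map Z = P'.map Z') : TendstoInDistribution X atTop Z' (fun _ => P) P' := by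
  refine ⟨h.forall_aemeasurable, hZ', ?_⟩
  have h1 := h.tendsto
  have h2 : (⟨P'.map Z, Measure.isProbabilityMeasure_map h.aemeasurable_limit⟩ :
      ProbabilityMeasure E) = ⟨P'.map Z', Measure.isProbabilityMeasure_map hZ'⟩ := Subtype.ext he
  rwa [h2] at h1

/-- Centered normal laws are symmetric. -/
lemma map_neg_eq_of_hasGaussianLaw {Ω E : Type*} [MeasurableSpace Ω] {P : Measure Ω}
    [NormedAddCommGroup E] [InnerProductSpace ℝ E] [CompleteSpace E] [SecondCountableTopology E]
    [MeasurableSpace E] [BorelSpace E] {X : Ω → E} (hX : HasGaussianLaw X P)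
    (h0 : ∫ ω, X ω ∂P = 0) : P.map (fun ω => -X ω) = P.map X := by
  have := hX.isProbabilityMeasure
  have := Measure.isProbabilityMeasure_map (μ := P) hX.aemeasurable
  have := Measure.isProbabilityMeasure_map (μ := P) hX.fun_neg.aemeasurable
  refine Measure.ext_of_charFun (funext fun t => ?_)
  have hm : ∫ ω, inner ℝ t (X ω) ∂P = 0 := by
    rw [integral_inner hX.integrable, h0, inner_zero_right]
  rw [hX.charFun_map_eq, hX.fun_neg.charFun_map_eq]
  simp only [inner_neg_right, integral_neg, hm, neg_zero]
  rw [variance_fun_neg]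

end Gaussian

/-! ### Consistency and expansion of the GMM estimator -/

namespace RCModel

variable {Ω : Type*} {p K S : ℕ} {M : RCModel Ω p K}
lemma criterion_eq (n : ℕ) (ω : Ω) (B : Matrix (MomIdx K S) (MomIdx K S) ℝ)
    (θ : EuclideanSpace ℝ (ThetaIdx K)) (σ : EuclideanSpace ℝ (SigmaIdx K)) :
    M.criterion S n ω B θ σ = inner ℝ (M.ghat S n ω θ σ (M.γhat n ω))
      (mulL B (M.ghat S n ω θ σ (M.γhat n ω))) := by
  rw [mulL_apply, inner_mulE_right]
  rfl

variable [MeasurableSpace Ω] {P : Measure Ω}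
variable {Qww : Matrix (Fin (p + 1)) (Fin (p + 1)) ℝ} {qwy : EuclideanSpace ℝ (Fin (p + 1))}
variable {Θ : Set (EuclideanSpace ℝ (ThetaIdx K))} {Sig : Set (EuclideanSpace ℝ (SigmaIdx K))}
  {σ₀ : EuclideanSpace ℝ (SigmaIdx K)} {An : ℕ → Ω → Matrix (MomIdx K S) (MomIdx K S) ℝ}
  {A : Matrix (MomIdx K S) (MomIdx K S) ℝ}
variable {ρ : ℕ → ℕ → EuclideanSpace ℝ (Fin p) → ℝ}

lemma GMMConditions.tendsto_mulL (hgmm : M.GMMConditions P S Θ Sig σ₀ An A) :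
    Tendsto (fun a : ℕ × Ω => mulL (An a.1 a.2)) (whp P) (𝓝 (mulL A)) :=
  CategoricalRC.tendsto_mulL fun k i =>
    (tendsto_whp_iff (X := fun n ω => An n ω k i)).2 (hgmm.An_lim k i)

variable [IsProbabilityMeasure P]

lemma GMMConditions.tendsto_ghat_true (hM : M.IsModel P) (hreg : M.Regularity P Qww qwy)
    (hgmm : M.GMMConditions P S Θ Sig σ₀ An A) (hS' : S ≤ 4 * K - 2) (hρ : M.IsPopMoment P S ρ)
    (hγ : Tendsto (fun a : ℕ × Ω => M.γhat a.1 a.2 - M.γ) (whp P) (𝓝 0))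
    (hg : Tendsto (fun a : ℕ × Ω => M.ghat S a.1 a.2 M.θ₀ σ₀ M.γ) (whp P) (𝓝 0)) :
    Tendsto (fun a : ℕ × Ω => M.ghat S a.1 a.2 M.θ₀ σ₀ (M.γhat a.1 a.2)) (whp P) (𝓝 0) := by
  have h1 := (hgmm.isLittleO_ghat_γhat_sub hM hreg hS' hρ hγ M.θ₀ σ₀).isBigO.trans_tendsto hγ
  have h2 := ((mulL (GGamma S ρ M.θ₀ σ₀ M.γ)).continuous.tendsto 0).comp hγ
  rw [map_zero] at h2
  have h3 := (h1.add h2).add hg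
  rw [add_zero, add_zero] at h3
  refine h3.congr fun a => ?_
  simp only [Function.comp_apply, mulL_apply]
  abel

/-- The population moment conditions hold at the true parameters. -/
lemma GMMConditions.gPop_true (hM : M.IsModel P) (hreg : M.Regularity P Qww qwy)
    (hgmm : M.GMMConditions P S Θ Sig σ₀ An A) (hS' : S ≤ 4 * K - 2) (hρ : M.IsPopMoment P S ρ)
    (hγ : Tendsto (fun a : ℕ × Ω => M.γhat a.1 a.2 - M.γ) (whp P) (𝓝 0))
    (hg : Tendsto (fun a : ℕ × Ω => M.ghat S a.1 a.2 M.θ₀ σ₀ M.γ) (whp P) (𝓝 0)) :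
    gPop S ρ M.θ₀ σ₀ M.γ = 0 := by
  -- The same sample moments at `γhat` tend to `g₀` by the moment assumption and to zero by the
  -- assumed limit law.
  have h1 := hgmm.tendsto_ghat hρ le_rfl (y := fun _ => stack M.θ₀ σ₀) tendsto_const_nhds
  have h2 := hgmm.tendsto_ghat_true hM hreg hS' hρ hγ hg
  simp only [thetaPart_stack, sigmaPart_stack] at h1
  exact tendsto_nhds_unique h1 h2

variable {θhat : ℕ → Ω → EuclideanSpace ℝ (ThetaIdx K)}
  {σhat : ℕ → Ω → EuclideanSpace ℝ (SigmaIdx K)}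

/-- The GMM estimator is consistent. -/
theorem IsGMM.tendsto (hest : M.IsGMM P S Θ Sig An θhat σhat) (hM : M.IsModel P)
    (hreg : M.Regularity P Qww qwy) (hgmm : M.GMMConditions P S Θ Sig σ₀ An A)
    (hS : 2 * K - 1 < S) (hS' : S ≤ 4 * K - 2) (hρ : M.IsPopMoment P S ρ)
    (hrank : ((GEta S ρ M.θ₀ σ₀ M.γ)ᵀ * A * GEta S ρ M.θ₀ σ₀ M.γ).PosDef)
    (hγ : Tendsto (fun a : ℕ × Ω => M.γhat a.1 a.2 - M.γ) (whp P) (𝓝 0))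
    (hg : Tendsto (fun a : ℕ × Ω => M.ghat S a.1 a.2 M.θ₀ σ₀ M.γ) (whp P) (𝓝 0)) :
    Tendsto (fun a : ℕ × Ω => (θhat a.1 a.2, σhat a.1 a.2)) (whp P) (𝓝 (M.θ₀, σ₀)) := by
  have hθ₀ := interior_subset hgmm.θ₀_int
  have hσ₀ := interior_subset hgmm.σ₀_int
  have hmin := eventually_whp_of_forall_ae hest.isMin
  -- By compactness only cluster points matter. Along an ultrafilter the estimator converges, so the
  -- criterion does too, and comparison with the truth gives `g₀ = 0` at the cluster point; no
  -- separate uniform law of large numbers is used.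
  refine (hgmm.Θ_compact.prod hgmm.Sig_compact).tendsto_nhds_of_unique_mapClusterPt
    (hmin.mono fun a ha => ⟨ha.1, ha.2.1⟩) ?_
  rintro ⟨θ, σ⟩ ⟨hθ, -⟩ hcl
  obtain ⟨U, hU, hlim⟩ := mapClusterPt_iff_ultrafilter.1 hcl
  have hy : Tendsto (fun a : ℕ × Ω => stack (θhat a.1 a.2) (σhat a.1 a.2)) U (𝓝 (stack θ σ)) :=
    (continuous_stack.tendsto (θ, σ)).comp hlim
  have h1 : Tendsto (fun a : ℕ × Ω => M.ghat S a.1 a.2 (θhat a.1 a.2) (σhat a.1 a.2)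
      (M.γhat a.1 a.2)) U (𝓝 (gPop S ρ θ σ M.γ)) := by
    simpa only [thetaPart_stack, sigmaPart_stack] using hgmm.tendsto_ghat hρ hU hy
  have h2 := (hgmm.tendsto_ghat_true hM hreg hS' hρ hγ hg).mono_left hU
  have hT := hgmm.tendsto_mulL.mono_left hU
  have h3 := tendsto_inner_clm_apply hT h1
  have h4 := tendsto_inner_clm_apply hT h2
  have h5 := le_of_tendsto_of_tendsto h3 h4 ((hmin.filter_mono hU).mono fun a ha => by
    have := ha.2.2 M.θ₀ hθ₀ σ₀ hσ₀
    rwa [criterion_eq, criterion_eq] at this)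
  rw [map_zero, inner_zero_right, mulL_apply] at h5
  obtain ⟨c, hc, hcA⟩ := exists_pos_mul_sq_le hgmm.A_pos
  have h6 : gPop S ρ θ σ M.γ = 0 := by
    have h7 := (hcA (gPop S ρ θ σ M.γ)).trans h5
    have h8 : ‖gPop S ρ θ σ M.γ‖ ^ 2 ≤ 0 := by
      by_contra hcon
      push Not at hcon
      linarith [mul_pos hc hcon]
    exact norm_eq_zero.1 (pow_eq_zero_iff two_ne_zero |>.1 (le_antisymm h8 (sq_nonneg _)))
  have h7 := hgmm.gPop_true hM hreg hS' hρ hγ hg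
  have hK := hM.two_le
  have hadm := hgmm.Θ_admissible _ hθ₀
  -- Here the local rank condition becomes global identification, through the regressor moments that
  -- do not factor.
  obtain ⟨e1, e2⟩ := eq_of_momSum_eq (m := fun j => ρ 0 j M.γ) (by omega) hS (hρ.zero_zero M.γ)
    (hreg.popMoment_two_pos hρ (by omega) M.γ).ne'
    (fun r hr hrK => hρ.exists_ne_mul hM hreg hS hS' hadm σ₀ M.γ hrank hr hrK)
    (hgmm.Θ_admissible θ hθ) hadm (σ := σ) (σ' := σ₀) (fun r s hr hrK hrs => by
      obtain ⟨r, rfl⟩ : ∃ k, r = k + 1 := ⟨r - 1, by omega⟩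
      have t1 := congrFun (congrArg WithLp.ofLp (h6.trans h7.symm))
        (⟨⟨r, by omega⟩, ⟨s, by simp only; omega⟩⟩ : MomIdx K S)
      rw [gPop_apply, gPop_apply] at t1
      simp only at t1
      linarith)
  rw [e1, e2]

/-- First-order expansion of the GMM estimator. -/
theorem IsGMM.isLittleO_sub (hest : M.IsGMM P S Θ Sig An θhat σhat) (hM : M.IsModel P)
    (hreg : M.Regularity P Qww qwy) (hgmm : M.GMMConditions P S Θ Sig σ₀ An A)
    (hS : 2 * K - 1 < S) (hS' : S ≤ 4 * K - 2) (hρ : M.IsPopMoment P S ρ)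
    {G₀ : Matrix (MomIdx K S) (EtaIdx K) ℝ} (hG₀ : G₀ = GEta S ρ M.θ₀ σ₀ M.γ)
    (hrank : (G₀ᵀ * A * G₀).PosDef)
    (hγ : Tendsto (fun a : ℕ × Ω => M.γhat a.1 a.2 - M.γ) (whp P) (𝓝 0))
    (hg : Tendsto (fun a : ℕ × Ω => M.ghat S a.1 a.2 M.θ₀ σ₀ M.γ) (whp P) (𝓝 0)) :
    (fun a : ℕ × Ω => stack (θhat a.1 a.2) (σhat a.1 a.2) - stack M.θ₀ σ₀ +
      mulE ((G₀ᵀ * A * G₀)⁻¹ * G₀ᵀ * A) (M.ghat S a.1 a.2 M.θ₀ σ₀ (M.γhat a.1 a.2))) =o[whp P]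
      fun a => M.ghat S a.1 a.2 M.θ₀ σ₀ (M.γhat a.1 a.2) := by
  obtain ⟨c, hc, hcA⟩ := exists_pos_mul_sq_le hgmm.A_pos
  obtain ⟨c', hc', hcG⟩ := exists_pos_mul_norm_le hrank
  have hlim := hest.tendsto hM hreg hgmm hS hS' hρ (hG₀ ▸ hrank) hγ hg
  -- The truth is interior, so the linearized minimizer is eventually a feasible competitor.
  have hU : {η : EuclideanSpace ℝ (EtaIdx K) | thetaPart η ∈ Θ ∧ sigmaPart η ∈ Sig} ∈
      𝓝 (stack M.θ₀ σ₀) := by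
    have c1 : Continuous fun η : EuclideanSpace ℝ (EtaIdx K) => thetaPart η := by
      unfold thetaPart; fun_prop
    have c2 : Continuous fun η : EuclideanSpace ℝ (EtaIdx K) => sigmaPart η := by
      unfold sigmaPart; fun_prop
    exact inter_mem (c1.continuousAt.preimage_mem_nhds (mem_interior_iff_mem_nhds.1 hgmm.θ₀_int))
      (c2.continuousAt.preimage_mem_nhds (mem_interior_iff_mem_nhds.1 hgmm.σ₀_int))
  have hAt : Aᵀ = A := by simpa using hgmm.A_pos.1.eq
  refine isLittleO_argmin_sub (T := fun a : ℕ × Ω => mulL (An a.1 a.2)) (A := mulL A)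
    (G := mulL G₀) (L := mulL ((G₀ᵀ * A * G₀)⁻¹ * G₀ᵀ * A)) hgmm.tendsto_mulL ?_ hc hcA hc' hcG ?_
    (g := fun a η => M.ghat S a.1 a.2 (thetaPart η) (sigmaPart η) (M.γhat a.1 a.2))
    (η₀ := stack M.θ₀ σ₀) hU ((continuous_stack.tendsto (M.θ₀, σ₀)).comp hlim) ?_
    (hgmm.tendsto_ghat_true hM hreg hS' hρ hγ hg) ?_
  · intro v w
    rw [mulL_apply, mulL_apply, inner_mulE_left, hAt]
  · intro e v
    have hdet : IsUnit (G₀ᵀ * A * G₀).det := (Matrix.isUnit_iff_isUnit_det _).1 hrank.isUnit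
    simp only [mulL_apply]
    rw [inner_mulE_left]
    have : mulE G₀ᵀ (mulE A (v - mulE G₀ (mulE ((G₀ᵀ * A * G₀)⁻¹ * G₀ᵀ * A) v))) = 0 := by
      rw [← mulE_mul, ← mulL_apply (G₀ᵀ * A), map_sub, mulL_apply, mulL_apply, ← mulE_mul,
        ← mulE_mul, ← Matrix.mul_assoc, ← Matrix.mul_assoc,
        Matrix.mul_nonsing_inv _ hdet, Matrix.one_mul, sub_self]
    rw [this, inner_zero_right]
  · intro y hy
    rw [hG₀]
    exact hgmm.isLittleO_ghat_sub hρ M.θ₀ σ₀ hy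
  · filter_upwards [eventually_whp_of_forall_ae hest.isMin] with a ha η hη
    have := ha.2.2 _ hη.1 _ hη.2
    rwa [criterion_eq, criterion_eq] at this

end RCModel

end CategoricalRC

end

/-! ### The limit laws -/

theorem theorem5 {Ω Ω' : Type*} [MeasurableSpace Ω] [MeasurableSpace Ω']
    (P : Measure Ω) [IsProbabilityMeasure P] (P' : Measure Ω') [IsProbabilityMeasure P']
    {p K S : ℕ} (hS : 2 * K - 1 < S) (hS' : S ≤ 4 * K - 2)
    (M : RCModel Ω p K) (hM : M.IsModel P)
    -- regularity of errors and regressors, and the variance of the least squares score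
    (Qww : Matrix (Fin (p + 1)) (Fin (p + 1)) ℝ) (qwy : EuclideanSpace ℝ (Fin (p + 1)))
    (hreg : M.Regularity P Qww qwy)
    (Vwξ : Matrix (Fin (p + 1)) (Fin (p + 1)) ℝ) (hV : M.ScoreVariance P Vwξ)
    -- the limits that define the population moment function and the true value of `σ`
    (ρ : ℕ → ℕ → EuclideanSpace ℝ (Fin p) → ℝ) (hρ : M.IsPopMoment P S ρ)
    (σ₀ : EuclideanSpace ℝ (SigmaIdx K)) (hσ : M.IsErrorMoment P σ₀)
    -- parameter space, weighting matrices, and the GMM estimator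
    (Θ : Set (EuclideanSpace ℝ (ThetaIdx K))) (Sig : Set (EuclideanSpace ℝ (SigmaIdx K)))
    (An : ℕ → Ω → Matrix (MomIdx K S) (MomIdx K S) ℝ) (A : Matrix (MomIdx K S) (MomIdx K S) ℝ)
    (hgmm : M.GMMConditions P S Θ Sig σ₀ An A)
    (θhat : ℕ → Ω → EuclideanSpace ℝ (ThetaIdx K)) (σhat : ℕ → Ω → EuclideanSpace ℝ (SigmaIdx K))
    (hest : M.IsGMM P S Θ Sig An θhat σhat)
    -- the derivatives of the population moment function, and the full rank condition
    (G₀ : Matrix (MomIdx K S) (EtaIdx K) ℝ) (hG₀ : G₀ = GEta S ρ M.θ₀ σ₀ M.γ)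
    (Gγ : Matrix (MomIdx K S) (Fin p) ℝ) (hGγ : Gγ = GGamma S ρ M.θ₀ σ₀ M.γ)
    (hrank : (G₀ᵀ * A * G₀).PosDef)
    -- asymptotic normality of the sample moments at the true parameters
    (V : Matrix (MomIdx K S) (MomIdx K S) ℝ) (hVpsd : V.PosSemidef)
    (ζ : Ω' → EuclideanSpace ℝ (MomIdx K S)) (hζ : HasLaw ζ (multivariateGaussian 0 V) P')
    (hg : TendstoInDistribution (fun (n : ℕ) ω => √(n : ℝ) • M.ghat S n ω M.θ₀ σ₀ M.γ)
      atTop ζ (fun _ => P) P') :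
    -- the limit law of `√n (γhat - γ)`
    TendstoInDistribution (fun (n : ℕ) ω => √(n : ℝ) • (M.γhat n ω - M.γ)) atTop
      (id : EuclideanSpace ℝ (Fin p) → EuclideanSpace ℝ (Fin p)) (fun _ => P)
      (multivariateGaussian 0 ((Qww⁻¹ * Vwξ * Qww⁻¹).submatrix Fin.succ Fin.succ)) ∧
    -- the limit law of `√n (ηhat - η₀)`, for every jointly normal joint limit `(ζ, ζγ)`
    ∀ ζγ : Ω' → EuclideanSpace ℝ (Fin p),
      HasGaussianLaw (fun ω' => (ζ ω', ζγ ω')) P' →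
      TendstoInDistribution
        (fun (n : ℕ) ω =>
          (√(n : ℝ) • M.ghat S n ω M.θ₀ σ₀ M.γ, √(n : ℝ) • (M.γhat n ω - M.γ)))
        atTop (fun ω' => (ζ ω', ζγ ω')) (fun _ => P) P' →
      TendstoInDistribution
        (fun (n : ℕ) ω => √(n : ℝ) • (stack (θhat n ω) (σhat n ω) - stack M.θ₀ σ₀))
        atTop
        (fun ω' => mulE ((G₀ᵀ * A * G₀)⁻¹ * G₀ᵀ * A) (ζ ω' + mulE Gγ (ζγ ω')))
        (fun _ => P) P' := by
  have hlimγ := RCModel.tendstoInDistribution_γhat hM hreg hV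
  refine ⟨hlimγ, fun ζγ hG hjoint => ?_⟩
  have hγ0 := tendsto_whp_zero_of_tendstoInDistribution hlimγ
  have hg0 := tendsto_whp_zero_of_tendstoInDistribution hg
  have H1 := hest.isLittleO_sub hM hreg hgmm hS hS' hρ hG₀ hrank hγ0 hg0
  have H2 := hgmm.isLittleO_ghat_γhat_sub hM hreg hS' hρ hγ0 M.θ₀ σ₀
  rw [← hGγ] at H2
  set L := (G₀ᵀ * A * G₀)⁻¹ * G₀ᵀ * A
  set Φ : EuclideanSpace ℝ (MomIdx K S) × EuclideanSpace ℝ (Fin p) →L[ℝ]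
      EuclideanSpace ℝ (EtaIdx K) := mulL L ∘L (ContinuousLinearMap.fst ℝ _ _ +
        mulL Gγ ∘L ContinuousLinearMap.snd ℝ _ _)
  have hΦ_apply : ∀ v d, Φ (v, d) = mulL L (v + mulL Gγ d) := fun _ _ => rfl
  -- The expansion yields the limit `-Φ (ζ, ζγ)`; symmetry of a centered normal law removes the
  -- sign. That `ζγ` is centered follows from uniqueness of limits: its law is the normal limit
  -- already found for `γhat`.
  have hlaw : P'.map (fun ω' => -Φ (ζ ω', ζγ ω')) = P'.map fun ω' => Φ (ζ ω', ζγ ω') := by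
    have hζ0 : ∫ ω', ζ ω' ∂P' = 0 := by
      rw [hζ.integral_eq, integral_id_multivariateGaussian]
    have hζγ0 : ∫ ω', ζγ ω' ∂P' = 0 := by
      have h1 := tendstoInDistribution_unique _ (hjoint.continuous_comp continuous_snd) hlimγ
      have h2 : ∫ ω', ζγ ω' ∂P' = ∫ x, x ∂(P'.map ζγ) :=
        (integral_map hG.snd.aemeasurable aestronglyMeasurable_id).symm
      have h3 : P'.map ζγ = P'.map (Prod.snd ∘ fun ω' => (ζ ω', ζγ ω')) := rfl
      rw [h2, h3, h1, Measure.map_id, integral_id_multivariateGaussian]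
    refine map_neg_eq_of_hasGaussianLaw (hG.map_fun Φ) ?_
    have hi : Integrable (fun ω' => mulL Gγ (ζγ ω')) P' :=
      (mulL Gγ).integrable_comp hG.snd.integrable
    have hi' : Integrable (fun ω' => ζ ω' + mulL Gγ (ζγ ω')) P' := hG.fst.integrable.add hi
    simp_rw [hΦ_apply]
    rw [(mulL L).integral_comp_comm hi', integral_add hG.fst.integrable hi,
      (mulL Gγ).integral_comp_comm hG.snd.integrable, hζ0, hζγ0]
    simp
  have hX := tendstoInDistribution_of_map_eq (hjoint.continuous_comp Φ.continuous.neg)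
    (Φ.continuous.measurable.comp_aemeasurable hjoint.aemeasurable_limit) hlaw
  refine tendstoInDistribution_of_tendstoInMeasure_sub _ _ hX ?_ fun n => ?_
  · have hb := bddInProb_norm_of_tendstoInDistribution hjoint
    -- A common scale for all error terms: bounded in probability, and larger than both components
    -- since the product carries the maximum norm.
    set b : ℕ → Ω → ℝ := fun n ω =>
      ‖(√(n : ℝ) • M.ghat S n ω M.θ₀ σ₀ M.γ, √(n : ℝ) • (M.γhat n ω - M.γ))‖
    have hsqrt := Asymptotics.isBigO_refl (fun a : ℕ × Ω => √(a.1 : ℝ)) (whp P)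
    have o1 : (fun a : ℕ × Ω => √(a.1 : ℝ) • M.ghat S a.1 a.2 M.θ₀ σ₀ M.γ) =O[whp P]
        fun a => b a.1 a.2 :=
      Asymptotics.IsBigO.of_norm_le fun a => le_max_left _ _
    have o2 : (fun a : ℕ × Ω => √(a.1 : ℝ) • (M.γhat a.1 a.2 - M.γ)) =O[whp P]
        fun a => b a.1 a.2 :=
      Asymptotics.IsBigO.of_norm_le fun a => le_max_right _ _
    have o3 := (hsqrt.smul_isLittleO H2).trans_isBigO o2
    have o4 : (fun a : ℕ × Ω => √(a.1 : ℝ) • M.ghat S a.1 a.2 M.θ₀ σ₀ (M.γhat a.1 a.2)) =O[whp P]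
        fun a => b a.1 a.2 := by
      refine ((o3.isBigO.add o1).add (((mulL Gγ).isBigO_comp _ _).trans o2)).congr_left fun a => ?_
      simp only [← mulL_apply, map_smul, map_sub, smul_sub]
      abel
    have o5 := (hsqrt.smul_isLittleO H1).trans_isBigO o4
    have o6 := o5.sub (((mulL L).isBigO_comp _ _).trans_isLittleO o3)
    have hlim := tendsto_whp_zero_of_isLittleO o6 hb
    refine tendsto_whp_iff.1 (hlim.congr fun a => ?_)
    simp only [Pi.sub_apply, Pi.neg_apply, Function.comp_apply, hΦ_apply, ← mulL_apply, map_smul, map_sub,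
      map_add, smul_sub, smul_add]
    abel
  · have h1 : AEMeasurable (fun ω => stack (θhat n ω) (σhat n ω)) P :=
      continuous_stack.measurable.comp_aemeasurable ((hest.meas_θ n).prodMk (hest.meas_σ n))
    fun_prop
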